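/- **Setting.** Let $\mathfrak a=1/\sqrt2$. For $f\in L^2(\mathbb R)$ put $$\mathcal Gf(x,y)=2^{1/4}\int_{\mathbb R} f(t)e^{-\pi(t-x)^2}e^{-2\pi i y t}\,dt,\qquad \mathcal Sf=|\mathcal Gf|^2 .$$ For $T,S,R,s>0$ let $\Lambda=([-T,T]\times[-S,S])\cap\mathfrak a\mathbb Z^2$, $\Omega=([-T-R,T+R]\times[-S-R,S+R])\cap s\mathbb Z^2$, $\Gamma=([-T-2R,T+2R]\times[-S-2R,S+2R])\cap\mathfrak a\mathbb Z^2$; write $\|\mathcal Gf\|_{\ell^2(\Lambda)}^2=\sum_{\lambda\in\Lambda}|\mathcal Gf(\lambda)|^2$. *Spectral gap.* For $r>0$, let $u\sim v$ for $u,v\in\Lambda$ mean $0<|u-v|<r$, and let $\mathcal L\in\mathbb R^{\Lambda\times\Lambda}$ be the Laplacian of this graph with vertex weights $\alpha_v=\mathcal Sf(v)$: $\mathcal L_{u,u}=\sum_{z\sim u}\alpha_z$, $\mathcal L_{u,v}=-\sqrt{\alpha_u\alpha_v}$ if $u\sim v$, and $\mathcal L_{u,v}=0$ otherwise. Let $\lambda_2(f,\Lambda,r)$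 be its second smallest eigenvalue, counted with multiplicity ($:=0$ if $|\Lambda|<2$). *Well-calibrated parameters.* The numbers $T,S,R,r,s,\varepsilon,\varepsilon'>0$ are well calibrated (for $f$) if $$\varepsilon\le\Big[\tfrac{e^{-\frac{17\pi}{32}r^2}}{1.33\times10^5}\min\Big\{\tfrac{\|\mathcal Gf\|^2_{\ell^2(\Lambda)}}{|\Lambda|^2},\tfrac{\lambda_2(f,\Lambda,r)}{192r^2}\Big\}\Big]^2,\qquad \varepsilon'=(3.1\times10^4)\sqrt\varepsilon\,e^{\frac{17\pi}{32}r^2},$$ $$s\le\frac{0.3}{\sqrt{\ln\frac{2}{3\varepsilon}}},\qquad R\ge\max\Big\{2.1+0.9\sqrt{\ln\tfrac1\varepsilon},\ \tfrac{r+s^{-1}}2\Big\}.$$ *The two convex programs.* For $\lambda,\mu\in\mathbb R^2$ and $z\in\mathbb C^2$ let $$\Phi_{\lambda,\mu}(z)=e^{-\frac\pi4|\lambda-\mu|^2+\pi i(\lambda_1\lambda_2-\mu_1\mu_2)}\,e^{i\pi(z_1(\lambda_2-\mu_2)-z_2(\lambda_1-\mu_1))}\,e^{-\pi\sum_{j=1}^2(z_j-\frac{\lambda_j+\mu_j}2)^2},$$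 and for $A\in\mathbb C^{\Gamma\times\Gamma}$ let $F_A=\sum_{\lambda,\mu\in\Gamma}A_{\lambda,\mu}\Phi_{\lambda,\mu}$. For $G:\mathbb C^2\to\mathbb C$ and $p,u\in\mathbb R^2$ let $$\mathcal E[G](p,u)=G\Big(p+\tfrac12\begin{pmatrix}1&-i\\ i&1\end{pmatrix}u\Big)\,e^{-\frac\pi2|u|^2-\pi i(2p_1+u_1)u_2}.$$ Given $\sigma\in\mathbb R^\Omega$, program 1 is: minimize $\max_{\lambda\in\Gamma}A_{\lambda,\lambda}$ over all positive semidefinite $A\in\mathbb C^{\Gamma\times\Gamma}$ with $|F_A(\omega)-\sigma_\omega|\le\varepsilon$ for all $\omega\in\Omega$. Given a solution $A_*$ of program 1, program 2 is: find a positive semidefinite $Y\in\mathbb C^{\Lambda\times\Lambda}$ with $|Y_{\lambda',\lambda}-\mathcal E[F_{A_*}](\lambda,\lambda'-\lambda)|\le\varepsilon'$ for all $\lambda,\lambda'\in\Lambda$ with $|\lambda-\lambda'|\le r$. **Theorem.** Let $f\in L^2(\mathbb R)$ with $\|\mathcal Sf\|_{L^\infty(\mathbb R^2)}\le1$, let $T,S,R,r,s,\varepsilon,\varepsilon'$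 be well calibrated, and let $\sigma\in\mathbb R^\Omega$ satisfy $|\sigma_\omega-\mathcal Sf(\omega)|\le\varepsilon/2$ for all $\omega\in\Omega$. Then program 1 is feasible and has a solution, and for every solution $A_*$ of program 1, program 2 is feasible. Moreover, for every solution $A_*$ of program 1 and every feasible $Y$ of program 2, the largest eigenvalue of $Y$ is simple, and every eigenvector $v\in\mathbb C^\Lambda$ of $Y$ for this eigenvalue with Euclidean norm $|v|=1$ satisfies $$\min_{\theta\in\mathbb R}\Big|\sqrt{\operatorname{tr}(Y)}\,v-e^{i\theta}(\mathcal Gf(\lambda))_{\lambda\in\Lambda}\Big|\le177\,e^{0.84r^2}\Big(1+20r\sqrt{\frac{\|\mathcal Gf\|^2_{\ell^2(\Lambda)}}{\lambda_2(f,\Lambda,r)}}\Big)\sqrt[4]{\varepsilon}.$$ -/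

import Mathlib

open MeasureTheory
open scoped ComplexOrder

noncomputable section

/-- The plane `ℝ²` with its Euclidean norm. -/
abbrev Plane : Type := EuclideanSpace ℝ (Fin 2)

/-! ### The Gabor transform -/

/-- `𝒢f(x,y) = 2^{1/4} ∫ f(t) e^{-π(t-x)²} e^{-2πiyt} dt`, at the point `p = (x,y)`. -/
def gabor (f : ℝ → ℂ) (p : Plane) : ℂ :=
  (((2 : ℝ) ^ (1 / 4 : ℝ) : ℝ) : ℂ) *
    ∫ t : ℝ, f t * Complex.exp (-(Real.pi : ℂ) * ((t : ℂ) - (p 0 : ℂ)) ^ 2) *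
      Complex.exp (-2 * (Real.pi : ℂ) * Complex.I * (p 1 : ℂ) * (t : ℂ))

/-- The spectrogram `𝒮f = |𝒢f|²`. -/
def spectrogram (f : ℝ → ℂ) (p : Plane) : ℝ := ‖gabor f p‖ ^ 2

/-- `‖𝒢f‖²_{ℓ²(Λ)}`. -/
def gaborEnergy (f : ℝ → ℂ) (Λ : Set Plane) [Fintype Λ] : ℝ :=
  ∑ l : Λ, ‖gabor f l‖ ^ 2

/-- The vector `(𝒢f(λ))_{λ ∈ Λ}` in `ℂ^Λ` with the Euclidean norm. -/
def gaborSamples (f : ℝ → ℂ) (Λ : Set Plane) [Fintype Λ] : EuclideanSpace ℂ Λ :=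
  WithLp.toLp 2 (fun l : Λ => gabor f l)

/-! ### Index sets -/

/-- `([-T,T] × [-S,S]) ∩ hℤ²`. -/
def latticeRect (h T S : ℝ) : Set Plane :=
  {p | |p 0| ≤ T ∧ |p 1| ≤ S ∧ ∃ m n : ℤ, p 0 = h * m ∧ p 1 = h * n}

theorem latticeRect_finite {h : ℝ} (hh : 0 < h) (T S : ℝ) : (latticeRect h T S).Finite := by
  have key : ∀ (B x : ℝ) (m : ℤ), |x| ≤ B → x = h * m → m ∈ Set.Icc (-⌈B / h⌉) ⌈B / h⌉ := by
    intro B x m hx hm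
    subst hm
    rw [abs_mul, abs_of_pos hh] at hx
    have h1 : |(m : ℝ)| ≤ B / h := by rw [le_div_iff₀ hh]; linarith
    have h2 : |(m : ℝ)| ≤ (⌈B / h⌉ : ℝ) := h1.trans (Int.le_ceil _)
    have h3 := abs_le.mp h2
    constructor
    · exact_mod_cast h3.1
    · exact_mod_cast h3.2
  refine (((Set.finite_Icc (-⌈T / h⌉) ⌈T / h⌉).prod
    (Set.finite_Icc (-⌈S / h⌉) ⌈S / h⌉)).image
      (fun q : ℤ × ℤ => (!₂[h * (q.1 : ℝ), h * (q.2 : ℝ)] : Plane))).subset ?_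
  rintro p ⟨h0, h1, m, n, hm, hn⟩
  refine ⟨(m, n), ⟨key T _ m h0 hm, key S _ n h1 hn⟩, ?_⟩
  ext i
  fin_cases i
  · simp [hm]
  · simp [hn]

/-- The mesh size `𝔞 = 1/√2`. -/
def meshA : ℝ := 1 / Real.sqrt 2

theorem meshA_pos : 0 < meshA := by
  unfold meshA
  positivity

/-- `([-T,T] × [-S,S]) ∩ 𝔞ℤ²`. -/
def gaborRect (T S : ℝ) : Set Plane := latticeRect meshA T S

instance gaborRect.instFintype (T S : ℝ) : Fintype (gaborRect T S) :=
  (latticeRect_finite meshA_pos T S).fintype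

/-- The set `Λ = ([-T,T] × [-S,S]) ∩ 𝔞ℤ²`. -/
abbrev setLambda (T S : ℝ) : Set Plane := gaborRect T S

/-- The set `Ω = ([-T-R,T+R] × [-S-R,S+R]) ∩ sℤ²` of sampling positions. -/
abbrev setOmega (T S R s : ℝ) : Set Plane := latticeRect s (T + R) (S + R)

/-- The set `Γ = ([-T-2R,T+2R] × [-S-2R,S+2R]) ∩ 𝔞ℤ²`. -/
abbrev setGamma (T S R : ℝ) : Set Plane := gaborRect (T + 2 * R) (S + 2 * R)

/-! ### Vertex-weighted graphs and the spectral gap -/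

open Classical in
/-- The Laplacian of the graph `G` with vertex weights `α`. -/
def weightedLaplacian {V : Type} [Fintype V] (G : SimpleGraph V) (α : V → ℝ) : Matrix V V ℝ :=
  fun u v =>
    if u = v then ∑ z ∈ Finset.univ.filter (fun z => G.Adj u z), α z
    else if G.Adj u v then -Real.sqrt (α u * α v)
    else 0

theorem weightedLaplacian_isHermitian {V : Type} [Fintype V] (G : SimpleGraph V) (α : V → ℝ) :
    (weightedLaplacian G α).IsHermitian := by
  ext u v
  simp only [Matrix.conjTranspose_apply, star_trivial, weightedLaplacian]
  by_cases h : u = v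
  · subst h
    simp
  · have h' : ¬ v = u := fun e => h e.symm
    have h2 : G.Adj v u ↔ G.Adj u v := G.adj_comm v u
    by_cases ha : G.Adj u v
    · simp [h, h', ha, h2.mpr ha, mul_comm (α u) (α v)]
    · simp [h, h', ha, mt h2.mp ha]

open Classical in
/-- The second smallest eigenvalue (with multiplicity) of the Laplacian of `(V, E, α)`.
`eigenvalues₀` is sorted in decreasing order, so this is the entry with index `|V| - 2`.
A graph with fewer than two vertices has no second eigenvalue; the value is then set to `0`. -/
def secondEigenvalue {V : Type} [Fintype V] (G : SimpleGraph V) (α : V → ℝ) : ℝ :=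
  if h : 2 ≤ Fintype.card V then
    (weightedLaplacian_isHermitian G α).eigenvalues₀
      ⟨Fintype.card V - 2, Nat.sub_lt (lt_of_lt_of_le Nat.zero_lt_two h) Nat.zero_lt_two⟩
  else 0

/-- The graph on `Λ` in which `u ∼ v` iff `0 < |u - v| < r`. -/
def proximityGraph (Λ : Set Plane) (r : ℝ) : SimpleGraph Λ where
  Adj u v := 0 < ‖(u : Plane) - v‖ ∧ ‖(u : Plane) - v‖ < r
  symm := ⟨fun u v h => by rwa [norm_sub_rev (v : Plane) (u : Plane)]⟩
  loopless := ⟨fun u h => by simp at h⟩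

/-- The spectral gap `λ₂(f,Λ,r)` of the signal associated graph: vertex set `Λ`, edges between
points at distance in `(0,r)`, vertex weights `𝒮f`. -/
def spectralGap (f : ℝ → ℂ) (Λ : Set Plane) [Fintype Λ] (r : ℝ) : ℝ :=
  secondEigenvalue (proximityGraph Λ r) (fun u => spectrogram f u)

/-! ### Ansatz functions and the evaluation operator -/

/-- `C(λ,μ) = exp(-(π/4)|λ-μ|² + πi(λ₁λ₂ - μ₁μ₂))`. -/
def ansatzConst (l m : Plane) : ℂ :=
  Complex.exp (-((Real.pi : ℂ) / 4) * ((‖l - m‖ ^ 2 : ℝ) : ℂ) +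
    (Real.pi : ℂ) * Complex.I * ((l 0 : ℂ) * (l 1 : ℂ) - (m 0 : ℂ) * (m 1 : ℂ)))

/-- `Φ_{λ,μ}(z) = C(λ,μ) e^{iπ zᵀ𝒥(λ-μ)} e^{-π(z-(λ+μ)/2)²}` on `ℂ²`, where
`𝒥 = (0 1; -1 0)` and `w² = w₁² + w₂²`. -/
def ansatzKernel (l m : Plane) (z : Fin 2 → ℂ) : ℂ :=
  ansatzConst l m *
    Complex.exp (Complex.I * (Real.pi : ℂ) *
      (z 0 * ((l 1 : ℂ) - (m 1 : ℂ)) - z 1 * ((l 0 : ℂ) - (m 0 : ℂ)))) *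
    Complex.exp (-(Real.pi : ℂ) *
      ((z 0 - ((l 0 : ℂ) + (m 0 : ℂ)) / 2) ^ 2 + (z 1 - ((l 1 : ℂ) + (m 1 : ℂ)) / 2) ^ 2))

/-- `F_A(z) = ∑_{λ,μ ∈ Γ} A_{λ,μ} Φ_{λ,μ}(z)`. -/
def ansatzFun {Γ : Set Plane} [Fintype Γ] (A : Matrix Γ Γ ℂ) (z : Fin 2 → ℂ) : ℂ :=
  ∑ l : Γ, ∑ m : Γ, A l m * ansatzKernel l m z

/-- The inclusion `ℝ² ⊆ ℂ²`. -/
def toC2 (p : Plane) : Fin 2 → ℂ := fun i => (p i : ℂ)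

/-- `L(p,u) = p + ½ (1 -i; i 1) u`. -/
def evalL (p u : Plane) : Fin 2 → ℂ :=
  ![(p 0 : ℂ) + 1 / 2 * ((u 0 : ℂ) - Complex.I * (u 1 : ℂ)),
    (p 1 : ℂ) + 1 / 2 * (Complex.I * (u 0 : ℂ) + (u 1 : ℂ))]

/-- `Q(p,u) = -(π/2)|u|² - πi(2p₁+u₁)u₂`. -/
def evalQ (p u : Plane) : ℂ :=
  -((Real.pi : ℂ) / 2) * ((‖u‖ ^ 2 : ℝ) : ℂ) -
    (Real.pi : ℂ) * Complex.I * (2 * (p 0 : ℂ) + (u 0 : ℂ)) * (u 1 : ℂ)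

/-- The evaluation `ℰ[G](p,u) = G(L(p,u)) e^{Q(p,u)}`. -/
def evaluation (G : (Fin 2 → ℂ) → ℂ) (p u : Plane) : ℂ :=
  G (evalL p u) * Complex.exp (evalQ p u)

/-! ### The two convex programs -/

/-- Feasible set of the first program: `A ⪰ 0` with `|F_A(ω) - σ_ω| ≤ ε` for `ω ∈ Ω`. -/
def feasible1 (Γ Ω : Set Plane) [Fintype Γ] (σ : Ω → ℝ) (ε : ℝ) : Set (Matrix Γ Γ ℂ) :=
  {A | A.PosSemidef ∧ ∀ w : Ω, ‖ansatzFun A (toC2 w) - (σ w : ℂ)‖ ≤ ε}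

/-- Objective of the first program: `max_{λ ∈ Γ} A_{λ,λ}` (a diagonal entry of a positive
semidefinite matrix is real). -/
def objective1 {Γ : Set Plane} (A : Matrix Γ Γ ℂ) : ℝ := ⨆ l : Γ, (A l l).re

/-- `A` solves the first program: it is feasible and minimizes the objective. -/
def IsSolution1 (Γ Ω : Set Plane) [Fintype Γ] (σ : Ω → ℝ) (ε : ℝ) (A : Matrix Γ Γ ℂ) : Prop :=
  A ∈ feasible1 Γ Ω σ ε ∧ IsMinOn objective1 (feasible1 Γ Ω σ ε) A

/-- Feasible set of the second program: `Y ⪰ 0` such that `|Y_{λ',λ} - T_{λ',λ}| ≤ ε'` whenever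
`|λ - λ'| ≤ r`, where `T_{λ',λ} = ℰ[F_A](λ, λ' - λ)`. -/
def feasible2 (Λ : Set Plane) {Γ : Set Plane} [Fintype Γ] (A : Matrix Γ Γ ℂ) (r ε' : ℝ) :
    Set (Matrix Λ Λ ℂ) :=
  {Y | Y.PosSemidef ∧ ∀ l l' : Λ, ‖(l : Plane) - l'‖ ≤ r →
    ‖Y l' l - evaluation (ansatzFun A) l ((l' : Plane) - l)‖ ≤ ε'}

open Classical in
/-- `η` is the largest eigenvalue of the Hermitian matrix `Y`. -/
def IsTopEigenvalue {ι : Type} [Fintype ι] (Y : Matrix ι ι ℂ) (η : ℝ) : Prop :=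
  Module.End.HasEigenvalue (Matrix.toEuclideanLin Y) (η : ℂ) ∧
    ∀ μ : ℝ, Module.End.HasEigenvalue (Matrix.toEuclideanLin Y) (μ : ℂ) → μ ≤ η

open Classical in
/-- The largest eigenvalue of `Y` is simple. -/
def HasSimpleTopEigenvalue {ι : Type} [Fintype ι] (Y : Matrix ι ι ℂ) : Prop :=
  ∃ η : ℝ, IsTopEigenvalue Y η ∧
    Module.finrank ℂ (Module.End.eigenspace (Matrix.toEuclideanLin Y) (η : ℂ)) = 1

open Classical in
/-- `v` is a normalized eigenvector for the largest eigenvalue of `Y`. -/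
def IsTopEigenvector {ι : Type} [Fintype ι] (Y : Matrix ι ι ℂ) (v : EuclideanSpace ℂ ι) : Prop :=
  ‖v‖ = 1 ∧ ∃ η : ℝ, IsTopEigenvalue Y η ∧
    Module.End.HasEigenvector (Matrix.toEuclideanLin Y) (η : ℂ) v

/-! ### Parameters -/

/-- Well calibrated parameters, for `Λ = ([-T,T] × [-S,S]) ∩ 𝔞ℤ²`. -/
structure WellCalibrated (f : ℝ → ℂ) (T S R r s ε ε' : ℝ) : Prop where
  T_pos : 0 < T
  S_pos : 0 < S
  R_pos : 0 < R
  r_pos : 0 < r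
  s_pos : 0 < s
  eps_pos : 0 < ε
  eps'_pos : 0 < ε'
  eps_le : ε ≤ (Real.exp (-(17 * Real.pi / 32) * r ^ 2) / (1.33 * 10 ^ 5) *
    min (gaborEnergy f (setLambda T S) / (Fintype.card (setLambda T S) : ℝ) ^ 2)
      (spectralGap f (setLambda T S) r / (192 * r ^ 2))) ^ 2
  eps'_eq : ε' = 3.1 * 10 ^ 4 * Real.sqrt ε * Real.exp (17 * Real.pi / 32 * r ^ 2)
  s_le : s ≤ 0.3 / Real.sqrt (Real.log (2 / (3 * ε)))
  R_ge : max (2.1 + 0.9 * Real.sqrt (Real.log (1 / ε))) ((r + s⁻¹) / 2) ≤ R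

end

/-! The products `𝒢f(λ') · conj 𝒢f(λ)` for nearby `λ, λ'` are read off a holomorphic extension of
the spectrogram to `ℂ²`, and connectivity of the weighted graph on `Λ` glues these local products
into one vector up to a global phase.

Ansatz. By `ansatzKernel_evalL`, `ℰ` turns `Φ_{λ,μ}` into `K(p+u,λ) · conj K(p,μ)`, where `K(·,λ)`
is the Gabor transform of a time-frequency shifted Gaussian. Hence `F_A` with `A = c c*` evaluates
to products of `∑ c_λ K(·,λ)`. Coefficients with `|c_λ| ≤ 1` that reproduce `𝒢f` to within `ε/8` on
the enlarged box come from the redundancy-two Gabor system on `𝔞ℤ²`. Two Poisson summations show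
that synthesis from the samples of `𝒢f` equals `2W𝒢f`, with `W` a weighted sum of shifts by the
adjoint lattice `2𝔞ℤ²`. In the sup norm `‖1 - W‖ ≤ 1/2`, and synthesis commutes with `W`, so a
truncated Neumann series inverts `W` with bounded coefficients (`exists_bounded_expansion`). This
makes program 1 feasible with objective at most 1.

Stability. A minimizer therefore has all entries bounded by 1, so its difference `B` from the
rank-one candidate has entries bounded by 2 and `|F_B| ≤ 2ε` on `Ω`. Since `F_B` is entire and grows
at most like `exp(2π|Im z|²)`, a Gaussian damping factor localizes it. A one-dimensional sampling
estimate (`norm_le_of_samples`), used once per coordinate, bounds it on all of `ℝ²` by a multiple of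
`ε`. The three lines theorem carries the bound to the complex points needed by `ℰ`, at the price of
turning `ε` into `√ε` (`norm_evaluation_le_of_samples`). Thus the data of program 2 are within `ε'`
of `x x*`, where `x = (𝒢f(λ))_{λ∈Λ}`, and `x x*` is feasible there.

Gluing. Any feasible `Y` agrees with `x x*` up to `2ε'` on the diagonal and along the edges. For `Y
= ∑ y_j y_j*`, the Laplacian form with weights `|x_v|²` measures how far each `y_j` is from a
multiple of `x`. Summed over `j`, this form involves only diagonal and edge entries of `Y`. The
spectral gap then shows that nearly all of `tr Y` lies in the direction of `x`
(`secondEigenvalue_mul_trace_sub_le`). This forces a simple top eigenvalue and an eigenvector close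
to `x` (`topEigenvector_close`). The rest is bookkeeping of constants. -/

noncomputable section

/-! ### Functions of Gaussian growth on strips -/

/-- Three lines theorem for an entire function of Gaussian growth in the imaginary direction. -/
theorem norm_le_interp_of_gaussian_growth {g : ℂ → ℂ} (hg : Differentiable ℂ g) {K κ M : ℝ}
    (hK : 0 ≤ K) (hκ : 0 ≤ κ)
    (hgrow : ∀ x y : ℝ, ‖g (x + y * Complex.I)‖ ≤ K * Real.exp (κ * y ^ 2))
    (hreal : ∀ x : ℝ, ‖g x‖ ≤ M) (x Y : ℝ) {θ : ℝ} (hθ0 : 0 ≤ θ) (hθ1 : θ ≤ 1) :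
    ‖g (x + (θ * Y : ℝ) * Complex.I)‖ ≤
      M ^ (1 - θ) * (K * Real.exp (κ * Y ^ 2)) ^ θ := by
  have hform : ∀ z : ℂ, (x : ℂ) + Complex.I * Y * z =
      ((x - Y * z.im : ℝ) : ℂ) + ((Y * z.re : ℝ) : ℂ) * Complex.I := by
    intro z
    apply Complex.ext <;> simp [sub_eq_add_neg]
  have hd : Differentiable ℂ fun z : ℂ => g (x + Complex.I * Y * z) :=
    hg.comp (by fun_prop)
  have h := Complex.HadamardThreeLines.norm_le_interp_of_mem_verticalClosedStrip₀₁'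
    (fun z : ℂ => g (x + Complex.I * Y * z)) (z := (θ : ℂ)) (a := M)
    (b := K * Real.exp (κ * Y ^ 2)) ?_ hd.diffContOnCl ?_ ?_ ?_
  · simp only [Complex.ofReal_re] at h
    have e : (x : ℂ) + (θ * Y : ℝ) * Complex.I = x + Complex.I * Y * θ := by push_cast; ring
    rw [e]
    exact h
  · simpa [Complex.HadamardThreeLines.verticalClosedStrip] using ⟨hθ0, hθ1⟩
  · refine ⟨K * Real.exp (κ * Y ^ 2), ?_⟩
    rintro _ ⟨z, hz, rfl⟩
    simp only [Complex.HadamardThreeLines.verticalClosedStrip, Set.mem_preimage, Set.mem_Icc] at hz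
    simp only [Function.comp_apply, hform]
    refine (hgrow _ _).trans ?_
    have h1 : z.re ^ 2 ≤ 1 := by nlinarith [hz.1, hz.2]
    have h2 : (Y * z.re) ^ 2 ≤ Y ^ 2 := by rw [mul_pow]; nlinarith [sq_nonneg Y]
    gcongr
  · intro z hz
    simp only [Set.mem_preimage, Set.mem_singleton_iff] at hz
    simp only [hform, hz, mul_zero, Complex.ofReal_zero, zero_mul, add_zero]
    exact hreal _
  · intro z hz
    simp only [Set.mem_preimage, Set.mem_singleton_iff] at hz
    simp only [hform, hz, mul_one]
    exact hgrow _ _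

/-! ### Cubic interpolation at four equidistant nodes -/

theorem exists_deriv_zero_between {f f' : ℝ → ℝ} (hf : ∀ t, HasDerivAt f (f' t) t) {a b : ℝ}
    (hab : a < b) (ha : f a = 0) (hb : f b = 0) : ∃ c, a < c ∧ c < b ∧ f' c = 0 := by
  obtain ⟨c, hc, h⟩ := exists_hasDerivAt_eq_zero hab
    (fun t _ => (hf t).continuousAt.continuousWithinAt) (ha.trans hb.symm) (fun t _ => hf t)
  exact ⟨c, hc.1, hc.2, h⟩

theorem exists_fourth_deriv_zero {f₀ f₁ f₂ f₃ f₄ : ℝ → ℝ} (h₀ : ∀ t, HasDerivAt f₀ (f₁ t) t)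
    (h₁ : ∀ t, HasDerivAt f₁ (f₂ t) t) (h₂ : ∀ t, HasDerivAt f₂ (f₃ t) t)
    (h₃ : ∀ t, HasDerivAt f₃ (f₄ t) t) {a b c d e : ℝ} (hab : a < b) (hbc : b < c) (hcd : c < d)
    (hde : d < e) (ha : f₀ a = 0) (hb : f₀ b = 0) (hc : f₀ c = 0) (hd : f₀ d = 0) (he : f₀ e = 0) :
    ∃ t, f₄ t = 0 := by
  obtain ⟨p₁, -, p₁', p₁0⟩ := exists_deriv_zero_between h₀ hab ha hb
  obtain ⟨p₂, p₂l, p₂', p₂0⟩ := exists_deriv_zero_between h₀ hbc hb hc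
  obtain ⟨p₃, p₃l, p₃', p₃0⟩ := exists_deriv_zero_between h₀ hcd hc hd
  obtain ⟨p₄, p₄l, -, p₄0⟩ := exists_deriv_zero_between h₀ hde hd he
  obtain ⟨q₁, -, q₁', q₁0⟩ := exists_deriv_zero_between h₁ (p₁'.trans p₂l) p₁0 p₂0
  obtain ⟨q₂, q₂l, q₂', q₂0⟩ := exists_deriv_zero_between h₁ (p₂'.trans p₃l) p₂0 p₃0
  obtain ⟨q₃, q₃l, -, q₃0⟩ := exists_deriv_zero_between h₁ (p₃'.trans p₄l) p₃0 p₄0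
  obtain ⟨r₁, -, r₁', r₁0⟩ := exists_deriv_zero_between h₂ (q₁'.trans q₂l) q₁0 q₂0
  obtain ⟨r₂, r₂l, -, r₂0⟩ := exists_deriv_zero_between h₂ (q₂'.trans q₃l) q₂0 q₃0
  obtain ⟨t, -, -, ht⟩ := exists_deriv_zero_between h₃ (r₁'.trans r₂l) r₁0 r₂0
  exact ⟨t, ht⟩

/-- The vanishing last term keeps the derivative in the shape of a quartic, so that the lemma can be
applied again to its own output. -/
theorem hasDerivAt_quartic (a b c d e t : ℝ) :
    HasDerivAt (fun t : ℝ => a + b * t + c * t ^ 2 + d * t ^ 3 + e * t ^ 4)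
      (b + 2 * c * t + 3 * d * t ^ 2 + 4 * e * t ^ 3 + 0 * t ^ 4) t := by
  have h1 := (hasDerivAt_id t).const_mul b
  have h2 := (hasDerivAt_pow 2 t).const_mul c
  have h3 := (hasDerivAt_pow 3 t).const_mul d
  have h4 := (hasDerivAt_pow 4 t).const_mul e
  refine ((((h1.const_add a).add h2).add h3).add h4).congr_deriv ?_
  norm_num
  ring

/-- Lagrange interpolation at `±h, ±3h`, split into even and odd parts. On the middle interval the
two parts are at most `5δ/4` each, and 3 is a rounded-up stability constant. -/
theorem exists_cubic_of_four_values {gp gm gp3 gm3 δ h : ℝ} (hh : 0 < h) (hp : |gp| ≤ δ)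
    (hm : |gm| ≤ δ) (hp3 : |gp3| ≤ δ) (hm3 : |gm3| ≤ δ) :
    ∃ c₀ c₁ c₂ c₃ : ℝ, c₀ + c₁ * h + c₂ * h ^ 2 + c₃ * h ^ 3 = gp ∧
      c₀ - c₁ * h + c₂ * h ^ 2 - c₃ * h ^ 3 = gm ∧
      c₀ + c₁ * (3 * h) + c₂ * (3 * h) ^ 2 + c₃ * (3 * h) ^ 3 = gp3 ∧
      c₀ - c₁ * (3 * h) + c₂ * (3 * h) ^ 2 - c₃ * (3 * h) ^ 3 = gm3 ∧
      ∀ x, |x| ≤ h → c₀ + c₁ * x + c₂ * x ^ 2 + c₃ * x ^ 3 ≤ 3 * δ := by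
  have hδ : 0 ≤ δ := (abs_nonneg _).trans hp
  refine ⟨(gp + gm) / 2 - ((gp3 + gm3) - (gp + gm)) / 16,
    (gp - gm) / (2 * h) - ((gp3 - gm3) / 3 - (gp - gm)) / (16 * h),
    ((gp3 + gm3) - (gp + gm)) / (16 * h ^ 2), ((gp3 - gm3) / 3 - (gp - gm)) / (16 * h ^ 3),
    ?_, ?_, ?_, ?_, ?_⟩
  · field_simp; ring
  · field_simp; ring
  · field_simp; ring
  · field_simp; ring
  · intro x hx
    obtain ⟨θ, hθ1, hθ⟩ : ∃ θ : ℝ, |θ| ≤ 1 ∧ x = θ * h := by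
      refine ⟨x / h, ?_, by field_simp⟩
      rw [abs_div, abs_of_pos hh, div_le_one hh]; exact hx
    have e : (gp + gm) / 2 - ((gp3 + gm3) - (gp + gm)) / 16 +
        ((gp - gm) / (2 * h) - ((gp3 - gm3) / 3 - (gp - gm)) / (16 * h)) * x +
        ((gp3 + gm3) - (gp + gm)) / (16 * h ^ 2) * x ^ 2 +
        ((gp3 - gm3) / 3 - (gp - gm)) / (16 * h ^ 3) * x ^ 3 =
        (gp + gm) / 2 + (1 - θ ^ 2) * ((gp + gm) - (gp3 + gm3)) / 16 +
        θ * ((gp - gm) / 2 + (1 - θ ^ 2) * ((gp - gm) - (gp3 - gm3) / 3) / 16) := by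
      rw [hθ]; field_simp; ring
    rw [e]
    have hθ2 : θ ^ 2 ≤ 1 := by rw [← sq_abs]; nlinarith [abs_nonneg θ]
    have hθ3 : |1 - θ ^ 2| ≤ 1 := by rw [abs_le]; constructor <;> nlinarith [sq_nonneg θ]
    obtain ⟨_, _⟩ := abs_le.mp hp
    obtain ⟨_, _⟩ := abs_le.mp hm
    obtain ⟨_, _⟩ := abs_le.mp hp3
    obtain ⟨_, _⟩ := abs_le.mp hm3
    have e1 : |(1 - θ ^ 2) * ((gp + gm) - (gp3 + gm3))| ≤ 1 * (4 * δ) := by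
      rw [abs_mul]
      have : |(gp + gm) - (gp3 + gm3)| ≤ 4 * δ := by rw [abs_le]; constructor <;> linarith
      gcongr
    have e2 : |(1 - θ ^ 2) * ((gp - gm) - (gp3 - gm3) / 3)| ≤ 1 * (4 * δ) := by
      rw [abs_mul]
      have : |(gp - gm) - (gp3 - gm3) / 3| ≤ 4 * δ := by rw [abs_le]; constructor <;> linarith
      gcongr
    obtain ⟨_, _⟩ := abs_le.mp e1
    obtain ⟨_, _⟩ := abs_le.mp e2
    have e3 : θ * ((gp - gm) / 2 + (1 - θ ^ 2) * ((gp - gm) - (gp3 - gm3) / 3) / 16) ≤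
        1 * (5 / 4 * δ) := by
      apply (le_abs_self _).trans
      rw [abs_mul]
      have : |(gp - gm) / 2 + (1 - θ ^ 2) * ((gp - gm) - (gp3 - gm3) / 3) / 16| ≤ 5 / 4 * δ := by
        rw [abs_le]; constructor <;> linarith
      gcongr
    linarith

/-- Stability of the interpolating cubic plus the classical remainder `G₄(ξ)/4! · (x²-h²)(x²-9h²)`,
whose node polynomial is at most `9h⁴` between the inner nodes. -/
theorem le_of_four_samples {G₀ G₁ G₂ G₃ G₄ : ℝ → ℝ} (h₀ : ∀ t, HasDerivAt G₀ (G₁ t) t)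
    (h₁ : ∀ t, HasDerivAt G₁ (G₂ t) t) (h₂ : ∀ t, HasDerivAt G₂ (G₃ t) t)
    (h₃ : ∀ t, HasDerivAt G₃ (G₄ t) t) {B δ h : ℝ} (hB : ∀ t, |G₄ t| ≤ B) (hh : 0 < h)
    (hp : |G₀ h| ≤ δ) (hm : |G₀ (-h)| ≤ δ) (hp3 : |G₀ (3 * h)| ≤ δ) (hm3 : |G₀ (-(3 * h))| ≤ δ)
    {x : ℝ} (hx : |x| ≤ h) : G₀ x ≤ 3 * δ + 9 * h ^ 4 * (B / 24) := by
  have hδ : 0 ≤ δ := (abs_nonneg _).trans hp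
  have hB0 : 0 ≤ B := (abs_nonneg _).trans (hB 0)
  have hrem : 0 ≤ 9 * h ^ 4 * (B / 24) := by positivity
  obtain ⟨c₀, c₁, c₂, c₃, ep, em, ep3, em3, hcub⟩ := exists_cubic_of_four_values hh hp hm hp3 hm3
  have hP := hcub x hx
  obtain ⟨hx1, hx2⟩ := abs_le.mp hx
  -- At an inner node the node polynomial vanishes and cannot be divided by; there the sample itself
  -- gives the bound.
  rcases eq_or_lt_of_le hx1 with hx1 | hx1
  · rw [← hx1]; linarith [le_abs_self (G₀ (-h))]
  rcases eq_or_lt_of_le hx2 with hx2 | hx2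
  · rw [hx2]; linarith [le_abs_self (G₀ h)]
  have hxx : x ^ 2 < h ^ 2 := by nlinarith
  have hn : (x ^ 2 - h ^ 2) * (x ^ 2 - 9 * h ^ 2) ≠ 0 :=
    mul_ne_zero (by linarith) (by nlinarith)
  -- With this `e`, subtracting the cubic plus `e(t²-h²)(t²-9h²)` leaves five zeros, the nodes and
  -- `x`. By iterated Rolle the fourth derivative `G₄ - 24e` vanishes somewhere.
  obtain ⟨e, ee⟩ : ∃ e, G₀ x - (c₀ + c₁ * x + c₂ * x ^ 2 + c₃ * x ^ 3) =
      e * ((x ^ 2 - h ^ 2) * (x ^ 2 - 9 * h ^ 2)) := ⟨_, (div_mul_cancel₀ _ hn).symm⟩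
  obtain ⟨ξ, hξ⟩ := exists_fourth_deriv_zero
    (fun t => (h₀ t).sub (hasDerivAt_quartic (c₀ + e * (9 * h ^ 4)) c₁ (c₂ - 10 * e * h ^ 2) c₃ e t))
    (fun t => (h₁ t).sub (hasDerivAt_quartic c₁ (2 * (c₂ - 10 * e * h ^ 2)) (3 * c₃) (4 * e) 0 t))
    (fun t => (h₂ t).sub (hasDerivAt_quartic (2 * (c₂ - 10 * e * h ^ 2)) (2 * (3 * c₃))
      (3 * (4 * e)) (4 * 0) 0 t))
    (fun t => (h₃ t).sub (hasDerivAt_quartic (2 * (3 * c₃)) (2 * (3 * (4 * e))) (3 * (4 * 0))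
      (4 * 0) 0 t))
    (a := -(3 * h)) (b := -h) (c := x) (d := h) (e := 3 * h)
    (by linarith) hx1 hx2 (by linarith)
    (by simp only [Pi.sub_apply]; linear_combination -em3)
    (by simp only [Pi.sub_apply]; linear_combination -em)
    (by simp only [Pi.sub_apply]; linear_combination ee)
    (by simp only [Pi.sub_apply]; linear_combination -ep)
    (by simp only [Pi.sub_apply]; linear_combination -ep3)
  have he24 : |e| ≤ B / 24 := by
    have h24 : G₄ ξ = 24 * e := by linarith
    have h := hB ξ
    rw [h24, abs_mul] at h
    norm_num at h
    linarith
  have hprod : (x ^ 2 - h ^ 2) * (x ^ 2 - 9 * h ^ 2) ≤ 9 * h ^ 4 := by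
    nlinarith [sq_nonneg x, sq_nonneg h, mul_nonneg (sq_nonneg x) (sq_nonneg h)]
  have hprod0 : 0 ≤ (x ^ 2 - h ^ 2) * (x ^ 2 - 9 * h ^ 2) := by nlinarith [sq_nonneg h]
  have herr : e * ((x ^ 2 - h ^ 2) * (x ^ 2 - 9 * h ^ 2)) ≤ 9 * h ^ 4 * (B / 24) :=
    calc e * ((x ^ 2 - h ^ 2) * (x ^ 2 - 9 * h ^ 2))
        ≤ (B / 24) * ((x ^ 2 - h ^ 2) * (x ^ 2 - 9 * h ^ 2)) := by
          gcongr; exact (le_abs_self e).trans he24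
      _ ≤ (B / 24) * (9 * h ^ 4) := by gcongr
      _ = _ := by ring
  linarith

/-! ### From samples to the real line -/

theorem hasDerivAt_re_iteratedDeriv {g : ℂ → ℂ} (hg : Differentiable ℂ g) (n : ℕ) (t : ℝ) :
    HasDerivAt (fun t : ℝ => (iteratedDeriv n g t).re) (iteratedDeriv (n + 1) g t).re t := by
  have h := (hg.contDiff (n := ⊤)).differentiable_iteratedDeriv n (by exact_mod_cast WithTop.coe_lt_top _)
  rw [iteratedDeriv_succ]
  exact (h t).hasDerivAt.real_of_complex

/-- An entire function that grows like `K exp(17π/8 y²)` off the real axis is controlled on the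
real axis, up to `3Kε/2`, by its samples at a sufficiently dense lattice. -/
theorem norm_le_of_samples {g : ℂ → ℂ} (hg : Differentiable ℂ g) {K ε s δ : ℝ} (hK : 0 < K)
    (hε : 0 < ε) (hε2 : 2 ≤ Real.log (2 / (3 * ε))) (hs : 0 < s)
    (hsl : s ≤ 0.3 / Real.sqrt (Real.log (2 / (3 * ε))))
    (hgrow : ∀ x y : ℝ, ‖g (x + y * Complex.I)‖ ≤ K * Real.exp (17 * Real.pi / 8 * y ^ 2))
    (hsamp : ∀ k : ℤ, ‖g ((s * k : ℝ) : ℂ)‖ ≤ δ) (hδ : 3 / 2 * K * ε ≤ 10 * δ) (x : ℝ) :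
    ‖g x‖ ≤ 10 * δ := by
  set ℓ := Real.log (2 / (3 * ε)) with hℓ
  set κ := 17 * Real.pi / 8 with hκ
  have hκ0 : 0 < κ := by positivity
  have hκ1 : κ ≤ 6.68 := by rw [hκ]; linarith [Real.pi_lt_d4]
  clear_value κ
  have hℓ0 : 0 < ℓ := by linarith
  have hgx : ∀ x : ℝ, ‖g x‖ ≤ K := fun x => by simpa using hgrow x 0
  have hbdd : BddAbove (Set.range fun x : ℝ => ‖g x‖) := ⟨K, by rintro _ ⟨x, rfl⟩; exact hgx x⟩
  set M := ⨆ x : ℝ, ‖g x‖ with hM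
  have hleM : ∀ x : ℝ, ‖g x‖ ≤ M := fun x => le_ciSup hbdd x
  have hMK : M ≤ K := ciSup_le hgx
  -- If the supremum is already of order `ε` there is nothing to prove. Otherwise `K/M ≤ e^ℓ`, so
  -- the a priori growth is not too large relative to `M`, and `M` can be absorbed at the end.
  by_cases hMs : M ≤ 3 / 2 * K * ε
  · exact ((hleM x).trans hMs).trans hδ
  push Not at hMs
  have hM0 : 0 < M := lt_trans (by positivity) hMs
  -- The three lines theorem at height `H` gives `M · exp((ℓ + κH²)|y|/H)`. The best height is `H =
  -- √(ℓ/κ) = q/κ`, with exponent `2q|y|`, which is at most 4 for `|y| ≤ 2/q`. The assumption `ℓ ≥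
  -- 2` says exactly that `2/q ≤ H`.
  set q := Real.sqrt (κ * ℓ) with hq
  have hq0 : 0 < q := Real.sqrt_pos.mpr (by positivity)
  have hq2 : q ^ 2 = κ * ℓ := Real.sq_sqrt (by positivity)
  have hKM : K / M ≤ Real.exp ℓ := by
    rw [hℓ, Real.exp_log (by positivity), div_le_div_iff₀ hM0 (by positivity)]
    nlinarith
  -- growth in a strip
  have hstrip : ∀ x y : ℝ, |y| ≤ 2 / q → ‖g (x + y * Complex.I)‖ ≤ M * Real.exp 4 := by
    intro x y hy
    obtain ⟨Y, θ, hθ0, hθ1, hY2, hy2, hθq⟩ : ∃ Y θ : ℝ, 0 ≤ θ ∧ θ ≤ 1 ∧ Y ^ 2 = (q / κ) ^ 2 ∧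
        y = θ * Y ∧ θ * (q / κ) ≤ 2 / q := by
      have hH : 0 < q / κ := by positivity
      have h1 : |y| ≤ q / κ := by
        refine hy.trans ?_
        rw [div_le_div_iff₀ hq0 hκ0]
        nlinarith
      have h2 : |y| / (q / κ) * (q / κ) = |y| := div_mul_cancel₀ _ hH.ne'
      rcases abs_choice y with h | h
      · exact ⟨q / κ, |y| / (q / κ), by positivity, (div_le_one hH).mpr h1, rfl,
          by rw [h2, h], h2.trans_le hy⟩
      · exact ⟨-(q / κ), |y| / (q / κ), by positivity, (div_le_one hH).mpr h1, by ring,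
          by rw [mul_neg, h2, h, neg_neg], h2.trans_le hy⟩
    have h := norm_le_interp_of_gaussian_growth hg hK.le hκ0.le hgrow hleM x Y hθ0 hθ1
    rw [hy2]
    refine h.trans ?_
    have e1 : M ^ (1 - θ) * (K * Real.exp (κ * Y ^ 2)) ^ θ =
        M * (K / M * Real.exp (κ * Y ^ 2)) ^ θ := by
      rw [div_mul_eq_mul_div, Real.div_rpow (by positivity) hM0.le, Real.rpow_sub hM0, Real.rpow_one]
      ring
    rw [e1]
    gcongr
    calc (K / M * Real.exp (κ * Y ^ 2)) ^ θ ≤ (Real.exp ℓ * Real.exp (κ * Y ^ 2)) ^ θ := by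
          gcongr
      _ = Real.exp ((ℓ + κ * Y ^ 2) * θ) := by rw [← Real.exp_add, Real.exp_mul]
      _ ≤ Real.exp 4 := by
          rw [Real.exp_le_exp, hY2]
          have e2 : ℓ + κ * (q / κ) ^ 2 = 2 * q * (q / κ) := by
            field_simp; nlinarith
          rw [e2]
          calc 2 * q * (q / κ) * θ = 2 * q * (θ * (q / κ)) := by ring
            _ ≤ 2 * q * (2 / q) := by gcongr
            _ = 4 := by field_simp; norm_num
  -- Cauchy's estimate on a circle of radius `2/q`, the radius `ρ` that minimizes `e^{2qρ}/ρ⁴`.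
  have hder : ∀ t : ℝ, ‖iteratedDeriv 4 g t‖ ≤ 24 * (M * Real.exp 4) / (2 / q) ^ 4 := by
    intro t
    have h := Complex.norm_iteratedDeriv_le_of_forall_mem_sphere_norm_le (f := g) (c := (t : ℂ))
      (R := 2 / q) (C := M * Real.exp 4) 4 (by positivity) hg.diffContOnCl ?_
    · simpa [Nat.factorial] using h
    · intro z hz
      have hz1 : |z.im| ≤ 2 / q := by
        have := Complex.abs_im_le_norm (z - t)
        rw [mem_sphere_iff_norm] at hz
        simpa [hz] using this
      simpa using hstrip z.re z.im hz1
  have hqs : q ^ 4 * s ^ 4 ≤ 0.3615 := by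
    have h1 : ℓ * s ^ 2 ≤ 0.09 := by
      have h2 : s * Real.sqrt ℓ ≤ 0.3 := by
        rwa [le_div_iff₀ (Real.sqrt_pos.mpr hℓ0)] at hsl
      have h3 : (s * Real.sqrt ℓ) ^ 2 ≤ 0.3 ^ 2 := by gcongr
      rw [mul_pow, Real.sq_sqrt hℓ0.le] at h3
      linarith
    have h5 : q ^ 2 * s ^ 2 ≤ 0.6012 := by
      rw [hq2]
      calc κ * ℓ * s ^ 2 = κ * (ℓ * s ^ 2) := by ring
        _ ≤ 6.68 * 0.09 := by gcongr
        _ = 0.6012 := by norm_num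
    calc q ^ 4 * s ^ 4 = (q ^ 2 * s ^ 2) ^ 2 := by ring
      _ ≤ 0.6012 ^ 2 := by gcongr
      _ ≤ _ := by norm_num
  have hkey : ∀ x : ℝ, ‖g x‖ ≤ 3 * δ + 0.7 * M := by
    intro x
    -- `c` is the midpoint of the sampling cell of `x`, so the four surrounding samples sit at `c ±
    -- s/2` and `c ± 3s/2`. The unimodular `w` below reduces the claim to a real part, for which
    -- Rolle's theorem is available.
    set c : ℝ := s * (⌊x / s⌋ + 1 / 2) with hc
    obtain ⟨w, hw1, hw⟩ : ∃ w : ℂ, ‖w‖ = 1 ∧ w * g x = (‖g x‖ : ℂ) := by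
      obtain ⟨w, hw1, hw⟩ := RCLike.exists_norm_eq_mul_self (g x : ℂ)
      exact ⟨w, hw1, hw.symm⟩
    have hG : Differentiable ℂ fun z => w * g (c + z) :=
      (hg.comp (by fun_prop)).const_mul w
    have hval : ∀ t : ℝ, |(w * g (c + t)).re| ≤ ‖g ((c + t : ℝ) : ℂ)‖ := by
      intro t
      refine (Complex.abs_re_le_norm _).trans ?_
      rw [norm_mul, hw1, one_mul]
      push_cast
      exact le_rfl
    have hd4 : ∀ t : ℝ, |(iteratedDeriv 4 (fun z => w * g (c + z)) (t : ℂ)).re| ≤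
        24 * (M * Real.exp 4) / (2 / q) ^ 4 := by
      intro t
      refine (Complex.abs_re_le_norm _).trans ?_
      have e : iteratedDeriv 4 (fun z => w * g (c + z)) (t : ℂ) =
          w * iteratedDeriv 4 g ((c + t : ℝ) : ℂ) := by
        rw [iteratedDeriv_const_mul_field, iteratedDeriv_comp_const_add]
        push_cast
        rfl
      rw [e, norm_mul, hw1, one_mul]
      exact hder _
    have hnode : ∀ (k : ℤ) (t : ℝ), c + t = s * k → |(w * g (c + t)).re| ≤ δ := by
      intro k t hk
      refine (hval t).trans ?_
      rw [hk]
      exact hsamp k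
    have hfl := Int.floor_le (x / s)
    have hfl2 := Int.lt_floor_add_one (x / s)
    have hxs : x = s * (x / s) := by field_simp
    have h := le_of_four_samples (x := x - c) (h := s / 2) (δ := δ)
      (fun t => hasDerivAt_re_iteratedDeriv hG 0 t) (fun t => hasDerivAt_re_iteratedDeriv hG 1 t)
      (fun t => hasDerivAt_re_iteratedDeriv hG 2 t) (fun t => hasDerivAt_re_iteratedDeriv hG 3 t)
      hd4 (by positivity)
      (by simpa using hnode (⌊x / s⌋ + 1) (s / 2) (by rw [hc]; push_cast; ring))
      (by simpa using hnode ⌊x / s⌋ (-(s / 2)) (by rw [hc]; ring))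
      (by simpa using hnode (⌊x / s⌋ + 2) (3 * (s / 2)) (by rw [hc]; push_cast; ring))
      (by simpa using hnode (⌊x / s⌋ - 1) (-(3 * (s / 2))) (by rw [hc]; push_cast; ring))
      (by rw [abs_le, hc]; constructor <;> nlinarith)
    have hx0 : (iteratedDeriv 0 (fun z => w * g (c + z)) ((x - c : ℝ) : ℂ)).re = ‖g x‖ := by
      have : (c : ℂ) + ((x - c : ℝ) : ℂ) = x := by push_cast; ring
      rw [iteratedDeriv_zero, this, hw, Complex.ofReal_re]
    rw [hx0] at h
    refine h.trans (add_le_add le_rfl ?_)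
    have he4 : Real.exp 4 ≤ 54.7 := by
      have h1 := Real.exp_one_lt_d9
      have h2 : Real.exp 4 = Real.exp 1 ^ 4 := by rw [← Real.exp_nat_mul]; norm_num
      rw [h2]
      calc Real.exp 1 ^ 4 ≤ 2.719 ^ 4 := by gcongr; linarith
        _ ≤ 54.7 := by norm_num
    calc 9 * (s / 2) ^ 4 * (24 * (M * Real.exp 4) / (2 / q) ^ 4 / 24)
        = 9 / 256 * M * (Real.exp 4 * (q ^ 4 * s ^ 4)) := by field_simp; ring
      _ ≤ 9 / 256 * M * (54.7 * 0.3615) := by gcongr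
      _ ≤ 0.7 * M := by linarith
  -- The mesh is fine enough for the remainder to stay below `0.7M`; absorbing it leaves `0.3M ≤
  -- 3δ`.
  have hfin : M ≤ 3 * δ + 0.7 * M := ciSup_le hkey
  linarith [hleM x]

end

noncomputable section

/-! ### Gaussian sums over the integers and over the lattice -/

theorem hasSum_exp_neg_mul_nat {c : ℝ} (hc : 0 < c) :
    HasSum (fun n : ℕ => Real.exp (-(c * n))) (1 / (1 - Real.exp (-c))) := by
  have h := hasSum_geometric_of_lt_one (Real.exp_pos (-c)).le (by rw [Real.exp_lt_one_iff]; linarith)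
  simp only [← Real.exp_nat_mul] at h
  rw [one_div]
  convert h using 3
  ring

theorem summable_int_and_tsum_le {F : ℤ → ℝ} {u v : ℕ → ℝ} {U V : ℝ} (hF : ∀ k, 0 ≤ F k)
    (hu : HasSum u U) (hv : HasSum v V) (h1 : ∀ n : ℕ, F n ≤ u n)
    (h2 : ∀ n : ℕ, F (-(n + 1)) ≤ v n) : Summable F ∧ ∑' k, F k ≤ U + V := by
  have s1 : Summable fun n : ℕ => F n := Summable.of_nonneg_of_le (fun n => hF _) h1 hu.summable
  have s2 : Summable fun n : ℕ => F (-(n + 1)) :=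
    Summable.of_nonneg_of_le (fun n => hF _) h2 hv.summable
  refine ⟨Summable.of_nat_of_neg_add_one s1 s2, ?_⟩
  rw [tsum_of_nat_of_neg_add_one s1 s2]
  have b1 := s1.tsum_le_tsum h1 hu.summable
  have b2 := s2.tsum_le_tsum h2 hv.summable
  rw [hu.tsum_eq] at b1
  rw [hv.tsum_eq] at b2
  exact add_le_add b1 b2

theorem exp_neg_mul_sq_le {c : ℝ} (hc : 0 < c) {n : ℕ} {d : ℝ} (hd : (n : ℝ) ≤ |d|) :
    Real.exp (-(c * d ^ 2)) ≤ Real.exp (-(c * n)) := by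
  have h1 : (n : ℝ) ≤ (n : ℝ) ^ 2 := by
    have := Nat.le_self_pow two_ne_zero n
    exact_mod_cast this
  have h2 : (n : ℝ) ^ 2 ≤ |d| ^ 2 := pow_le_pow_left₀ (Nat.cast_nonneg n) hd 2
  rw [sq_abs] at h2
  exact Real.exp_le_exp.mpr (neg_le_neg (mul_le_mul_of_nonneg_left (h1.trans h2) hc.le))

/-- After recentring at `⌊x⌋ + 1`, the `n`-th integer on either side is at distance at least `n`
from `x`. Since `n² ≥ n`, each half is dominated by a geometric series, uniformly in `x`. -/
theorem summable_and_tsum_gaussian_le {c : ℝ} (hc : 0 < c) (x : ℝ) :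
    Summable (fun k : ℤ => Real.exp (-(c * ((k : ℝ) - x) ^ 2))) ∧
      ∑' k : ℤ, Real.exp (-(c * ((k : ℝ) - x) ^ 2)) ≤ 2 / (1 - Real.exp (-c)) := by
  have hg := hasSum_exp_neg_mul_nat hc
  have hfl := Int.floor_le x
  have hfl2 := Int.lt_floor_add_one x
  have h := summable_int_and_tsum_le
    (F := fun k : ℤ => Real.exp (-(c * (((k + (⌊x⌋ + 1) : ℤ) : ℝ) - x) ^ 2)))
    (fun _ => (Real.exp_pos _).le) hg hg
    (fun n => exp_neg_mul_sq_le hc (le_trans (by push_cast; linarith) (le_abs_self _)))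
    (fun n => exp_neg_mul_sq_le hc (le_trans (by push_cast; linarith) (neg_le_abs _)))
  refine ⟨(Equiv.addRight (⌊x⌋ + 1)).summable_iff.mp h.1, ?_⟩
  rw [← (Equiv.addRight (⌊x⌋ + 1)).tsum_eq]
  refine h.2.trans (le_of_eq (by ring))

theorem meshA_sq : meshA ^ 2 = 1 / 2 := by
  rw [meshA, div_pow, Real.sq_sqrt (by norm_num)]
  norm_num

/-- The point of the lattice `𝔞ℤ²` with integer coordinates `a`. -/
def latPt (a : ℤ × ℤ) : Plane := !₂[meshA * a.1, meshA * a.2]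

@[simp] theorem latPt_zero_coord (a : ℤ × ℤ) : latPt a 0 = meshA * a.1 := rfl
@[simp] theorem latPt_one_coord (a : ℤ × ℤ) : latPt a 1 = meshA * a.2 := rfl

theorem latPt_add (a b : ℤ × ℤ) : latPt (a + b) = latPt a + latPt b := by
  ext i
  fin_cases i <;> simp [mul_add]

theorem latPt_zero : latPt 0 = 0 := by
  ext i
  fin_cases i <;> simp

theorem latPt_injective : Function.Injective latPt := by
  intro a b h
  have h0 := congrArg (fun p : Plane => p 0) h
  have h1 := congrArg (fun p : Plane => p 1) h
  simp only [latPt_zero_coord, latPt_one_coord, mul_eq_mul_left_iff, meshA_pos.ne', or_false,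
    Int.cast_inj] at h0 h1
  exact Prod.ext h0 h1

/-- The squared Euclidean distance, in coordinates. -/
def sqDist (p q : Plane) : ℝ := (p 0 - q 0) ^ 2 + (p 1 - q 1) ^ 2

theorem norm_sub_sq_eq_sqDist (p q : Plane) : ‖p - q‖ ^ 2 = sqDist p q := by
  rw [EuclideanSpace.norm_sq_eq, Fin.sum_univ_two]
  simp [sqDist]

theorem lattice_gaussian_eq (c : ℝ) (z : Plane) (a : ℤ × ℤ) :
    Real.exp (-(2 * c * sqDist z (latPt a))) =
      Real.exp (-(c * ((a.1 : ℝ) - z 0 / meshA) ^ 2)) *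
        Real.exp (-(c * ((a.2 : ℝ) - z 1 / meshA) ^ 2)) := by
  rw [← Real.exp_add]
  congr 1
  have h := meshA_sq
  have hp := meshA_pos.ne'
  have key : ∀ u k : ℝ, (k - u / meshA) ^ 2 = 2 * (u - meshA * k) ^ 2 := by
    intro u k
    have : (u - meshA * k) ^ 2 = meshA ^ 2 * (k - u / meshA) ^ 2 := by field_simp; ring
    rw [this, h]; ring
  rw [key, key]
  simp only [sqDist, latPt_zero_coord, latPt_one_coord]
  ring

theorem summable_lattice_gaussian {c : ℝ} (hc : 0 < c) (z : Plane) :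
    Summable fun a : ℤ × ℤ => Real.exp (-(2 * c * sqDist z (latPt a))) := by
  simp only [lattice_gaussian_eq]
  exact (summable_and_tsum_gaussian_le hc _).1.mul_of_nonneg (summable_and_tsum_gaussian_le hc _).1
    (fun _ => (Real.exp_pos _).le) (fun _ => (Real.exp_pos _).le)

theorem tsum_lattice_gaussian_le {c : ℝ} (hc : 0 < c) (z : Plane) :
    ∑' a : ℤ × ℤ, Real.exp (-(2 * c * sqDist z (latPt a))) ≤ (2 / (1 - Real.exp (-c))) ^ 2 := by
  have h0 := summable_and_tsum_gaussian_le hc (z 0 / meshA)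
  have h1 := summable_and_tsum_gaussian_le hc (z 1 / meshA)
  simp only [lattice_gaussian_eq]
  rw [← h0.1.tsum_mul_tsum h1.1 (h0.1.mul_of_nonneg h1.1
    (fun _ => (Real.exp_pos _).le) (fun _ => (Real.exp_pos _).le)), sq]
  exact mul_le_mul h0.2 h1.2 (tsum_nonneg fun _ => (Real.exp_pos _).le)
    ((tsum_nonneg fun _ => (Real.exp_pos _).le).trans h0.2)

/-- Uses only `1 + c ≤ e^c`, so the numerical bounds below need no more than `π > 3`. -/
theorem gaussian_geom_le {c B : ℝ} (hB : 2 < B) (h : B / (B - 2) ≤ 1 + c) :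
    2 / (1 - Real.exp (-c)) ≤ B := by
  have h1 : B / (B - 2) ≤ Real.exp c := h.trans (by linarith [Real.add_one_le_exp c])
  have h2 : Real.exp (-c) ≤ (B - 2) / B := by
    rw [Real.exp_neg, inv_le_comm₀ (Real.exp_pos _) (div_pos (by linarith) (by linarith)), inv_div]
    exact h1
  have h3 : 2 / B ≤ 1 - Real.exp (-c) := by
    have : (B - 2) / B = 1 - 2 / B := by
      have : B ≠ 0 := by linarith
      field_simp
    linarith
  have h4 : 0 < 2 / B := div_pos two_pos (by linarith)
  rw [div_le_iff₀ (h4.trans_le h3)]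
  calc (2 : ℝ) = B * (2 / B) := by
        have : B ≠ 0 := by linarith
        field_simp
    _ ≤ _ := by gcongr

theorem tsum_lattice_gaussian_half_le (z : Plane) :
    ∑' a : ℤ × ℤ, Real.exp (-(Real.pi / 2 * sqDist z (latPt a))) ≤ 25 := by
  have h := tsum_lattice_gaussian_le (c := Real.pi / 4) (by positivity) z
  have e : ∀ u : ℝ, 2 * (Real.pi / 4) * u = Real.pi / 2 * u := fun u => by ring
  simp only [e] at h
  refine h.trans ?_
  have : 2 / (1 - Real.exp (-(Real.pi / 4))) ≤ 5 :=
    gaussian_geom_le (by norm_num) (by linarith [Real.pi_gt_three])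
  have h0 : 0 ≤ 2 / (1 - Real.exp (-(Real.pi / 4))) := by
    have : Real.exp (-(Real.pi / 4)) ≤ 1 := by
      rw [Real.exp_le_one_iff]; linarith [Real.pi_pos]
    exact div_nonneg (by norm_num) (by linarith)
  nlinarith

theorem tsum_lattice_gaussian_quarter_le (z : Plane) :
    ∑' a : ℤ × ℤ, Real.exp (-(Real.pi / 4 * sqDist z (latPt a))) ≤ 64 := by
  have h := tsum_lattice_gaussian_le (c := Real.pi / 8) (by positivity) z
  have e : ∀ u : ℝ, 2 * (Real.pi / 8) * u = Real.pi / 4 * u := fun u => by ring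
  simp only [e] at h
  refine h.trans ?_
  have : 2 / (1 - Real.exp (-(Real.pi / 8))) ≤ 8 :=
    gaussian_geom_le (by norm_num) (by linarith [Real.pi_gt_three])
  have h0 : 0 ≤ 2 / (1 - Real.exp (-(Real.pi / 8))) := by
    have : Real.exp (-(Real.pi / 8)) ≤ 1 := by
      rw [Real.exp_le_one_iff]; linarith [Real.pi_pos]
    exact div_nonneg (by norm_num) (by linarith)
  nlinarith

theorem summable_lattice_gaussian_half (z : Plane) :
    Summable fun a : ℤ × ℤ => Real.exp (-(Real.pi / 2 * sqDist z (latPt a))) := by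
  have h := summable_lattice_gaussian (c := Real.pi / 4) (by positivity) z
  convert h using 4
  ring

theorem summable_lattice_gaussian_quarter (z : Plane) :
    Summable fun a : ℤ × ℤ => Real.exp (-(Real.pi / 4 * sqDist z (latPt a))) := by
  have h := summable_lattice_gaussian (c := Real.pi / 8) (by positivity) z
  convert h using 4
  ring

/-- The weight `e^{-π(n²+m²)}`. -/
def thetaWeight (b : ℤ × ℤ) : ℝ := Real.exp (-(Real.pi * ((b.1 : ℝ) ^ 2 + (b.2 : ℝ) ^ 2)))

theorem thetaWeight_eq (b : ℤ × ℤ) :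
    thetaWeight b = Real.exp (-(Real.pi * ((b.1 : ℝ) - 0) ^ 2)) *
      Real.exp (-(Real.pi * ((b.2 : ℝ) - 0) ^ 2)) := by
  rw [thetaWeight, ← Real.exp_add]
  congr 1
  ring

theorem thetaWeight_pos (b : ℤ × ℤ) : 0 < thetaWeight b := Real.exp_pos _

theorem summable_thetaWeight : Summable thetaWeight := by
  have h := (summable_and_tsum_gaussian_le Real.pi_pos 0).1
  have := h.mul_of_nonneg h (fun _ => (Real.exp_pos _).le) (fun _ => (Real.exp_pos _).le)
  refine this.congr fun b => (thetaWeight_eq b).symm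

theorem exp_neg_pi_le : Real.exp (-Real.pi) ≤ 1 / 20 := by
  have h1 : (20 : ℝ) ≤ Real.exp 3 := by
    have h2 : Real.exp 3 = Real.exp 1 ^ 3 := by rw [← Real.exp_nat_mul]; norm_num
    have h3 := Real.exp_one_gt_d9
    rw [h2]
    calc (20 : ℝ) ≤ 2.718 ^ 3 := by norm_num
      _ ≤ _ := by gcongr; linarith
  have h4 : Real.exp 3 ≤ Real.exp Real.pi := Real.exp_le_exp.mpr Real.pi_gt_three.le
  rw [Real.exp_neg, inv_le_comm₀ (Real.exp_pos _) (by norm_num)]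
  linarith

theorem tsum_gaussian_pi_le : ∑' k : ℤ, Real.exp (-(Real.pi * ((k : ℝ) - 0) ^ 2)) ≤ 6 / 5 := by
  have hg := hasSum_exp_neg_mul_nat Real.pi_pos
  have hexp := exp_neg_pi_le
  have hpos := Real.exp_pos (-Real.pi)
  have h2 : ∀ n : ℕ, Real.exp (-(Real.pi * (((-((n : ℤ) + 1) : ℤ) : ℝ) - 0) ^ 2)) ≤
      Real.exp (-Real.pi) * Real.exp (-(Real.pi * n)) := by
    intro n
    have e : Real.exp (-Real.pi) * Real.exp (-(Real.pi * n)) =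
        Real.exp (-(Real.pi * ((n + 1 : ℕ) : ℝ))) := by
      rw [← Real.exp_add]; push_cast; congr 1; ring
    rw [e]
    exact exp_neg_mul_sq_le Real.pi_pos (le_trans (by push_cast; linarith) (neg_le_abs _))
  have h := (summable_int_and_tsum_le
    (F := fun k : ℤ => Real.exp (-(Real.pi * ((k : ℝ) - 0) ^ 2)))
    (fun _ => (Real.exp_pos _).le) hg (hg.mul_left (Real.exp (-Real.pi)))
    (fun n => exp_neg_mul_sq_le Real.pi_pos (le_trans (by push_cast; linarith) (le_abs_self _)))
    h2).2
  refine h.trans ?_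
  have b3 : 1 / (1 - Real.exp (-Real.pi)) ≤ 20 / 19 := by
    rw [div_le_div_iff₀ (by linarith) (by norm_num)]; linarith
  have b5 : 0 ≤ 1 / (1 - Real.exp (-Real.pi)) := div_nonneg (by norm_num) (by linarith)
  have b4 : Real.exp (-Real.pi) * (1 / (1 - Real.exp (-Real.pi))) ≤ 1 / 20 * (20 / 19) := by
    gcongr
  linarith

/-- The weight at the origin is 1, so the other weights sum to at most `1/2`; this is the
contraction constant of the Neumann series. -/
theorem tsum_thetaWeight_le : ∑' b, thetaWeight b ≤ 3 / 2 := by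
  have h := (summable_and_tsum_gaussian_le Real.pi_pos 0).1
  have h0 : 0 ≤ ∑' k : ℤ, Real.exp (-(Real.pi * ((k : ℝ) - 0) ^ 2)) :=
    tsum_nonneg fun _ => (Real.exp_pos _).le
  simp only [thetaWeight_eq]
  rw [← h.tsum_mul_tsum h (h.mul_of_nonneg h
    (fun _ => (Real.exp_pos _).le) (fun _ => (Real.exp_pos _).le))]
  have := tsum_gaussian_pi_le
  nlinarith

/-! ### Synthesis on the lattice and the commuting shift operator -/

/-- `K(z,l) = 𝒢φ_l(z)`, the Gabor transform of the time-frequency shift by `l` of the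
normalized Gaussian. -/
def gaborKernel (z l : Plane) : ℂ :=
  Complex.exp (-((Real.pi : ℂ) / 2) * (((z 0 : ℂ) - l 0) ^ 2 + ((z 1 : ℂ) - l 1) ^ 2) +
    Real.pi * Complex.I * ((l 1 : ℂ) - z 1) * ((l 0 : ℂ) + z 0))

theorem norm_gaborKernel (z l : Plane) :
    ‖gaborKernel z l‖ = Real.exp (-(Real.pi / 2 * sqDist z l)) := by
  rw [gaborKernel, Complex.norm_exp]
  congr 1
  have e : -((Real.pi : ℂ) / 2) * (((z 0 : ℂ) - l 0) ^ 2 + ((z 1 : ℂ) - l 1) ^ 2) +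
      Real.pi * Complex.I * ((l 1 : ℂ) - z 1) * ((l 0 : ℂ) + z 0) =
      ((-(Real.pi / 2 * sqDist z l) : ℝ) : ℂ) +
        ((Real.pi * (l 1 - z 1) * (l 0 + z 0) : ℝ) : ℂ) * Complex.I := by
    simp only [sqDist]; push_cast; ring
  rw [e]
  simp

/-- `𝒟X(z) = ∑_{l ∈ 𝔞ℤ²} X(l) K(z,l)`. -/
def synthesis (X : Plane → ℂ) (z : Plane) : ℂ :=
  ∑' a : ℤ × ℤ, X (latPt a) * gaborKernel z (latPt a)

/-- The weight of the shift by `latPt (2 • b)`. -/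
def shiftWeight (z : Plane) (b : ℤ × ℤ) : ℂ :=
  Complex.exp (-(Real.pi : ℂ) * ((b.1 : ℂ) ^ 2 + (b.2 : ℂ) ^ 2) -
    2 * Real.pi * Complex.I * (2 * meshA * b.1) * z 1)

theorem norm_shiftWeight (z : Plane) (b : ℤ × ℤ) : ‖shiftWeight z b‖ = thetaWeight b := by
  rw [shiftWeight, Complex.norm_exp, thetaWeight]
  congr 1
  have e : -(Real.pi : ℂ) * ((b.1 : ℂ) ^ 2 + (b.2 : ℂ) ^ 2) -
      2 * Real.pi * Complex.I * (2 * meshA * b.1) * z 1 =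
      ((-(Real.pi * ((b.1 : ℝ) ^ 2 + (b.2 : ℝ) ^ 2)) : ℝ) : ℂ) +
        ((-(2 * Real.pi * (2 * meshA * b.1) * z 1) : ℝ) : ℂ) * Complex.I := by
    push_cast; ring
  rw [e, Complex.add_re, Complex.ofReal_re, Complex.re_ofReal_mul, Complex.I_re, mul_zero, add_zero]

/-- The weighted sum of the shifts by the vectors of `2𝔞ℤ²`. -/
def shiftSum (X : Plane → ℂ) (z : Plane) : ℂ :=
  ∑' b : ℤ × ℤ, shiftWeight z b * X (z - latPt (2 • b))

theorem summable_synthesis {X : Plane → ℂ} {C : ℝ} (hX : ∀ p, ‖X p‖ ≤ C) (z : Plane) :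
    Summable fun a : ℤ × ℤ => X (latPt a) * gaborKernel z (latPt a) := by
  refine Summable.of_norm_bounded ((summable_lattice_gaussian_half z).mul_left C) fun a => ?_
  rw [norm_mul, norm_gaborKernel]
  gcongr
  exact hX _

theorem summable_shiftSum {X : Plane → ℂ} {C : ℝ} (hX : ∀ p, ‖X p‖ ≤ C) (z : Plane) :
    Summable fun b : ℤ × ℤ => shiftWeight z b * X (z - latPt (2 • b)) := by
  refine Summable.of_norm_bounded (summable_thetaWeight.mul_right C) fun b => ?_
  rw [norm_mul, norm_shiftWeight]
  have := thetaWeight_pos b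
  gcongr
  exact hX _

theorem norm_shiftSum_sub_le {X : Plane → ℂ} {C : ℝ} (hX : ∀ p, ‖X p‖ ≤ C) (z : Plane) :
    ‖X z - shiftSum X z‖ ≤ C / 2 := by
  have hC : 0 ≤ C := (norm_nonneg _).trans (hX 0)
  have h0 : shiftWeight z 0 * X (z - latPt (2 • 0)) = X z := by
    simp [shiftWeight, latPt_zero]
  have hw0 : thetaWeight 0 = 1 := by simp [thetaWeight]
  rw [shiftSum, (summable_shiftSum hX z).tsum_eq_add_tsum_ite 0, h0, sub_add_cancel_left, norm_neg]
  have hs : Summable fun b : ℤ × ℤ => if b = 0 then 0 else thetaWeight b := by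
    refine Summable.of_nonneg_of_le (fun b => ?_) (fun b => ?_) summable_thetaWeight
    · split_ifs
      · exact le_rfl
      · exact (thetaWeight_pos b).le
    · split_ifs
      · exact (thetaWeight_pos b).le
      · exact le_rfl
  have ht := tsum_thetaWeight_le
  rw [summable_thetaWeight.tsum_eq_add_tsum_ite 0, hw0] at ht
  refine (tsum_of_norm_bounded (hs.mul_right C).hasSum fun b => ?_).trans ?_
  · split_ifs
    · simp
    · rw [norm_mul, norm_shiftWeight]
      have := thetaWeight_pos b
      gcongr
      exact hX _
  · rw [tsum_mul_right]
    nlinarith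

/-- Covariance of the kernel. A joint shift of both arguments changes only its phase, by the amount
by which the two shift weights differ. -/
theorem shiftWeight_mul_gaborKernel (z : Plane) (a b : ℤ × ℤ) :
    shiftWeight (latPt (a + 2 • b)) b * gaborKernel z (latPt (a + 2 • b)) =
      shiftWeight z b * gaborKernel (z - latPt (2 • b)) (latPt a) := by
  simp only [shiftWeight, gaborKernel, ← Complex.exp_add, PiLp.sub_apply, latPt_zero_coord,
    latPt_one_coord]
  congr 1
  simp only [two_nsmul, Prod.fst_add, Prod.snd_add]
  push_cast
  ring

/-- Synthesis commutes with the shift sum: the shifts preserve `𝔞ℤ²`, so after exchanging the sums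
they can be moved from the coefficients to the kernel by `shiftWeight_mul_gaborKernel`. -/
theorem synthesis_shiftSum {X : Plane → ℂ} {C : ℝ} (hX : ∀ p, ‖X p‖ ≤ C) (z : Plane) :
    synthesis (shiftSum X) z = shiftSum (synthesis X) z := by
  have hC : 0 ≤ C := (norm_nonneg _).trans (hX 0)
  set F : ℤ × ℤ → ℤ × ℤ → ℂ := fun a b =>
    shiftWeight (latPt a) b * X (latPt a - latPt (2 • b)) * gaborKernel z (latPt a) with hF
  have hsum : Summable (Function.uncurry F) := by
    refine Summable.of_norm_bounded (((summable_lattice_gaussian_half z).mul_of_nonneg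
      summable_thetaWeight (fun _ => (Real.exp_pos _).le)
      (fun b => (thetaWeight_pos b).le)).mul_left C) ?_
    rintro ⟨a, b⟩
    simp only [Function.uncurry_apply_pair, hF, norm_mul, norm_shiftWeight, norm_gaborKernel]
    have h1 := hX (latPt a - latPt (2 • b))
    have h2 := thetaWeight_pos b
    calc thetaWeight b * ‖X (latPt a - latPt (2 • b))‖ *
          Real.exp (-(Real.pi / 2 * sqDist z (latPt a)))
        ≤ thetaWeight b * C * Real.exp (-(Real.pi / 2 * sqDist z (latPt a))) := by gcongr
      _ = _ := by ring
  have e1 : synthesis (shiftSum X) z = ∑' a, ∑' b, F a b := by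
    unfold synthesis shiftSum
    refine tsum_congr fun a => ?_
    rw [← tsum_mul_right]
  have e2 : shiftSum (synthesis X) z = ∑' b, ∑' a, F a b := by
    unfold synthesis shiftSum
    refine tsum_congr fun b => ?_
    rw [← tsum_mul_left, ← (Equiv.addRight (2 • b)).tsum_eq (fun a => F a b)]
    refine tsum_congr fun a => ?_
    simp only [Equiv.coe_addRight, hF]
    rw [mul_right_comm, shiftWeight_mul_gaborKernel, latPt_add, add_sub_cancel_right]
    ring
  rw [e1, e2, hsum.tsum_comm]

end

noncomputable section

/-! ### The Janssen-type identity on the lattice -/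

/-- The kernel `e^{-π(t-x)²} e^{-2πiyt}` of the Gabor transform. -/
def windowKernel (p : Plane) (t : ℝ) : ℂ :=
  Complex.exp (-(Real.pi : ℂ) * ((t : ℂ) - (p 0 : ℂ)) ^ 2) *
    Complex.exp (-2 * (Real.pi : ℂ) * Complex.I * (p 1 : ℂ) * (t : ℂ))

theorem norm_windowKernel (p : Plane) (t : ℝ) :
    ‖windowKernel p t‖ = Real.exp (-(Real.pi * (t - p 0) ^ 2)) := by
  have e1 : -(Real.pi : ℂ) * ((t : ℂ) - (p 0 : ℂ)) ^ 2 = ((-(Real.pi * (t - p 0) ^ 2) : ℝ) : ℂ) := by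
    push_cast; ring
  have e2 : -2 * (Real.pi : ℂ) * Complex.I * (p 1 : ℂ) * (t : ℂ) =
      ((-2 * Real.pi * p 1 * t : ℝ) : ℂ) * Complex.I := by push_cast; ring
  rw [windowKernel, norm_mul, e1, e2, Complex.norm_exp_ofReal_mul_I, mul_one, Complex.norm_exp,
    Complex.ofReal_re]

theorem norm_windowKernel_le_one (p : Plane) (t : ℝ) : ‖windowKernel p t‖ ≤ 1 := by
  rw [norm_windowKernel, Real.exp_le_one_iff]
  have := Real.pi_pos
  have : 0 ≤ Real.pi * (t - p 0) ^ 2 := by positivity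
  linarith

theorem meshA_sq_complex : (meshA : ℂ) ^ 2 = 1 / 2 := by
  have := congrArg (fun x : ℝ => (x : ℂ)) meshA_sq
  push_cast at this
  exact this

theorem summable_window_mul_kernel (z : Plane) (t : ℝ) :
    Summable fun a : ℤ × ℤ => windowKernel (latPt a) t * gaborKernel z (latPt a) := by
  refine Summable.of_norm_bounded (summable_lattice_gaussian_half z) fun a => ?_
  rw [norm_mul, norm_gaborKernel]
  exact mul_le_of_le_one_left (Real.exp_pos _).le (norm_windowKernel_le_one _ _)

/-- The exponent that appears after the first Poisson summation. -/
def mixedExponent (x y t : ℝ) (k n : ℤ) : ℂ :=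
  -(Real.pi : ℂ) * ((t : ℂ) - meshA * k) ^ 2 - Real.pi / 2 * (((x : ℂ) - meshA * k) ^ 2 + (y : ℂ) ^ 2) -
    Real.pi * Complex.I * y * (meshA * k + x) -
    4 * Real.pi * (n + meshA / 2 * (Complex.I * y - (meshA * k + x - 2 * t))) ^ 2

/-- In the frequency index the summand is a Gaussian `e^{-πl²/4}` with a linear term, because `𝔞² =
1/2`. Its width gives the factor 2, the redundancy of the lattice. -/
theorem poisson_second_coordinate (z : Plane) (t : ℝ) (k : ℤ) :
    ∑' l : ℤ, windowKernel (latPt (k, l)) t * gaborKernel z (latPt (k, l)) =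
      2 * ∑' n : ℤ, Complex.exp (mixedExponent (z 0) (z 1) t k n) := by
  have ha := meshA_sq_complex
  set b : ℂ := meshA / 2 * (z 1 + Complex.I * (meshA * k + z 0 - 2 * t)) with hb
  set c : ℂ := -(Real.pi : ℂ) * ((t : ℂ) - meshA * k) ^ 2 -
    Real.pi / 2 * (((z 0 : ℂ) - meshA * k) ^ 2 + (z 1 : ℂ) ^ 2) -
    Real.pi * Complex.I * z 1 * (meshA * k + z 0) with hc
  have h := Complex.tsum_exp_neg_quadratic (a := 1 / 4) (by norm_num) b
  have h4 : (1 : ℂ) / (1 / 4) ^ (1 / 2 : ℂ) = 2 := by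
    have : ((1 : ℂ) / 4) ^ (1 / 2 : ℂ) = 1 / 2 := by
      have e : ((1 / 4 : ℝ) : ℂ) ^ ((1 / 2 : ℝ) : ℂ) = ((1 / 2 : ℝ) : ℂ) := by
        rw [← Complex.ofReal_cpow (by norm_num), ← Real.sqrt_eq_rpow,
          show (1 / 4 : ℝ) = (1 / 2) ^ 2 by norm_num, Real.sqrt_sq (by norm_num)]
      simpa using e
    rw [this]; norm_num
  rw [h4] at h
  have e1 : ∀ l : ℤ, windowKernel (latPt (k, l)) t * gaborKernel z (latPt (k, l)) =
      Complex.exp c * Complex.exp (-Real.pi * (1 / 4) * l ^ 2 + 2 * Real.pi * b * l) := by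
    intro l
    simp only [windowKernel, gaborKernel, ← Complex.exp_add, latPt_zero_coord, latPt_one_coord]
    congr 1
    rw [hb, hc]
    push_cast
    linear_combination (-(Real.pi : ℂ) / 2 * l ^ 2) * ha
  have e2 : ∀ n : ℤ, Complex.exp (mixedExponent (z 0) (z 1) t k n) =
      Complex.exp c * Complex.exp (-Real.pi / (1 / 4) * (n + Complex.I * b) ^ 2) := by
    intro n
    rw [← Complex.exp_add]
    congr 1
    have hI : Complex.I * b = meshA / 2 * (Complex.I * z 1 - (meshA * k + z 0 - 2 * t)) := by
      rw [hb]
      linear_combination (meshA / 2 * (meshA * k + z 0 - 2 * t) : ℂ) * Complex.I_sq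
    rw [hI, mixedExponent, hc]
    ring
  simp only [e1, e2, tsum_mul_left]
  rw [h]
  ring

/-- Now the time index carries `e^{-πk²}`, and the dual sum consists of windows shifted by the
adjoint lattice. The sign of `m` is flipped to match the convention of `shiftWeight`. -/
theorem poisson_first_coordinate (z : Plane) (t : ℝ) (n : ℤ) :
    ∑' k : ℤ, Complex.exp (mixedExponent (z 0) (z 1) t k n) =
      ∑' m : ℤ, shiftWeight z (n, m) * windowKernel (z - latPt (2 • (n, m))) t := by
  have ha := meshA_sq_complex
  set b : ℂ := 2 * meshA * t + n with hb
  set c : ℂ := -(Real.pi : ℂ) * (t : ℂ) ^ 2 -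
    Real.pi / 2 * ((z 0 : ℂ) ^ 2 + (z 1 : ℂ) ^ 2) - Real.pi * Complex.I * z 1 * z 0 -
    4 * Real.pi * (n + meshA / 2 * (Complex.I * z 1 - (z 0 - 2 * t))) ^ 2 with hc
  have h := Complex.tsum_exp_neg_quadratic (a := 1) (by norm_num) b
  have e1 : ∀ k : ℤ, Complex.exp (mixedExponent (z 0) (z 1) t k n) =
      Complex.exp c * Complex.exp (-Real.pi * 1 * k ^ 2 + 2 * Real.pi * b * k) := by
    intro k
    rw [← Complex.exp_add, mixedExponent, hb, hc]
    congr 1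
    linear_combination ((k : ℂ) ^ 2 * (-(3 * Real.pi / 2) - Real.pi * (meshA ^ 2 + 1 / 2)) +
      4 * Real.pi * (n + meshA / 2 * (Complex.I * z 1 - z 0 + 2 * t)) * k) * ha
  have e2 : ∀ m : ℤ, shiftWeight z (n, -m) * windowKernel (z - latPt (2 • (n, -m))) t =
      Complex.exp c * Complex.exp (-Real.pi / 1 * (m + Complex.I * b) ^ 2) := by
    intro m
    -- Expanding the square with `b = 2𝔞t + n` leaves a phase `e^{-2πimn} = 1`.
    have hper : Complex.exp (-Real.pi / 1 * (m + Complex.I * b) ^ 2) =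
        Complex.exp (-Real.pi * m ^ 2 - 4 * Real.pi * Complex.I * meshA * m * t + Real.pi * b ^ 2) := by
      rw [Complex.exp_eq_exp_iff_exists_int]
      refine ⟨-(m * n), ?_⟩
      rw [hb]
      push_cast
      linear_combination (-(Real.pi : ℂ) * (2 * meshA * t + n) ^ 2) * Complex.I_sq
    rw [hper]
    simp only [shiftWeight, windowKernel, ← Complex.exp_add, PiLp.sub_apply, latPt_zero_coord,
      latPt_one_coord]
    congr 1
    rw [hb, hc]
    simp only [two_nsmul, Prod.mk_add_mk]
    push_cast
    linear_combination (-((-(Real.pi : ℂ) * (Complex.I * z 1 - z 0 + 2 * t) ^ 2 + 4 * Real.pi * t ^ 2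
      + 4 * Real.pi * n ^ 2))) * ha + (Real.pi : ℂ) / 2 * z 1 ^ 2 * Complex.I_sq
  rw [← (Equiv.neg ℤ).tsum_eq (fun m => shiftWeight z (n, m) * windowKernel (z - latPt (2 • (n, m))) t)]
  simp only [Equiv.neg_apply, e1, e2, tsum_mul_left]
  rw [h]
  simp

/-- The two contributions of `y²` to the real part cancel because `𝔞² = 1/2`. What remains is a
Gaussian in `k` times a Gaussian in `n` whose centre depends on `k`. -/
theorem norm_exp_mixedExponent_le (x y t : ℝ) (k n : ℤ) :
    ‖Complex.exp (mixedExponent x y t k n)‖ ≤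
      Real.exp (-(Real.pi / 4 * ((k : ℝ) - x / meshA) ^ 2)) *
      Real.exp (-(4 * Real.pi * ((n : ℝ) - meshA / 2 * (meshA * k + x - 2 * t)) ^ 2)) := by
  have e : mixedExponent x y t k n =
      ((-(Real.pi * (t - meshA * k) ^ 2) - Real.pi / 2 * (x - meshA * k) ^ 2 -
        4 * Real.pi * ((n : ℝ) - meshA / 2 * (meshA * k + x - 2 * t)) ^ 2 : ℝ) : ℂ) +
      ((-(Real.pi * y * (meshA * k + x)) -
        4 * Real.pi * (n - meshA / 2 * (meshA * k + x - 2 * t)) * (meshA * y) : ℝ) : ℂ) *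
        Complex.I := by
    rw [mixedExponent]
    push_cast
    linear_combination (Real.pi * (y : ℂ) ^ 2) * meshA_sq_complex -
      (Real.pi * (y : ℂ) ^ 2 * meshA ^ 2) * Complex.I_sq
  have h1 : (x - meshA * k) ^ 2 = 1 / 2 * ((k : ℝ) - x / meshA) ^ 2 := by
    have hp := meshA_pos.ne'
    rw [← meshA_sq]; field_simp; ring
  have h2 : 0 ≤ Real.pi * (t - meshA * k) ^ 2 := mul_nonneg Real.pi_pos.le (sq_nonneg _)
  rw [Complex.norm_exp, e, Complex.add_re, Complex.ofReal_re, Complex.re_ofReal_mul, Complex.I_re,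
    mul_zero, add_zero, ← Real.exp_add, Real.exp_le_exp, h1]
  linarith

theorem summable_skew_gaussian {c d : ℝ} (hc : 0 < c) (hd : 0 < d) (x : ℝ) (w : ℤ → ℝ) :
    Summable fun p : ℤ × ℤ => Real.exp (-(c * ((p.1 : ℝ) - x) ^ 2)) *
      Real.exp (-(d * ((p.2 : ℝ) - w p.1) ^ 2)) := by
  have h0 : (0 : ℤ × ℤ → ℝ) ≤ fun p : ℤ × ℤ => Real.exp (-(c * ((p.1 : ℝ) - x) ^ 2)) *
      Real.exp (-(d * ((p.2 : ℝ) - w p.1) ^ 2)) := by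
    intro p
    simp only [Pi.zero_apply]
    positivity
  have h1 : ∀ k : ℤ, Summable fun n : ℤ => Real.exp (-(c * ((k : ℝ) - x) ^ 2)) *
      Real.exp (-(d * ((n : ℝ) - w k) ^ 2)) := fun k =>
    Summable.mul_left _ (summable_and_tsum_gaussian_le hd (w k)).1
  have h2 : ∀ k : ℤ, ∑' n : ℤ, Real.exp (-(c * ((k : ℝ) - x) ^ 2)) *
      Real.exp (-(d * ((n : ℝ) - w k) ^ 2)) ≤
      Real.exp (-(c * ((k : ℝ) - x) ^ 2)) * (2 / (1 - Real.exp (-d))) := by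
    intro k
    rw [tsum_mul_left]
    exact mul_le_mul_of_nonneg_left (summable_and_tsum_gaussian_le hd (w k)).2 (Real.exp_pos _).le
  have h3 : Summable fun k : ℤ => Real.exp (-(c * ((k : ℝ) - x) ^ 2)) * (2 / (1 - Real.exp (-d))) :=
    Summable.mul_right _ (summable_and_tsum_gaussian_le hc x).1
  refine (summable_prod_of_nonneg h0).mpr ⟨h1, ?_⟩
  refine Summable.of_nonneg_of_le (fun k => tsum_nonneg fun n => h0 (k, n)) h2 h3

theorem summable_mixedExponent (x y t : ℝ) :
    Summable fun p : ℤ × ℤ => Complex.exp (mixedExponent x y t p.1 p.2) :=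
  Summable.of_norm_bounded
    (summable_skew_gaussian (c := Real.pi / 4) (d := 4 * Real.pi)
      (div_pos Real.pi_pos (by norm_num)) (mul_pos (by norm_num) Real.pi_pos) (x / meshA)
      (fun k => meshA / 2 * (meshA * k + x - 2 * t)))
    (fun p => norm_exp_mixedExponent_le x y t p.1 p.2)

theorem summable_shift_mul_window (z : Plane) (t : ℝ) :
    Summable fun b : ℤ × ℤ => shiftWeight z b * windowKernel (z - latPt (2 • b)) t := by
  refine Summable.of_norm_bounded summable_thetaWeight fun b => ?_
  rw [norm_mul, norm_shiftWeight]
  exact mul_le_of_le_one_right (thetaWeight_pos b).le (norm_windowKernel_le_one _ _)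

/-- The Janssen identity before integration against `f`, pointwise in `t`. -/
theorem tsum_window_mul_kernel (z : Plane) (t : ℝ) :
    ∑' a : ℤ × ℤ, windowKernel (latPt a) t * gaborKernel z (latPt a) =
      2 * ∑' b : ℤ × ℤ, shiftWeight z b * windowKernel (z - latPt (2 • b)) t := by
  rw [(summable_window_mul_kernel z t).tsum_prod, (summable_shift_mul_window z t).tsum_prod]
  simp only [poisson_second_coordinate, ← poisson_first_coordinate, tsum_mul_left]
  congr 1
  exact (Summable.tsum_comm (f := fun k n => Complex.exp (mixedExponent (z 0) (z 1) t k n))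
    (summable_mixedExponent (z 0) (z 1) t)).symm

end

noncomputable section

/-! ### The Gabor transform of a square-integrable function -/

theorem gabor_eq (f : ℝ → ℂ) (p : Plane) :
    gabor f p = (((2 : ℝ) ^ (1 / 4 : ℝ) : ℝ) : ℂ) * ∫ t : ℝ, f t * windowKernel p t := by
  simp only [gabor, windowKernel, mul_assoc]

theorem continuous_windowKernel (p : Plane) : Continuous (windowKernel p) := by
  unfold windowKernel
  fun_prop

theorem integrable_gaussian_shift {c : ℝ} (hc : 0 < c) (x : ℝ) :
    Integrable fun t : ℝ => Real.exp (-(c * (t - x) ^ 2)) := by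
  have h := (integrable_exp_neg_mul_sq hc).comp_sub_right x
  simpa only [neg_mul] using h

/-- A pointwise substitute for Cauchy–Schwarz; its integral does not depend on `p`, which is what
the exchange of sum and integral requires. -/
theorem norm_mul_windowKernel_le (f : ℝ → ℂ) (p : Plane) (t : ℝ) :
    ‖f t * windowKernel p t‖ ≤ ‖f t‖ ^ 2 + Real.exp (-(2 * Real.pi * (t - p 0) ^ 2)) := by
  rw [norm_mul, norm_windowKernel]
  have e : Real.exp (-(2 * Real.pi * (t - p 0) ^ 2)) = Real.exp (-(Real.pi * (t - p 0) ^ 2)) ^ 2 := by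
    rw [← Real.exp_nat_mul]; congr 1; push_cast; ring
  rw [e]
  nlinarith [sq_nonneg (‖f t‖ - Real.exp (-(Real.pi * (t - p 0) ^ 2))), sq_nonneg (‖f t‖),
    sq_nonneg (Real.exp (-(Real.pi * (t - p 0) ^ 2)))]

variable {f : ℝ → ℂ}

theorem integrable_sq_add_gaussian (hf : MemLp f 2 volume) {c : ℝ} (hc : 0 < c) (x : ℝ) :
    Integrable fun t : ℝ => ‖f t‖ ^ 2 + Real.exp (-(c * (t - x) ^ 2)) :=
  Integrable.add (MemLp.integrable_norm_pow (p := 2) (by exact_mod_cast hf) two_ne_zero)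
    (integrable_gaussian_shift hc x)

theorem integrable_mul_windowKernel (hf : MemLp f 2 volume) (p : Plane) :
    Integrable fun t : ℝ => f t * windowKernel p t := by
  refine (integrable_sq_add_gaussian hf (c := 2 * Real.pi) (by positivity) (p 0)).mono'
    (hf.1.mul (continuous_windowKernel p).aestronglyMeasurable) ?_
  exact Filter.Eventually.of_forall fun t => norm_mul_windowKernel_le f p t

theorem integral_norm_mul_windowKernel_le (hf : MemLp f 2 volume) (p : Plane) :
    ∫ t : ℝ, ‖f t * windowKernel p t‖ ≤
      ∫ t : ℝ, (‖f t‖ ^ 2 + Real.exp (-(2 * Real.pi * t ^ 2))) := by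
  have h2 : (0 : ℝ) < 2 * Real.pi := by positivity
  have hsq : Integrable fun t : ℝ => ‖f t‖ ^ 2 :=
    MemLp.integrable_norm_pow (p := 2) (by exact_mod_cast hf) two_ne_zero
  calc ∫ t : ℝ, ‖f t * windowKernel p t‖
      ≤ ∫ t : ℝ, (‖f t‖ ^ 2 + Real.exp (-(2 * Real.pi * (t - p 0) ^ 2))) :=
        integral_mono (integrable_mul_windowKernel hf p).norm
          (integrable_sq_add_gaussian hf h2 (p 0)) (fun t => norm_mul_windowKernel_le f p t)
    _ = (∫ t : ℝ, ‖f t‖ ^ 2) + ∫ t : ℝ, Real.exp (-(2 * Real.pi * (t - p 0) ^ 2)) :=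
        integral_add hsq (integrable_gaussian_shift h2 _)
    _ = (∫ t : ℝ, ‖f t‖ ^ 2) + ∫ t : ℝ, Real.exp (-(2 * Real.pi * t ^ 2)) := by
        rw [integral_sub_right_eq_self (fun t : ℝ => Real.exp (-(2 * Real.pi * t ^ 2))) (p 0)]
    _ = _ := by
        have h0 := integrable_gaussian_shift h2 0
        simp only [sub_zero] at h0
        exact (integral_add hsq h0).symm

theorem synthesis_gabor (hf : MemLp f 2 volume) (z : Plane) :
    synthesis (gabor f) z = 2 * shiftSum (gabor f) z := by
  set C := ∫ t : ℝ, (‖f t‖ ^ 2 + Real.exp (-(2 * Real.pi * t ^ 2))) with hC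
  have h1 := hasSum_integral_of_summable_integral_norm (μ := (volume : Measure ℝ))
    (F := fun (a : ℤ × ℤ) (t : ℝ) => f t * windowKernel (latPt a) t * gaborKernel z (latPt a))
    (fun a => (integrable_mul_windowKernel hf (latPt a)).mul_const _) (by
      simp only [norm_mul _ (gaborKernel z _), integral_mul_const, norm_gaborKernel]
      refine Summable.of_nonneg_of_le (fun a => mul_nonneg (integral_nonneg fun t => norm_nonneg _)
        (Real.exp_pos _).le) (fun a => ?_) ((summable_lattice_gaussian_half z).mul_left C)
      exact mul_le_mul_of_nonneg_right (integral_norm_mul_windowKernel_le hf _) (Real.exp_pos _).le)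
  have h2 := hasSum_integral_of_summable_integral_norm (μ := (volume : Measure ℝ))
    (F := fun (b : ℤ × ℤ) (t : ℝ) => shiftWeight z b * (f t * windowKernel (z - latPt (2 • b)) t))
    (fun b => (integrable_mul_windowKernel hf _).const_mul _) (by
      simp only [norm_mul (shiftWeight z _), integral_const_mul, norm_shiftWeight]
      refine Summable.of_nonneg_of_le (fun b => mul_nonneg (thetaWeight_pos b).le
        (integral_nonneg fun t => norm_nonneg _)) (fun b => ?_) (summable_thetaWeight.mul_right C)
      exact mul_le_mul_of_nonneg_left (integral_norm_mul_windowKernel_le hf _)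
        (thetaWeight_pos b).le)
  have e1 : synthesis (gabor f) z = (((2 : ℝ) ^ (1 / 4 : ℝ) : ℝ) : ℂ) *
      ∫ t : ℝ, ∑' a : ℤ × ℤ, f t * windowKernel (latPt a) t * gaborKernel z (latPt a) := by
    rw [← h1.tsum_eq, ← tsum_mul_left, synthesis]
    refine tsum_congr fun a => ?_
    rw [integral_mul_const, gabor_eq, mul_assoc]
  have e2 : shiftSum (gabor f) z = (((2 : ℝ) ^ (1 / 4 : ℝ) : ℝ) : ℂ) *
      ∫ t : ℝ, ∑' b : ℤ × ℤ, shiftWeight z b * (f t * windowKernel (z - latPt (2 • b)) t) := by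
    rw [← h2.tsum_eq, ← tsum_mul_left, shiftSum]
    refine tsum_congr fun b => ?_
    rw [integral_const_mul, gabor_eq, mul_left_comm]
  have e3 : ∀ t : ℝ, ∑' a : ℤ × ℤ, f t * windowKernel (latPt a) t * gaborKernel z (latPt a) =
      2 * ∑' b : ℤ × ℤ, shiftWeight z b * (f t * windowKernel (z - latPt (2 • b)) t) := by
    intro t
    simp only [mul_assoc (f t), mul_left_comm _ (f t), tsum_mul_left]
    rw [tsum_window_mul_kernel]
  rw [e1, e2]
  simp only [e3, integral_const_mul]
  ring

theorem continuous_gabor (hf : MemLp f 2 volume) : Continuous (gabor f) := by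
  have heq : gabor f = fun p => (((2 : ℝ) ^ (1 / 4 : ℝ) : ℝ) : ℂ) *
      ∫ t : ℝ, f t * windowKernel p t := funext (gabor_eq f)
  rw [heq]
  refine continuous_const.mul (continuous_iff_continuousAt.mpr fun p => ?_)
  have hnear : ∀ᶠ q : Plane in nhds p, |q 0 - p 0| ≤ 1 := by
    have hc : Continuous fun q : Plane => |q 0 - p 0| := by fun_prop
    have h0 : |p 0 - p 0| < 1 := by simp
    exact (hc.continuousAt.eventually_lt continuousAt_const h0).mono fun q hq => hq.le
  -- For `|q₀ - p₀| ≤ 1` one has `(t-p₀)² ≤ 2(t-q₀)² + 2`, whence the halved Gaussian rate and the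
  -- factor `e^{2π}`.
  refine continuousAt_of_dominated (bound := fun t => Real.exp (2 * Real.pi) *
    (‖f t‖ ^ 2 + Real.exp (-(Real.pi * (t - p 0) ^ 2)))) ?_ ?_ ?_ ?_
  · exact Filter.Eventually.of_forall fun q =>
      hf.1.mul (continuous_windowKernel q).aestronglyMeasurable
  · filter_upwards [hnear] with q hq
    refine Filter.Eventually.of_forall fun t => (norm_mul_windowKernel_le f q t).trans ?_
    rw [mul_add, ← Real.exp_add]
    have h1 : 1 ≤ Real.exp (2 * Real.pi) := Real.one_le_exp (by positivity)
    have hq2 : (q 0 - p 0) ^ 2 ≤ 1 := by rw [← sq_abs]; nlinarith [abs_nonneg (q 0 - p 0)]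
    refine add_le_add (le_mul_of_one_le_left (sq_nonneg _) h1) (Real.exp_le_exp.mpr ?_)
    nlinarith [Real.pi_pos, mul_nonneg Real.pi_pos.le (sq_nonneg ((t - q 0) - (q 0 - p 0)))]
  · exact (integrable_sq_add_gaussian hf Real.pi_pos (p 0)).const_mul _
  · refine Filter.Eventually.of_forall fun t => Continuous.continuousAt ?_
    unfold windowKernel
    fun_prop

/-- By continuity, the set where the essential bound fails is open and null, hence empty. -/
theorem norm_gabor_le_one (hf : MemLp f 2 volume) (hSf : eLpNorm (spectrogram f) ⊤ volume ≤ 1)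
    (p : Plane) : ‖gabor f p‖ ≤ 1 := by
  have hcont : Continuous (spectrogram f) := by
    unfold spectrogram
    exact (continuous_gabor hf).norm.pow 2
  have hae : ∀ᵐ q : Plane, spectrogram f q ≤ 1 := by
    rw [eLpNorm_exponent_top] at hSf
    filter_upwards [ae_le_eLpNormEssSup (f := spectrogram f) (μ := volume)] with q hq
    have h := hq.trans hSf
    rw [← ofReal_norm, ENNReal.ofReal_le_one] at h
    exact (le_abs_self _).trans h
  have hopen : IsOpen {q : Plane | 1 < spectrogram f q} := isOpen_lt continuous_const hcont
  have hzero : volume {q : Plane | 1 < spectrogram f q} = 0 := by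
    rw [ae_iff] at hae
    simpa only [not_le] using hae
  have hempty := (hopen.measure_eq_zero_iff volume).mp hzero
  have hp : ¬ 1 < spectrogram f p := fun h => by
    have : p ∈ {q : Plane | 1 < spectrogram f q} := h
    rw [hempty] at this
    exact this
  rw [spectrogram, not_lt] at hp
  exact (sq_le_one_iff₀ (norm_nonneg _)).mp hp

/-! ### Approximate expansion in the shifted Gaussians -/

/-- The iterates of `X ↦ X - shiftSum X`. -/
def shiftResidual (X : Plane → ℂ) : ℕ → Plane → ℂ
  | 0 => X
  | n + 1 => fun z => shiftResidual X n z - shiftSum (shiftResidual X n) z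

theorem norm_shiftResidual_le {X : Plane → ℂ} (hX : ∀ p, ‖X p‖ ≤ 1) (n : ℕ) (p : Plane) :
    ‖shiftResidual X n p‖ ≤ (1 / 2) ^ n := by
  induction n generalizing p with
  | zero => simpa [shiftResidual] using hX p
  | succ n ih =>
    refine (norm_shiftSum_sub_le ih p).trans (le_of_eq ?_)
    rw [pow_succ]; ring

theorem shiftSum_sub {X Y : Plane → ℂ} {C C' : ℝ} (hX : ∀ p, ‖X p‖ ≤ C) (hY : ∀ p, ‖Y p‖ ≤ C')
    (z : Plane) : shiftSum (fun p => X p - Y p) z = shiftSum X z - shiftSum Y z := by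
  unfold shiftSum
  rw [← (summable_shiftSum hX z).tsum_sub (summable_shiftSum hY z)]
  exact tsum_congr fun b => by ring

theorem synthesis_sub {X Y : Plane → ℂ} {C C' : ℝ} (hX : ∀ p, ‖X p‖ ≤ C) (hY : ∀ p, ‖Y p‖ ≤ C')
    (z : Plane) : synthesis (fun p => X p - Y p) z = synthesis X z - synthesis Y z := by
  unfold synthesis
  rw [← (summable_synthesis hX z).tsum_sub (summable_synthesis hY z)]
  exact tsum_congr fun b => by ring

theorem norm_shiftSum_le {X : Plane → ℂ} {C : ℝ} (hX : ∀ p, ‖X p‖ ≤ C) (z : Plane) :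
    ‖shiftSum X z‖ ≤ C + C / 2 := by
  have h := norm_shiftSum_sub_le hX z
  have h2 := norm_sub_le (X z) (X z - shiftSum X z)
  rw [sub_sub_cancel] at h2
  linarith [hX z]

theorem synthesis_shiftResidual {X : Plane → ℂ} (hX : ∀ p, ‖X p‖ ≤ 1)
    (hsyn : ∀ z, synthesis X z = 2 * shiftSum X z) (n : ℕ) (z : Plane) :
    synthesis (shiftResidual X n) z = 2 * shiftSum (shiftResidual X n) z := by
  induction n generalizing z with
  | zero => exact hsyn z
  | succ n ih =>
    have hb := norm_shiftResidual_le hX n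
    have hfun : synthesis (shiftResidual X n) = fun z => 2 * shiftSum (shiftResidual X n) z := funext ih
    have hmul : ∀ Y : Plane → ℂ, shiftSum (fun z => 2 * Y z) z = 2 * shiftSum Y z := by
      intro Y
      unfold shiftSum
      rw [← tsum_mul_left]
      exact tsum_congr fun b => by ring
    simp only [shiftResidual]
    rw [synthesis_sub hb (norm_shiftSum_le hb), shiftSum_sub hb (norm_shiftSum_le hb),
      synthesis_shiftSum hb, ih, hfun, hmul]
    ring

/-- With `G_n = (1-W)^n 𝒢f`, the relation `synthesis G_n = 2WG_n = 2(G_n - G_{n+1})` telescopes.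
Thus `X = ½∑_{n<N} G_n` synthesizes `𝒢f - G_N`, and its sup norm is at most `½∑ 2^{-n} ≤ 1`. -/
theorem exists_bounded_expansion (hf : MemLp f 2 volume) (hG : ∀ p, ‖gabor f p‖ ≤ 1) {δ : ℝ}
    (hδ : 0 < δ) : ∃ X : Plane → ℂ, (∀ p, ‖X p‖ ≤ 1) ∧ ∀ z, ‖gabor f z - synthesis X z‖ ≤ δ := by
  obtain ⟨N, hN⟩ := exists_pow_lt_of_lt_one hδ (by norm_num : (1 / 2 : ℝ) < 1)
  have key : ∀ n : ℕ, ∃ X : Plane → ℂ, (∀ p, ‖X p‖ ≤ 1 - (1 / 2) ^ n) ∧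
      ∀ z, synthesis X z = gabor f z - shiftResidual (gabor f) n z := by
    intro n
    induction n with
    | zero => exact ⟨fun _ => 0, by simp, by simp [synthesis, shiftResidual]⟩
    | succ n ih =>
      obtain ⟨X, hX, hXs⟩ := ih
      have hb := norm_shiftResidual_le hG n
      have hb2 : ∀ p, ‖-(1 / 2 : ℂ) * shiftResidual (gabor f) n p‖ ≤ 1 / 2 * (1 / 2) ^ n := by
        intro p
        rw [norm_mul, norm_neg]
        norm_num
        simpa using hb p
      refine ⟨fun p => X p - -(1 / 2 : ℂ) * shiftResidual (gabor f) n p, fun p => ?_, fun z => ?_⟩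
      · refine (norm_sub_le _ _).trans ((add_le_add (hX p) (hb2 p)).trans (le_of_eq ?_))
        rw [pow_succ]; ring
      · rw [synthesis_sub hX hb2, hXs]
        have e : synthesis (fun p => -(1 / 2 : ℂ) * shiftResidual (gabor f) n p) z =
            -(1 / 2 : ℂ) * synthesis (shiftResidual (gabor f) n) z := by
          unfold synthesis
          rw [← tsum_mul_left]
          exact tsum_congr fun a => by ring
        rw [e, synthesis_shiftResidual hG (synthesis_gabor hf)]
        simp only [shiftResidual]
        ring
  obtain ⟨X, hX, hXs⟩ := key N
  refine ⟨X, fun p => (hX p).trans (by linarith [pow_pos (by norm_num : (0 : ℝ) < 1 / 2) N]),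
    fun z => ?_⟩
  rw [hXs, sub_sub_cancel]
  exact (norm_shiftResidual_le hG N z).trans hN.le

end

noncomputable section

/-! ### Gram representation of positive semidefinite matrices -/

open scoped MatrixOrder Matrix.Norms.L2Operator in
theorem posSemidef_exists_vectors {V : Type} [Fintype V] {Y : Matrix V V ℂ} (hY : Y.PosSemidef) :
    ∃ y : V → EuclideanSpace ℂ V, ∀ u v, Y u v = ∑ j, y j u * star (y j v) := by
  classical
  obtain ⟨B, hB⟩ := CStarAlgebra.nonneg_iff_eq_star_mul_self.mp hY.nonneg
  refine ⟨fun j => WithLp.toLp 2 fun u => star (B j u), fun u v => ?_⟩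
  rw [hB, Matrix.mul_apply]
  simp [Matrix.star_apply]

section Gram

variable {V : Type} [Fintype V] {Y : Matrix V V ℂ} {y : V → EuclideanSpace ℂ V}

theorem inner_eq_sum (a b : EuclideanSpace ℂ V) : inner ℂ a b = ∑ u, star (a u) * b u := by
  rw [EuclideanSpace.inner_eq_star_dotProduct, dotProduct]
  exact Finset.sum_congr rfl fun u _ => by simp [mul_comm]

open Classical in
theorem inner_toEuclideanLin_eq (hy : ∀ u v, Y u v = ∑ j, y j u * star (y j v))
    (a : EuclideanSpace ℂ V) :
    inner ℂ a (Matrix.toEuclideanLin Y a) = ((∑ j, ‖inner ℂ a (y j)‖ ^ 2 : ℝ) : ℂ) := by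
  have h1 : ∀ j, ((‖inner ℂ a (y j)‖ ^ 2 : ℝ) : ℂ) =
      (∑ u, star (a u) * y j u) * ∑ v, star (y j v) * a v := by
    intro j
    rw [← inner_eq_sum, ← inner_eq_sum, ← inner_conj_symm (y j) a, Complex.mul_conj,
      Complex.normSq_eq_norm_sq]
  rw [Complex.ofReal_sum, Finset.sum_congr rfl fun j _ => h1 j, inner_eq_sum]
  simp only [Finset.sum_mul_sum]
  rw [Finset.sum_comm]
  refine Finset.sum_congr rfl fun u _ => ?_
  rw [Finset.sum_comm]
  simp only [Matrix.toLpLin_apply, Matrix.mulVec, dotProduct, hy, Finset.sum_mul, Finset.mul_sum]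
  exact Finset.sum_congr rfl fun v _ => Finset.sum_congr rfl fun j _ => by ring

theorem trace_eq_sum_norm_sq (hy : ∀ u v, Y u v = ∑ j, y j u * star (y j v)) :
    Y.trace = ((∑ j, ‖y j‖ ^ 2 : ℝ) : ℂ) := by
  simp only [Matrix.trace, Matrix.diag_apply, hy]
  rw [Finset.sum_comm, Complex.ofReal_sum]
  refine Finset.sum_congr rfl fun j _ => ?_
  rw [EuclideanSpace.norm_sq_eq, Complex.ofReal_sum]
  refine Finset.sum_congr rfl fun u _ => ?_
  rw [Complex.star_def, Complex.mul_conj, Complex.normSq_eq_norm_sq]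

end Gram

/-! ### Quadratic form against trace. -/

section TopEigenvalue

variable {V : Type} [Fintype V] {Y : Matrix V V ℂ}

-- Bessel's inequality for the orthonormal pair `a, b`, applied to each Gram vector of `Y`.
open Classical in
theorem quadForm_add_le_trace (hY : Y.PosSemidef) {a b : EuclideanSpace ℂ V} (ha : ‖a‖ = 1)
    (hb : ‖b‖ = 1) (hab : inner ℂ a b = 0) :
    (inner ℂ a (Matrix.toEuclideanLin Y a)).re + (inner ℂ b (Matrix.toEuclideanLin Y b)).re ≤
      Y.trace.re := by
  obtain ⟨y, hy⟩ := posSemidef_exists_vectors hY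
  rw [inner_toEuclideanLin_eq hy, inner_toEuclideanLin_eq hy, trace_eq_sum_norm_sq hy]
  simp only [Complex.ofReal_re]
  rw [← Finset.sum_add_distrib]
  refine Finset.sum_le_sum fun j _ => ?_
  have hon : Orthonormal ℂ ![a, b] := by
    rw [orthonormal_vecCons_iff]
    refine ⟨ha, ?_, ?_⟩
    · intro i; fin_cases i; simpa using hab
    · rw [orthonormal_vecCons_iff]
      exact ⟨hb, fun i => i.elim0, by simp [Orthonormal, Pairwise]⟩
  have h := hon.sum_inner_products_le (y j) (s := Finset.univ)
  simpa [Fin.sum_univ_two] using h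

open Classical in
theorem quadForm_le_trace (hY : Y.PosSemidef) {a : EuclideanSpace ℂ V} (ha : ‖a‖ = 1) :
    (inner ℂ a (Matrix.toEuclideanLin Y a)).re ≤ Y.trace.re := by
  obtain ⟨y, hy⟩ := posSemidef_exists_vectors hY
  rw [inner_toEuclideanLin_eq hy, trace_eq_sum_norm_sq hy]
  simp only [Complex.ofReal_re]
  refine Finset.sum_le_sum fun j _ => ?_
  have := norm_inner_le_norm (𝕜 := ℂ) a (y j)
  rw [ha, one_mul] at this
  gcongr

end TopEigenvalue

/-! ### Rayleigh quotients of Hermitian matrices -/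

theorem re_inner_toEuclideanLin_eq_sum {𝕜 : Type} [RCLike 𝕜] {V : Type} [Fintype V] [DecidableEq V]
    {A : Matrix V V 𝕜} (hA : A.IsHermitian) (a : EuclideanSpace 𝕜 V) :
    RCLike.re (inner 𝕜 a (Matrix.toEuclideanLin A a)) =
      ∑ i, hA.eigenvalues i * ‖inner 𝕜 (hA.eigenvectorBasis i) a‖ ^ 2 := by
  have hT := Matrix.isSymmetric_toEuclideanLin_iff.mpr hA
  have he : ∀ i, Matrix.toEuclideanLin A (hA.eigenvectorBasis i) =
      ((hA.eigenvalues i : ℝ) : 𝕜) • hA.eigenvectorBasis i := by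
    intro i
    have h := hA.mulVec_eigenvectorBasis i
    rw [Matrix.toLpLin_apply, h]
    ext u
    simp [RCLike.real_smul_eq_coe_mul]
  rw [← hA.eigenvectorBasis.sum_inner_mul_inner, map_sum]
  refine Finset.sum_congr rfl fun i _ => ?_
  rw [← hT, he, inner_smul_left, ← inner_conj_symm a, RCLike.conj_ofReal]
  rw [mul_left_comm, RCLike.conj_mul, RCLike.re_ofReal_mul, ← RCLike.ofReal_pow, RCLike.ofReal_re]

/-! ### The spectral gap of the weighted Laplacian -/

section Laplacian

variable {V : Type} [Fintype V] (G : SimpleGraph V) (α : V → ℝ)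

open Classical in
theorem weightedLaplacian_mulVec (w : V → ℝ) (hα : ∀ v, 0 ≤ α v) (u : V) :
    (weightedLaplacian G α).mulVec w u =
      ∑ v, if G.Adj u v then α v * w u - √(α u) * √(α v) * w v else 0 := by
  have h : ∀ v, weightedLaplacian G α u v * w v =
      (if u = v then (∑ z ∈ Finset.univ.filter (fun z => G.Adj u z), α z) * w v else 0) -
        (if G.Adj u v then √(α u) * √(α v) * w v else 0) := by
    intro v
    unfold weightedLaplacian
    by_cases huv : u = v
    · subst huv
      simp
    · by_cases ha : G.Adj u v
      · simp [huv, ha, Real.sqrt_mul (hα u)]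
      · simp [huv, ha]
  rw [Matrix.mulVec, dotProduct, Finset.sum_congr rfl fun v _ => h v, Finset.sum_sub_distrib,
    Finset.sum_ite_eq Finset.univ u, if_pos (Finset.mem_univ u), Finset.sum_filter,
    Finset.sum_mul, ← Finset.sum_sub_distrib]
  refine Finset.sum_congr rfl fun v _ => ?_
  split_ifs <;> ring

open Classical in
theorem inner_weightedLaplacian (hα : ∀ v, 0 ≤ α v) (w : EuclideanSpace ℝ V) :
    inner ℝ w (Matrix.toEuclideanLin (weightedLaplacian G α) w) =
      1 / 2 * ∑ u, ∑ v, if G.Adj u v then (√(α v) * w u - √(α u) * w v) ^ 2 else 0 := by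
  have h1 : inner ℝ w (Matrix.toEuclideanLin (weightedLaplacian G α) w) =
      ∑ u, ∑ v, if G.Adj u v then α v * w u ^ 2 - √(α u) * √(α v) * w u * w v else 0 := by
    rw [EuclideanSpace.inner_eq_star_dotProduct, dotProduct]
    refine Finset.sum_congr rfl fun u _ => ?_
    rw [Matrix.toLpLin_apply]
    simp only [weightedLaplacian_mulVec G α _ hα, Finset.sum_mul, Pi.star_apply, star_trivial]
    refine Finset.sum_congr rfl fun v _ => ?_
    split_ifs <;> ring
  have h2 : inner ℝ w (Matrix.toEuclideanLin (weightedLaplacian G α) w) =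
      ∑ u, ∑ v, if G.Adj u v then α u * w v ^ 2 - √(α u) * √(α v) * w u * w v else 0 := by
    rw [h1, Finset.sum_comm]
    refine Finset.sum_congr rfl fun u _ => Finset.sum_congr rfl fun v _ => ?_
    rw [G.adj_comm v u]
    split_ifs <;> ring
  have h3 : (∑ u, ∑ v, if G.Adj u v then (√(α v) * w u - √(α u) * w v) ^ 2 else 0) =
      (∑ u, ∑ v, if G.Adj u v then α v * w u ^ 2 - √(α u) * √(α v) * w u * w v else 0) +
      ∑ u, ∑ v, if G.Adj u v then α u * w v ^ 2 - √(α u) * √(α v) * w u * w v else 0 := by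
    rw [← Finset.sum_add_distrib]
    refine Finset.sum_congr rfl fun u _ => ?_
    rw [← Finset.sum_add_distrib]
    refine Finset.sum_congr rfl fun v _ => ?_
    split_ifs
    · linear_combination (w u) ^ 2 * Real.sq_sqrt (hα v) + (w v) ^ 2 * Real.sq_sqrt (hα u)
    · ring
  rw [h3, ← h1, ← h2]
  ring

open Classical in
/-- On the orthogonal complement of the ground state `√α`, the Laplacian is bounded below by the
spectral gap. -/
theorem secondEigenvalue_mul_norm_sq_le (hα : ∀ v, 0 ≤ α v) (hα0 : 0 < ∑ v, α v)
    (hgap : 0 < secondEigenvalue G α) (w : EuclideanSpace ℝ V) (hw : ∑ v, √(α v) * w v = 0) :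
    secondEigenvalue G α * ‖w‖ ^ 2 ≤
      1 / 2 * ∑ u, ∑ v, if G.Adj u v then (√(α v) * w u - √(α u) * w v) ^ 2 else 0 := by
  rw [← inner_weightedLaplacian G α hα]
  set A := weightedLaplacian G α with hA'
  have hA : A.IsHermitian := weightedLaplacian_isHermitian G α
  have hT := Matrix.isSymmetric_toEuclideanLin_iff.mpr hA
  have hcard : 2 ≤ Fintype.card V := by
    by_contra h
    rw [secondEigenvalue, dif_neg h] at hgap
    exact lt_irrefl _ hgap
  set e : Fin (Fintype.card V) ≃ V := Fintype.equivOfCardEq (Fintype.card_fin _) with he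
  -- Eigenvalues are sorted decreasingly, so this is the index of the smallest one; all others are
  -- at least the gap. Since `√α` lies in the kernel and these are positive, `√α` is a multiple of
  -- the eigenvector at `i₀`. Hence `w ⊥ √α` has no component there.
  set i₀ : V := e ⟨Fintype.card V - 1, by omega⟩ with hi₀
  have hge : ∀ i, i ≠ i₀ → secondEigenvalue G α ≤ hA.eigenvalues i := by
    intro i hi
    rw [secondEigenvalue, dif_pos hcard]
    refine hA.eigenvalues₀_antitone ?_
    have hne : (e.symm i).val ≠ Fintype.card V - 1 := by
      intro h
      apply hi
      rw [hi₀, ← e.apply_symm_apply i]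
      congr 1
      exact Fin.ext h
    have hlt := (e.symm i).isLt
    rw [Fin.le_def]
    change (e.symm i).val ≤ Fintype.card V - 2
    omega
  set a : EuclideanSpace ℝ V := WithLp.toLp 2 fun v => √(α v) with ha
  have hAa : Matrix.toEuclideanLin A a = 0 := by
    ext u
    rw [Matrix.toLpLin_apply]
    simp only [hA', ha, weightedLaplacian_mulVec G α _ hα]
    refine Finset.sum_eq_zero fun v _ => ?_
    split_ifs
    · linear_combination (-√(α u)) * Real.sq_sqrt (hα v)
    · rfl
  have hperp : ∀ i, i ≠ i₀ → inner ℝ (hA.eigenvectorBasis i) a = 0 := by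
    intro i hi
    have h1 : Matrix.toEuclideanLin A (hA.eigenvectorBasis i) =
        hA.eigenvalues i • hA.eigenvectorBasis i := by
      rw [Matrix.toLpLin_apply, hA.mulVec_eigenvectorBasis i]
      rfl
    have h2 := hT (hA.eigenvectorBasis i) a
    rw [hAa, inner_zero_right, h1, inner_smul_left] at h2
    have h3 := hgap.trans_le (hge i hi)
    simpa [h3.ne'] using h2
  have haw : inner ℝ a w = 0 := by
    rw [EuclideanSpace.inner_eq_star_dotProduct, dotProduct, ← hw]
    exact Finset.sum_congr rfl fun v _ => by simp [ha, mul_comm]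
  have haa : inner ℝ a a = ∑ v, α v := by
    rw [EuclideanSpace.inner_eq_star_dotProduct, dotProduct]
    exact Finset.sum_congr rfl fun v _ => by simp [ha, Real.mul_self_sqrt (hα v)]
  have hsum : ∀ b : EuclideanSpace ℝ V, inner ℝ a b =
      inner ℝ a (hA.eigenvectorBasis i₀) * inner ℝ (hA.eigenvectorBasis i₀) b := by
    intro b
    rw [← hA.eigenvectorBasis.sum_inner_mul_inner a b]
    refine Finset.sum_eq_single_of_mem i₀ (Finset.mem_univ _) fun i _ hi => ?_
    rw [real_inner_comm, hperp i hi, zero_mul]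
  have hw0 : inner ℝ (hA.eigenvectorBasis i₀) w = 0 := by
    have h1 := hsum a
    have h2 := hsum w
    rw [haw] at h2
    rw [haa] at h1
    rcases mul_eq_zero.mp h2.symm with h | h
    · rw [h, zero_mul] at h1; linarith
    · exact h
  have hq := re_inner_toEuclideanLin_eq_sum hA w
  rw [RCLike.re_to_real] at hq
  rw [hq, ← hA.eigenvectorBasis.sum_sq_norm_inner_right w, Finset.mul_sum]
  refine Finset.sum_le_sum fun i _ => ?_
  by_cases hi : i = i₀
  · rw [hi, hw0]; simp
  · gcongr
    exact hge i hi

-- Dividing out the phases of `x` turns the form into that of the real Laplacian with ground state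
-- `|x|`. The real and imaginary parts of the rotated `y` are then treated separately; where `x`
-- vanishes any phase will do.
open Classical in
theorem secondEigenvalue_mul_norm_sq_le_complex (x : V → ℂ) (hx : 0 < ∑ v, ‖x v‖ ^ 2)
    (hgap : 0 < secondEigenvalue G (fun v => ‖x v‖ ^ 2)) (y : V → ℂ)
    (hxy : ∑ v, star (x v) * y v = 0) :
    secondEigenvalue G (fun v => ‖x v‖ ^ 2) * ∑ v, ‖y v‖ ^ 2 ≤
      1 / 2 * ∑ u, ∑ v, if G.Adj u v then ‖x v * y u - x u * y v‖ ^ 2 else 0 := by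
  obtain ⟨s, hs, hxs⟩ : ∃ s : V → ℂ, (∀ v, ‖s v‖ = 1) ∧ ∀ v, x v = ‖x v‖ * s v := by
    refine ⟨fun v => if x v = 0 then 1 else x v / ‖x v‖, fun v => ?_, fun v => ?_⟩
    · dsimp only
      split_ifs with h
      · simp
      · simp [h]
    · dsimp only
      split_ifs with h
      · simp [h]
      · have : (‖x v‖ : ℂ) ≠ 0 := by simpa using h
        field_simp
  set w : V → ℂ := fun v => star (s v) * y v with hw
  have hss : ∀ v, s v * star (s v) = 1 := by
    intro v
    rw [Complex.star_def, Complex.mul_conj, Complex.normSq_eq_norm_sq, hs]; simp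
  have hyw : ∀ v, y v = s v * w v := fun v => by
    rw [hw]; linear_combination (-(y v)) * hss v
  have hzero : ∑ v, (‖x v‖ : ℂ) * w v = 0 := by
    rw [← hxy]
    refine Finset.sum_congr rfl fun v _ => ?_
    have : star (x v) = ‖x v‖ * star (s v) := by
      conv_lhs => rw [hxs v]
      simp
    rw [this, hw]; ring
  have hsq : ∀ v, √(‖x v‖ ^ 2) = ‖x v‖ := fun v => Real.sqrt_sq (norm_nonneg _)
  have hre := secondEigenvalue_mul_norm_sq_le G (fun v => ‖x v‖ ^ 2) (fun v => sq_nonneg _) hx hgap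
    (WithLp.toLp 2 fun v => (w v).re) (by
      have := congrArg Complex.re hzero
      simpa [hsq] using this)
  have him := secondEigenvalue_mul_norm_sq_le G (fun v => ‖x v‖ ^ 2) (fun v => sq_nonneg _) hx hgap
    (WithLp.toLp 2 fun v => (w v).im) (by
      have := congrArg Complex.im hzero
      simpa [hsq] using this)
  rw [EuclideanSpace.real_norm_sq_eq] at hre him
  simp only [hsq] at hre him
  have hnorm : ∑ v, ‖y v‖ ^ 2 = ∑ v, (w v).re ^ 2 + ∑ v, (w v).im ^ 2 := by
    rw [← Finset.sum_add_distrib]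
    refine Finset.sum_congr rfl fun v _ => ?_
    rw [hyw, norm_mul, hs, one_mul, ← Complex.normSq_eq_norm_sq, Complex.normSq_apply]
    ring
  have hform : (∑ u, ∑ v, if G.Adj u v then ‖x v * y u - x u * y v‖ ^ 2 else 0) =
      (∑ u, ∑ v, if G.Adj u v then (‖x v‖ * (w u).re - ‖x u‖ * (w v).re) ^ 2 else 0) +
      ∑ u, ∑ v, if G.Adj u v then (‖x v‖ * (w u).im - ‖x u‖ * (w v).im) ^ 2 else 0 := by
    rw [← Finset.sum_add_distrib]
    refine Finset.sum_congr rfl fun u _ => ?_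
    rw [← Finset.sum_add_distrib]
    refine Finset.sum_congr rfl fun v _ => ?_
    split_ifs
    · have e : x v * y u - x u * y v = s u * s v * (‖x v‖ * w u - ‖x u‖ * w v) := by
        rw [hyw u, hyw v]
        conv_lhs => rw [hxs v, hxs u]
        ring
      rw [e, norm_mul, norm_mul, hs, hs, one_mul, one_mul, ← Complex.normSq_eq_norm_sq,
        Complex.normSq_apply]
      simp only [Complex.sub_re, Complex.sub_im, Complex.re_ofReal_mul, Complex.im_ofReal_mul]
      ring
    · ring
  rw [hnorm, hform]
  linarith

end Laplacian

end

noncomputable section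

/-! ### Rank-one structure from local information -/

section Propagation

variable {V : Type} [Fintype V]

theorem norm_sq_sub_proj (x y : EuclideanSpace ℂ V) (hx : x ≠ 0) :
    ‖y - (inner ℂ x y / ((‖x‖ ^ 2 : ℝ) : ℂ)) • x‖ ^ 2 = ‖y‖ ^ 2 - ‖inner ℂ x y‖ ^ 2 / ‖x‖ ^ 2 ∧
      inner ℂ x (y - (inner ℂ x y / ((‖x‖ ^ 2 : ℝ) : ℂ)) • x) = 0 := by
  have hE : ‖x‖ ≠ 0 := norm_ne_zero_iff.mpr hx
  have hE2 : ((‖x‖ ^ 2 : ℝ) : ℂ) ≠ 0 := by exact_mod_cast pow_ne_zero 2 hE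
  set c := inner ℂ x y / ((‖x‖ ^ 2 : ℝ) : ℂ) with hc
  have horth : inner ℂ x (y - c • x) = 0 := by
    rw [inner_sub_right, inner_smul_right, inner_self_eq_norm_sq_to_K, hc]
    push_cast at hE2 ⊢
    field_simp
    simp
  refine ⟨?_, horth⟩
  have hcn : ‖c • x‖ ^ 2 = ‖inner ℂ x y‖ ^ 2 / ‖x‖ ^ 2 := by
    rw [norm_smul, hc, norm_div, Complex.norm_real, Real.norm_of_nonneg (sq_nonneg _)]
    field_simp
  have horth2 : inner ℂ (y - c • x) (c • x) = 0 := by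
    rw [inner_smul_right, ← inner_conj_symm, horth]; simp
  have h := norm_add_sq_eq_norm_sq_add_norm_sq_of_inner_eq_zero (y - c • x) (c • x) horth2
  rw [sub_add_cancel] at h
  rw [← hcn]
  linarith [h, sq (‖y‖), sq (‖y - c • x‖), sq (‖c • x‖)]

open Classical in
/-- A positive semidefinite matrix that agrees up to `η` with `x x*` on the diagonal and on the edges
of a graph with maximal degree `D` is concentrated on the span of `x`. -/
theorem secondEigenvalue_mul_trace_sub_le (G : SimpleGraph V) (x : EuclideanSpace ℂ V) (hx : x ≠ 0)
    (hgap : 0 < secondEigenvalue G (fun v => ‖x v‖ ^ 2)) {Y : Matrix V V ℂ} (hY : Y.PosSemidef)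
    {η D : ℝ} (hdiag : ∀ u, ‖Y u u - x u * star (x u)‖ ≤ η)
    (hedge : ∀ u v, G.Adj u v → ‖Y u v - x u * star (x v)‖ ≤ η)
    (hdeg : ∀ u, ((Finset.univ.filter fun v => G.Adj u v).card : ℝ) ≤ D) :
    secondEigenvalue G (fun v => ‖x v‖ ^ 2) *
      (Y.trace.re - (inner ℂ x (Matrix.toEuclideanLin Y x)).re / ‖x‖ ^ 2) ≤
      2 * η * D * ‖x‖ ^ 2 := by
  obtain ⟨y, hy⟩ := posSemidef_exists_vectors hY
  set lam := secondEigenvalue G (fun v => ‖x v‖ ^ 2) with hlam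
  have hE : 0 < ‖x‖ := norm_pos_iff.mpr hx
  have hsumx : ∑ v, ‖x v‖ ^ 2 = ‖x‖ ^ 2 := (EuclideanSpace.norm_sq_eq x).symm
  -- one Gram vector
  have hone : ∀ j, lam * (‖y j‖ ^ 2 - ‖inner ℂ x (y j)‖ ^ 2 / ‖x‖ ^ 2) ≤
      1 / 2 * ∑ u, ∑ v, if G.Adj u v then ‖x v * y j u - x u * y j v‖ ^ 2 else 0 := by
    intro j
    obtain ⟨h1, h2⟩ := norm_sq_sub_proj x (y j) hx
    set c := inner ℂ x (y j) / ((‖x‖ ^ 2 : ℝ) : ℂ)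
    obtain ⟨z, hz⟩ : ∃ z, z = y j - c • x := ⟨_, rfl⟩
    rw [← hz] at h1 h2
    have h := secondEigenvalue_mul_norm_sq_le_complex G x (by rw [hsumx]; positivity) hgap
      z (by rw [← inner_eq_sum]; exact h2)
    rw [← EuclideanSpace.norm_sq_eq, h1] at h
    -- The expression `x_v y_u - x_u y_v` is unchanged when a multiple of `x` is added to `y`, so
    -- the projection may be dropped.
    refine h.trans (le_of_eq ?_)
    congr 1
    refine Finset.sum_congr rfl fun u _ => Finset.sum_congr rfl fun v _ => ?_
    congr 3
    simp only [hz, PiLp.sub_apply, PiLp.smul_apply, smul_eq_mul]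
    ring
  -- the sum over all Gram vectors
  have hpair : ∀ u v, ∑ j, ‖x v * y j u - x u * y j v‖ ^ 2 =
      ‖x v‖ ^ 2 * (Y u u).re + ‖x u‖ ^ 2 * (Y v v).re - 2 * (x v * star (x u) * Y u v).re := by
    intro u v
    have hterm : ∀ j, ‖x v * y j u - x u * y j v‖ ^ 2 =
        ‖x v‖ ^ 2 * (y j u * star (y j u)).re + ‖x u‖ ^ 2 * (y j v * star (y j v)).re -
          2 * (x v * star (x u) * (y j u * star (y j v))).re := by
      intro j
      simp only [← Complex.normSq_eq_norm_sq, Complex.normSq_apply, Complex.sub_re, Complex.sub_im,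
        Complex.mul_re, Complex.mul_im, Complex.star_def, Complex.conj_re, Complex.conj_im]
      ring
    rw [Finset.sum_congr rfl fun j _ => hterm j, Finset.sum_sub_distrib, Finset.sum_add_distrib,
      ← Finset.mul_sum, ← Finset.mul_sum, ← Finset.mul_sum, ← Complex.re_sum, ← Complex.re_sum,
      ← Complex.re_sum, ← Finset.mul_sum, ← hy, ← hy, ← hy]
  have hpair_le : ∀ u v, G.Adj u v → ∑ j, ‖x v * y j u - x u * y j v‖ ^ 2 ≤
      2 * η * ‖x u‖ ^ 2 + 2 * η * ‖x v‖ ^ 2 := by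
    intro u v huv
    have hη : 0 ≤ η := (norm_nonneg _).trans (hdiag u)
    have hself : ∀ w, (Y w w).re ≤ ‖x w‖ ^ 2 + η := by
      intro w
      have h1 := (le_abs_self _).trans ((Complex.abs_re_le_norm _).trans (hdiag w))
      have h2 : (x w * star (x w)).re = ‖x w‖ ^ 2 := by
        rw [Complex.star_def, Complex.mul_conj, Complex.normSq_eq_norm_sq, Complex.ofReal_re]
      rw [Complex.sub_re, h2] at h1
      linarith
    -- The main terms `|x_u|²|x_v|²` cancel against those from the diagonal; the remainder is
    -- `η(|x_u| + |x_v|)²`.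
    have hoff : ‖x u‖ ^ 2 * ‖x v‖ ^ 2 - ‖x u‖ * ‖x v‖ * η ≤ (x v * star (x u) * Y u v).re := by
      have e : x v * star (x u) * Y u v =
          ((‖x u‖ ^ 2 * ‖x v‖ ^ 2 : ℝ) : ℂ) + x v * star (x u) * (Y u v - x u * star (x v)) := by
        have e1 : star (x u) * x u = ((‖x u‖ ^ 2 : ℝ) : ℂ) := by
          rw [mul_comm, Complex.star_def, Complex.mul_conj, Complex.normSq_eq_norm_sq]
        have e2 : x v * star (x v) = ((‖x v‖ ^ 2 : ℝ) : ℂ) := by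
          rw [Complex.star_def, Complex.mul_conj, Complex.normSq_eq_norm_sq]
        rw [Complex.ofReal_mul, ← e1, ← e2]
        ring
      have h1 : ‖x v * star (x u) * (Y u v - x u * star (x v))‖ ≤ ‖x u‖ * ‖x v‖ * η := by
        rw [norm_mul, norm_mul, norm_star, mul_comm ‖x v‖]
        exact mul_le_mul_of_nonneg_left (hedge u v huv) (by positivity)
      have h2 := (neg_le_abs _).trans ((Complex.abs_re_le_norm _).trans h1)
      rw [e, Complex.add_re, Complex.ofReal_re]
      linarith
    rw [hpair]
    have h1 := mul_le_mul_of_nonneg_left (hself u) (sq_nonneg ‖x v‖)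
    have h2 := mul_le_mul_of_nonneg_left (hself v) (sq_nonneg ‖x u‖)
    nlinarith [mul_nonneg hη (sq_nonneg (‖x u‖ - ‖x v‖))]
  have htotal : ∑ j, (1 / 2 * ∑ u, ∑ v, if G.Adj u v then ‖x v * y j u - x u * y j v‖ ^ 2 else 0) ≤
      2 * η * D * ‖x‖ ^ 2 := by
    have hswap : ∑ j, (1 / 2 * ∑ u, ∑ v, if G.Adj u v then ‖x v * y j u - x u * y j v‖ ^ 2 else 0) =
        1 / 2 * ∑ u, ∑ v, if G.Adj u v then ∑ j, ‖x v * y j u - x u * y j v‖ ^ 2 else 0 := by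
      rw [← Finset.mul_sum, Finset.sum_comm]
      congr 1
      refine Finset.sum_congr rfl fun u _ => ?_
      rw [Finset.sum_comm]
      refine Finset.sum_congr rfl fun v _ => ?_
      split_ifs
      · rfl
      · simp
    have hb1 : (∑ u, ∑ v, if G.Adj u v then 2 * η * ‖x u‖ ^ 2 else 0) ≤ 2 * η * D * ‖x‖ ^ 2 := by
      rw [← hsumx, Finset.mul_sum]
      refine Finset.sum_le_sum fun u _ => ?_
      have hη : 0 ≤ η := (norm_nonneg _).trans (hdiag u)
      rw [← Finset.sum_filter, Finset.sum_const, nsmul_eq_mul]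
      calc _ ≤ D * (2 * η * ‖x u‖ ^ 2) := mul_le_mul_of_nonneg_right (hdeg u) (by positivity)
        _ = _ := by ring
    have hb2 : (∑ u, ∑ v, if G.Adj u v then 2 * η * ‖x v‖ ^ 2 else 0) =
        ∑ u, ∑ v, if G.Adj u v then 2 * η * ‖x u‖ ^ 2 else 0 := by
      rw [Finset.sum_comm]
      refine Finset.sum_congr rfl fun u _ => Finset.sum_congr rfl fun v _ => ?_
      rw [G.adj_comm v u]
    have hb3 : (∑ u, ∑ v, if G.Adj u v then ∑ j, ‖x v * y j u - x u * y j v‖ ^ 2 else 0) ≤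
        (∑ u, ∑ v, if G.Adj u v then 2 * η * ‖x u‖ ^ 2 else 0) +
          ∑ u, ∑ v, if G.Adj u v then 2 * η * ‖x v‖ ^ 2 else 0 := by
      rw [← Finset.sum_add_distrib]
      refine Finset.sum_le_sum fun u _ => ?_
      rw [← Finset.sum_add_distrib]
      refine Finset.sum_le_sum fun v _ => ?_
      split_ifs with h
      · exact hpair_le u v h
      · simp
    rw [hswap]
    rw [hb2] at hb3
    linarith
  refine le_trans (le_of_eq ?_) ((Finset.sum_le_sum fun j _ => hone j).trans htotal)
  rw [← Finset.mul_sum, Finset.sum_sub_distrib, ← Finset.sum_div, trace_eq_sum_norm_sq hy,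
    inner_toEuclideanLin_eq hy, Complex.ofReal_re, Complex.ofReal_re]

end Propagation

/-! ### The top eigenvector -/

section TopEigenvector

variable {V : Type} [Fintype V] {Y : Matrix V V ℂ}

open Classical in
theorem exists_topEigenvalue [Nonempty V] (hY : Y.PosSemidef) :
    ∃ μ : ℝ, Module.End.HasEigenvalue (Matrix.toEuclideanLin Y) (μ : ℂ) ∧
      ∀ a : EuclideanSpace ℂ V, (inner ℂ a (Matrix.toEuclideanLin Y a)).re ≤ μ * ‖a‖ ^ 2 := by
  have hA := hY.1
  obtain ⟨i, -, hi⟩ := Finset.exists_max_image Finset.univ hA.eigenvalues Finset.univ_nonempty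
  refine ⟨hA.eigenvalues i, ?_, fun a => ?_⟩
  · refine Module.End.hasEigenvalue_of_hasEigenvector (x := hA.eigenvectorBasis i)
      ⟨Module.End.mem_eigenspace_iff.mpr ?_, hA.eigenvectorBasis.orthonormal.ne_zero i⟩
    rw [Matrix.toLpLin_apply, hA.mulVec_eigenvectorBasis i]
    ext u
    simp
  · have h := re_inner_toEuclideanLin_eq_sum hA a
    rw [RCLike.re_eq_complex_re] at h
    rw [h, ← hA.eigenvectorBasis.sum_sq_norm_inner_right a, Finset.mul_sum]
    refine Finset.sum_le_sum fun j hj => ?_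
    gcongr
    exact hi j hj

open Classical in
theorem inner_eigenvector {μ : ℝ} {v : EuclideanSpace ℂ V}
    (hv : Matrix.toEuclideanLin Y v = (μ : ℂ) • v) :
    (inner ℂ v (Matrix.toEuclideanLin Y v)).re = μ * ‖v‖ ^ 2 := by
  rw [hv, inner_smul_right, inner_self_eq_norm_sq_to_K, Complex.re_ofReal_mul]
  norm_cast

open Classical in
/-- If the quadratic form of `Y` at `x` is close to its trace, then the top eigenvalue of `Y` is
simple and the top eigenvector is close to the direction of `x`. -/
theorem topEigenvector_close (hY : Y.PosSemidef) (x : EuclideanSpace ℂ V) (hx : x ≠ 0) {κ : ℝ}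
    (hκ : 2 * κ < Y.trace.re)
    (hQ : Y.trace.re - (inner ℂ x (Matrix.toEuclideanLin Y x)).re / ‖x‖ ^ 2 ≤ κ) :
    HasSimpleTopEigenvalue Y ∧ ∀ v, IsTopEigenvector Y v → ∃ θ : ℝ,
      ‖((√Y.trace.re : ℝ) : ℂ) • v - Complex.exp (Complex.I * θ) • x‖ ^ 2 ≤
        (√Y.trace.re - ‖x‖) ^ 2 + 2 * √Y.trace.re * ‖x‖ * (κ / (Y.trace.re - κ)) := by
  have hE : 0 < ‖x‖ := norm_pos_iff.mpr hx
  have hne : Nonempty V := by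
    by_contra h
    rw [not_nonempty_iff] at h
    exact hx (Subsingleton.elim _ _)
  set t := Y.trace.re with ht
  set T := Matrix.toEuclideanLin Y with hT
  have hsymm : T.IsSymmetric := Matrix.isSymmetric_toEuclideanLin_iff.mpr hY.1
  obtain ⟨μ, hμ, hμtop⟩ := exists_topEigenvalue hY
  have hxq : (t - κ) * ‖x‖ ^ 2 ≤ (inner ℂ x (T x)).re := by
    have h : t - κ ≤ (inner ℂ x (T x)).re / ‖x‖ ^ 2 := by linarith
    rwa [le_div_iff₀ (by positivity)] at h
  have hμt : t - κ ≤ μ := by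
    have h := hxq.trans (hμtop x)
    exact le_of_mul_le_mul_right h (by positivity)
  have htop : ∀ ν : ℝ, Module.End.HasEigenvalue T (ν : ℂ) → ν ≤ μ := by
    intro ν hν
    obtain ⟨v, hv⟩ := hν.exists_hasEigenvector
    have h1 := inner_eigenvector hv.apply_eq_smul
    have h2 := hμtop v
    rw [h1] at h2
    have : 0 < ‖v‖ := norm_pos_iff.mpr hv.2
    exact le_of_mul_le_mul_right h2 (by positivity)
  refine ⟨⟨μ, ⟨hμ, htop⟩, ?_⟩, ?_⟩
  · obtain ⟨v, hv⟩ := hμ.exists_hasEigenvector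
    have hvT : T v = (μ : ℂ) • v := hv.apply_eq_smul
    rw [finrank_eq_one_iff']
    refine ⟨⟨v, hv.1⟩, fun h => hv.2 (congrArg Subtype.val h), fun ⟨w, hw⟩ => ?_⟩
    have hwT : T w = (μ : ℂ) • w := Module.End.mem_eigenspace_iff.mp hw
    obtain ⟨-, horth⟩ := norm_sq_sub_proj v w hv.2
    set c := inner ℂ v w / ((‖v‖ ^ 2 : ℝ) : ℂ)
    refine ⟨c, Subtype.ext ?_⟩
    change c • v = w
    by_contra hcon
    have hw' : w - c • v ≠ 0 := fun h => hcon (sub_eq_zero.mp h).symm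
    have hw'T : T (w - c • v) = (μ : ℂ) • (w - c • v) := by
      rw [map_sub, map_smul, hvT, hwT, smul_sub, smul_comm c]
    have key : ∀ a : EuclideanSpace ℂ V, a ≠ 0 → T a = (μ : ℂ) • a →
        ‖((‖a‖⁻¹ : ℝ) : ℂ) • a‖ = 1 ∧
          (inner ℂ (((‖a‖⁻¹ : ℝ) : ℂ) • a) (T (((‖a‖⁻¹ : ℝ) : ℂ) • a))).re = μ := by
      intro a ha haT
      have hn : ‖((‖a‖⁻¹ : ℝ) : ℂ) • a‖ = 1 := by
        have : ‖a‖ ≠ 0 := norm_ne_zero_iff.mpr ha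
        rw [norm_smul, Complex.norm_real, Real.norm_of_nonneg (by positivity)]
        field_simp
      refine ⟨hn, ?_⟩
      have h := inner_eigenvector (Y := Y) (μ := μ) (v := ((‖a‖⁻¹ : ℝ) : ℂ) • a) (by
        rw [map_smul, haT, smul_comm])
      rw [h, hn]
      ring
    -- Two orthonormal eigenvectors for `μ` would give `2μ ≤ t`, whereas `μ ≥ t - κ > t/2`.
    obtain ⟨n1, q1⟩ := key v hv.2 hvT
    obtain ⟨n2, q2⟩ := key _ hw' hw'T
    have h := quadForm_add_le_trace hY n1 n2 (by
      rw [inner_smul_left, inner_smul_right, horth]; simp)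
    rw [q1, q2] at h
    linarith
  · rintro v ⟨hv1, ν, ⟨-, hνtop⟩, hν⟩
    have hμν : μ ≤ ν := hνtop μ hμ
    have hvT : T v = (ν : ℂ) • v := hν.apply_eq_smul
    have hv0 : v ≠ 0 := hν.2
    have hνt : ν ≤ t := by
      have h := quadForm_le_trace hY hv1
      rw [inner_eigenvector hvT, hv1] at h
      linarith
    have hκ0 : 0 ≤ κ := by linarith
    obtain ⟨hproj, horth⟩ := norm_sq_sub_proj v x hv0
    rw [hv1] at hproj horth
    simp only [one_pow, Complex.ofReal_one, div_one] at hproj horth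
    set c := inner ℂ v x with hc
    set w := x - c • v with hw
    have horth' : inner ℂ w v = 0 := by rw [← inner_conj_symm, horth]; simp
    have hxdec : x = c • v + w := by rw [hw]; abel
    -- the quadratic form on the orthogonal complement of `v`
    have hwq : (inner ℂ w (T w)).re ≤ κ * ‖w‖ ^ 2 := by
      by_cases hw0 : w = 0
      · rw [hw0]; simp
      · have hwn : 0 < ‖w‖ := norm_pos_iff.mpr hw0
        have hn : ‖((‖w‖⁻¹ : ℝ) : ℂ) • w‖ = 1 := by
          rw [norm_smul, Complex.norm_real, Real.norm_of_nonneg (by positivity)]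
          field_simp
        have h := quadForm_add_le_trace hY hv1 hn (by rw [inner_smul_right, horth]; simp)
        rw [inner_eigenvector hvT, hv1, map_smul, inner_smul_left, inner_smul_right,
          Complex.conj_ofReal, Complex.re_ofReal_mul, Complex.re_ofReal_mul] at h
        have h2 : ‖w‖⁻¹ * (‖w‖⁻¹ * (inner ℂ w (T w)).re) ≤ κ := by linarith
        have h3 : (inner ℂ w (T w)).re = ‖w‖⁻¹ * (‖w‖⁻¹ * (inner ℂ w (T w)).re) * ‖w‖ ^ 2 := by
          field_simp
        rw [h3]
        gcongr
    have hxq2 : (inner ℂ x (T x)).re = ν * ‖c‖ ^ 2 + (inner ℂ w (T w)).re := by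
      have e1 : inner ℂ (c • v) (T w) = 0 := by
        rw [← hsymm, map_smul, hvT, inner_smul_left, inner_smul_left, horth]; simp
      have e2 : inner ℂ w (T (c • v)) = 0 := by
        rw [map_smul, hvT, inner_smul_right, inner_smul_right, horth']; simp
      have e3 : (inner ℂ (c • v) (T (c • v))).re = ν * ‖c‖ ^ 2 := by
        have h := inner_eigenvector (Y := Y) (μ := ν) (v := c • v) (by
          rw [map_smul, hvT, smul_comm])
        rw [h, norm_smul, hv1, mul_one]
      conv_lhs => rw [hxdec]
      rw [map_add, inner_add_left, inner_add_right, inner_add_right, e1, e2, add_zero, zero_add,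
        Complex.add_re, e3]
    have hcx : ‖c‖ ≤ ‖x‖ := by
      have := norm_inner_le_norm (𝕜 := ℂ) v x
      rwa [hv1, one_mul] at this
    have htκ : 0 < t - κ := by linarith
    -- Compares `⟨x,Yx⟩ ≥ (t-κ)‖x‖²` with `⟨x,Yx⟩ ≤ t|c|² + κ(‖x‖² - |c|²)`, the latter from
    -- splitting `x` along and across `v`.
    have hmain : (‖x‖ ^ 2 - ‖c‖ ^ 2) * (t - κ) ≤ κ * ‖x‖ ^ 2 := by
      have h1 : ν * ‖c‖ ^ 2 ≤ t * ‖c‖ ^ 2 := by gcongr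
      nlinarith [sq_nonneg ‖c‖]
    have hdef : ‖x‖ - ‖c‖ ≤ ‖x‖ * (κ / (t - κ)) := by
      rw [mul_div_assoc', le_div_iff₀ htκ]
      have h1 : ‖x‖ * ((‖x‖ - ‖c‖) * (t - κ)) ≤ ‖x‖ * (‖x‖ * κ) := by
        have h2 : 0 ≤ ‖c‖ * (‖x‖ - ‖c‖) * (t - κ) :=
          mul_nonneg (mul_nonneg (norm_nonneg _) (by linarith)) htκ.le
        nlinarith
      exact le_of_mul_le_mul_left h1 hE
    have ht0 : 0 ≤ t := by linarith
    -- This phase makes the inner product with `v` equal to `|c|`, and the squared distance becomes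
    -- `(√t - ‖x‖)² + 2√t(‖x‖ - |c|)`.
    refine ⟨-Complex.arg c, ?_⟩
    have hrot : Complex.exp (Complex.I * ((-Complex.arg c : ℝ) : ℂ)) * c = ‖c‖ := by
      conv_lhs => rw [← Complex.norm_mul_exp_arg_mul_I c]
      rw [mul_left_comm, ← Complex.exp_add]
      push_cast
      rw [mul_comm Complex.I, neg_mul, mul_comm]
      simp
    have hnorm1 : ‖Complex.exp (Complex.I * ((-Complex.arg c : ℝ) : ℂ))‖ = 1 := by
      rw [mul_comm, Complex.norm_exp_ofReal_mul_I]
    have hexp : ‖((√t : ℝ) : ℂ) • v - Complex.exp (Complex.I * ((-Complex.arg c : ℝ) : ℂ)) • x‖ ^ 2 =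
        √t ^ 2 - 2 * (√t * ‖c‖) + ‖x‖ ^ 2 := by
      rw [@norm_sub_sq ℂ, norm_smul, norm_smul, hnorm1, hv1, Complex.norm_real,
        Real.norm_of_nonneg (Real.sqrt_nonneg _), inner_smul_left, inner_smul_right, hrot,
        Complex.conj_ofReal, mul_one, one_mul]
      congr 3
      rw [← Complex.ofReal_mul]
      exact Complex.ofReal_re _
    rw [hexp]
    have h5 := mul_le_mul_of_nonneg_left hdef (Real.sqrt_nonneg t)
    nlinarith

end TopEigenvector

end

noncomputable section

/-! ### Finite lattice sums -/

/-- The integer coordinates of the points of `gaborRect T S`. -/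
def gaborRectIndex (T S : ℝ) : Finset (ℤ × ℤ) :=
  ((latticeRect_finite meshA_pos T S).preimage latPt_injective.injOn).toFinset

theorem mem_gaborRectIndex {T S : ℝ} {a : ℤ × ℤ} :
    a ∈ gaborRectIndex T S ↔ latPt a ∈ gaborRect T S := by
  simp [gaborRectIndex, gaborRect]

theorem latPt_mem_gaborRect {T S : ℝ} {a : ℤ × ℤ} :
    latPt a ∈ gaborRect T S ↔ |latPt a 0| ≤ T ∧ |latPt a 1| ≤ S :=
  ⟨fun h => ⟨h.1, h.2.1⟩, fun h => ⟨h.1, h.2, a.1, a.2, rfl, rfl⟩⟩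

theorem exists_latPt_of_mem_gaborRect {T S : ℝ} {p : Plane} (hp : p ∈ gaborRect T S) :
    ∃ a, latPt a = p := by
  obtain ⟨-, -, m, n, hm, hn⟩ := hp
  refine ⟨(m, n), ?_⟩
  ext i
  fin_cases i
  · exact hm.symm
  · exact hn.symm

theorem sum_gaborRect {M : Type} [AddCommMonoid M] (T S : ℝ) (F : Plane → M) :
    ∑ l : gaborRect T S, F l = ∑ a ∈ gaborRectIndex T S, F (latPt a) := by
  symm
  refine Finset.sum_bij (fun a ha => ⟨latPt a, mem_gaborRectIndex.mp ha⟩) (fun _ _ => Finset.mem_univ _)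
    (fun a _ b _ h => latPt_injective (congrArg Subtype.val h)) (fun l _ => ?_) (fun _ _ => rfl)
  obtain ⟨a, ha⟩ := exists_latPt_of_mem_gaborRect l.2
  exact ⟨a, mem_gaborRectIndex.mpr (ha ▸ l.2), Subtype.ext ha⟩

theorem sum_norm_gaborKernel_le (T S : ℝ) (z : Plane) :
    ∑ l : gaborRect T S, ‖gaborKernel z l‖ ≤ 25 := by
  rw [sum_gaborRect T S fun l => ‖gaborKernel z l‖]
  simp only [norm_gaborKernel]
  exact ((summable_lattice_gaussian_half z).sum_le_tsum _ fun _ _ => (Real.exp_pos _).le).trans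
    (tsum_lattice_gaussian_half_le z)

/-- Omitted lattice points are at distance at least `R` from `z`. Half of the Gaussian exponent pays
for the factor `e^{-πR²/4}`, the other half for summability. -/
theorem norm_synthesis_sub_sum_le {X : Plane → ℂ} (hX : ∀ p, ‖X p‖ ≤ 1) {T S R : ℝ} (hR : 0 ≤ R)
    {z : Plane} (hz0 : |z 0| ≤ T) (hz1 : |z 1| ≤ S) :
    ‖synthesis X z - ∑ l : gaborRect (T + R) (S + R), X l * gaborKernel z l‖ ≤
      Real.exp (-(Real.pi / 4 * R ^ 2)) * 64 := by
  rw [sum_gaborRect (T + R) (S + R) fun l => X l * gaborKernel z l]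
  set s := gaborRectIndex (T + R) (S + R) with hs
  set g : ℤ × ℤ → ℂ := fun a => X (latPt a) * gaborKernel z (latPt a) with hg
  have hsum : Summable g := summable_synthesis hX z
  have hfin : HasSum (fun a => if a ∈ s then g a else 0) (∑ a ∈ s, g a) := by
    have h : HasSum (fun a => if a ∈ s then g a else 0) (∑ a ∈ s, if a ∈ s then g a else 0) :=
      hasSum_sum_of_ne_finset_zero fun a ha => if_neg ha
    rwa [Finset.sum_congr rfl fun a ha => if_pos ha] at h
  have hdiff := hsum.hasSum.sub hfin
  have hbound := (summable_lattice_gaussian_quarter z).mul_left (Real.exp (-(Real.pi / 4 * R ^ 2)))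
  have e : synthesis X z = ∑' a, g a := rfl
  rw [e, ← hdiff.tsum_eq]
  refine (tsum_of_norm_bounded hbound.hasSum fun a => ?_).trans ?_
  · split_ifs with ha
    · rw [sub_self, norm_zero]; positivity
    · rw [sub_zero, hg, norm_mul, norm_gaborKernel]
      have hfar : R ^ 2 ≤ sqDist z (latPt a) := by
        rw [hs, mem_gaborRectIndex, latPt_mem_gaborRect, not_and_or] at ha
        unfold sqDist
        rcases ha with ha | ha
        · have h1 : R ≤ |z 0 - latPt a 0| := by
            have := abs_sub_abs_le_abs_sub (latPt a 0) (z 0)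
            rw [abs_sub_comm] at this
            linarith [not_le.mp ha]
          have h2 := pow_le_pow_left₀ hR h1 2
          rw [sq_abs] at h2
          nlinarith [sq_nonneg (z 1 - latPt a 1)]
        · have h1 : R ≤ |z 1 - latPt a 1| := by
            have := abs_sub_abs_le_abs_sub (latPt a 1) (z 1)
            rw [abs_sub_comm] at this
            linarith [not_le.mp ha]
          have h2 := pow_le_pow_left₀ hR h1 2
          rw [sq_abs] at h2
          nlinarith [sq_nonneg (z 0 - latPt a 0)]
      refine (mul_le_of_le_one_left (Real.exp_pos _).le (hX _)).trans ?_
      rw [← Real.exp_add, Real.exp_le_exp]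
      nlinarith [Real.pi_pos]
  · rw [tsum_mul_left]
    exact mul_le_mul_of_nonneg_left (tsum_lattice_gaussian_quarter_le z) (Real.exp_pos _).le

/-! ### The ansatz functions -/

theorem norm_sq_plane (u : Plane) : ‖u‖ ^ 2 = u 0 ^ 2 + u 1 ^ 2 := by
  rw [EuclideanSpace.norm_sq_eq, Fin.sum_univ_two]
  simp

theorem star_gaborKernel (z l : Plane) : star (gaborKernel z l) =
    Complex.exp (-((Real.pi : ℂ) / 2) * (((z 0 : ℂ) - l 0) ^ 2 + ((z 1 : ℂ) - l 1) ^ 2) -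
      Real.pi * Complex.I * ((l 1 : ℂ) - z 1) * ((l 0 : ℂ) + z 0)) := by
  rw [gaborKernel, Complex.star_def, ← Complex.exp_conj]
  congr 1
  simp only [map_add, map_mul, map_neg, map_div₀, map_sub, map_pow, Complex.conj_ofReal,
    Complex.conj_I, map_ofNat]
  ring

/-- This explains the shape of `Φ`, `L` and `Q`: at `u = 0` the kernel is `K(p,l) · conj K(p,m)`,
and `ℰ` polarizes its holomorphic extension. -/
theorem ansatzKernel_evalL (l m p u : Plane) :
    ansatzKernel l m (evalL p u) * Complex.exp (evalQ p u) =
      gaborKernel (p + u) l * star (gaborKernel p m) := by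
  rw [star_gaborKernel]
  simp only [ansatzKernel, ansatzConst, gaborKernel, ← Complex.exp_add]
  congr 1
  simp only [evalQ, norm_sq_plane, evalL, PiLp.add_apply, PiLp.sub_apply,
    Matrix.cons_val_zero, Matrix.cons_val_one]
  push_cast
  linear_combination ((Real.pi : ℂ) * (-(1 / 4) * (u 1 : ℂ) ^ 2 - (1 / 4) * (u 0 : ℂ) ^ 2
    - (1 / 2) * l 0 * u 0 - (1 / 2) * l 1 * u 1 + (1 / 2) * m 0 * u 0 + (1 / 2) * m 1 * u 1)) * Complex.I_sq

theorem evaluation_ansatzFun {Γ : Set Plane} [Fintype Γ] (A : Matrix Γ Γ ℂ) (p u : Plane) :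
    evaluation (ansatzFun A) p u =
      ∑ l : Γ, ∑ m : Γ, A l m * (gaborKernel (p + u) l * star (gaborKernel p m)) := by
  unfold evaluation ansatzFun
  simp only [Finset.sum_mul, mul_assoc, ansatzKernel_evalL]

theorem evaluation_zero (F : (Fin 2 → ℂ) → ℂ) (p : Plane) : evaluation F p 0 = F (toC2 p) := by
  have h : evalL p 0 = toC2 p := by
    ext i
    fin_cases i <;> simp [evalL, toC2]
  simp [evaluation, h, evalQ]

theorem norm_exp_evalQ (p u : Plane) :
    ‖Complex.exp (evalQ p u)‖ = Real.exp (-(Real.pi / 2 * (u 0 ^ 2 + u 1 ^ 2))) := by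
  rw [Complex.norm_exp]
  congr 1
  have e : evalQ p u = ((-(Real.pi / 2 * (u 0 ^ 2 + u 1 ^ 2)) : ℝ) : ℂ) +
      ((-(Real.pi * (2 * p 0 + u 0) * u 1) : ℝ) : ℂ) * Complex.I := by
    rw [evalQ, norm_sq_plane]; push_cast; ring
  rw [e, Complex.add_re, Complex.ofReal_re, Complex.re_ofReal_mul, Complex.I_re, mul_zero, add_zero]

theorem norm_evaluation_ansatzFun_le {T S C : ℝ} {A : Matrix (gaborRect T S) (gaborRect T S) ℂ}
    (hA : ∀ l m, ‖A l m‖ ≤ C) (hC : 0 ≤ C) (p u : Plane) :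
    ‖evaluation (ansatzFun A) p u‖ ≤ C * 625 := by
  rw [evaluation_ansatzFun]
  calc ‖∑ l, ∑ m, A l m * (gaborKernel (p + u) l * star (gaborKernel p m))‖
      ≤ ∑ l : gaborRect T S, ∑ m : gaborRect T S,
          C * (‖gaborKernel (p + u) l‖ * ‖gaborKernel p m‖) := by
        refine (norm_sum_le _ _).trans (Finset.sum_le_sum fun l _ => ?_)
        refine (norm_sum_le _ _).trans (Finset.sum_le_sum fun m _ => ?_)
        rw [norm_mul, norm_mul, norm_star]
        exact mul_le_mul_of_nonneg_right (hA l m) (by positivity)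
    _ = C * ((∑ l : gaborRect T S, ‖gaborKernel (p + u) l‖) *
          ∑ m : gaborRect T S, ‖gaborKernel p m‖) := by
        rw [Finset.sum_mul_sum, Finset.mul_sum]
        exact Finset.sum_congr rfl fun l _ => (Finset.mul_sum _ _ _).symm
    _ ≤ C * (25 * 25) := by
        gcongr
        · exact sum_norm_gaborKernel_le T S (p + u)
        · exact sum_norm_gaborKernel_le T S p
    _ = C * 625 := by norm_num

/-- Every `z ∈ ℂ²` is `L(p,u)` for suitable real `p, u` with `|u|² = 4|Im z|²`. Undoing `|e^Q| =
e^{-π|u|²/2}` therefore costs `e^{2π|Im z|²}`. -/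
theorem norm_ansatzFun_le {T S C : ℝ} {A : Matrix (gaborRect T S) (gaborRect T S) ℂ}
    (hA : ∀ l m, ‖A l m‖ ≤ C) (hC : 0 ≤ C) (z : Fin 2 → ℂ) :
    ‖ansatzFun A z‖ ≤ C * 625 * Real.exp (2 * Real.pi * ((z 0).im ^ 2 + (z 1).im ^ 2)) := by
  set u : Plane := !₂[2 * (z 1).im, -(2 * (z 0).im)] with hu
  set p : Plane := !₂[(z 0).re - (z 1).im, (z 1).re + (z 0).im] with hp
  have hL : evalL p u = z := by
    ext i
    fin_cases i <;> apply Complex.ext <;> simp [evalL, hu, hp]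
  have h := norm_evaluation_ansatzFun_le hA hC p u
  rw [evaluation, hL, norm_mul, norm_exp_evalQ] at h
  have e : -(Real.pi / 2 * (u 0 ^ 2 + u 1 ^ 2)) =
      -(2 * Real.pi * ((z 0).im ^ 2 + (z 1).im ^ 2)) := by
    simp [hu]; ring
  rw [e, Real.exp_neg, ← div_eq_mul_inv, div_le_iff₀ (Real.exp_pos _)] at h
  exact h

/-! ### Localization -/

/-- `F_A` multiplied by a Gaussian centred at `p`. -/
def dampedFun {Γ : Set Plane} [Fintype Γ] (A : Matrix Γ Γ ℂ) (p : Plane) (z : Fin 2 → ℂ) : ℂ :=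
  ansatzFun A z * Complex.exp (-((Real.pi : ℂ) / 8) * ((z 0 - p 0) ^ 2 + (z 1 - p 1) ^ 2))

theorem norm_damping (p : Plane) (z : Fin 2 → ℂ) :
    ‖Complex.exp (-((Real.pi : ℂ) / 8) * ((z 0 - p 0) ^ 2 + (z 1 - p 1) ^ 2))‖ =
      Real.exp (Real.pi / 8 * ((z 0).im ^ 2 + (z 1).im ^ 2) -
        Real.pi / 8 * (((z 0).re - p 0) ^ 2 + ((z 1).re - p 1) ^ 2)) := by
  have e : -((Real.pi : ℂ) / 8) * ((z 0 - p 0) ^ 2 + (z 1 - p 1) ^ 2) =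
      ((-(Real.pi / 8) : ℝ) : ℂ) * ((z 0 - p 0) ^ 2 + (z 1 - p 1) ^ 2) := by push_cast; ring
  rw [Complex.norm_exp, e, Complex.re_ofReal_mul]
  congr 1
  simp only [sq, Complex.add_re, Complex.mul_re, Complex.sub_re, Complex.sub_im, Complex.ofReal_re,
    Complex.ofReal_im]
  ring

/-- The recurring 17 arises here: the damping adds `π/8` to the growth rate `2π`, giving `17π/8`. -/
theorem norm_dampedFun_le {T S C : ℝ} {A : Matrix (gaborRect T S) (gaborRect T S) ℂ}
    (hA : ∀ l m, ‖A l m‖ ≤ C) (hC : 0 ≤ C) (p : Plane) (z : Fin 2 → ℂ) :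
    ‖dampedFun A p z‖ ≤ C * 625 * Real.exp (17 * Real.pi / 8 * ((z 0).im ^ 2 + (z 1).im ^ 2) -
      Real.pi / 8 * (((z 0).re - p 0) ^ 2 + ((z 1).re - p 1) ^ 2)) := by
  rw [dampedFun, norm_mul, norm_damping]
  refine (mul_le_mul_of_nonneg_right (norm_ansatzFun_le hA hC z) (Real.exp_pos _).le).trans
    (le_of_eq ?_)
  rw [mul_assoc, ← Real.exp_add]
  congr 2
  ring

theorem norm_dampedFun_le' {T S C : ℝ} {A : Matrix (gaborRect T S) (gaborRect T S) ℂ}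
    (hA : ∀ l m, ‖A l m‖ ≤ C) (hC : 0 ≤ C) (p : Plane) (z : Fin 2 → ℂ) {B : ℝ}
    (hB : (z 0).im ^ 2 + (z 1).im ^ 2 = B) :
    ‖dampedFun A p z‖ ≤ C * 625 * Real.exp (17 * Real.pi / 8 * B) := by
  refine (norm_dampedFun_le hA hC p z).trans ?_
  rw [hB]
  gcongr
  have : 0 ≤ Real.pi / 8 * (((z 0).re - p 0) ^ 2 + ((z 1).re - p 1) ^ 2) :=
    mul_nonneg (div_nonneg Real.pi_pos.le (by norm_num)) (by positivity)
  linarith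

theorem differentiable_dampedFun_line {Γ : Set Plane} [Fintype Γ] (A : Matrix Γ Γ ℂ) (p : Plane)
    (a₀ a₁ b₀ b₁ : ℂ) :
    Differentiable ℂ fun ζ : ℂ => dampedFun A p ![a₀ + ζ * b₀, a₁ + ζ * b₁] := by
  simp only [dampedFun, ansatzFun, ansatzKernel, Matrix.cons_val_zero, Matrix.cons_val_one]
  fun_prop

/-- Smallness of `F_A` on the sampling set `Ω` propagates to a complex neighbourhood. -/
theorem norm_evaluation_le_of_samples {T S R s ε : ℝ} (hs : 0 < s) (hε : 0 < ε) (hR : 0 ≤ R)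
    (hlog : 2 ≤ Real.log (2 / (3 * ε)))
    (hsl : s ≤ 0.3 / Real.sqrt (Real.log (2 / (3 * ε))))
    (hRε : Real.exp (-(Real.pi / 8 * R ^ 2)) ≤ 3 / 2 * ε)
    {T' S' : ℝ} {B : Matrix (gaborRect T' S') (gaborRect T' S') ℂ} (hB : ∀ l m, ‖B l m‖ ≤ 2)
    (hsamp : ∀ w ∈ setOmega T S R s, ‖ansatzFun B (toC2 w)‖ ≤ 2 * ε)
    {l u : Plane} (h0 : |l 0 + u 0 / 2| ≤ T) (h1 : |l 1 + u 1 / 2| ≤ S) :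
    ‖evaluation (ansatzFun B) l u‖ ≤
      15400 * √ε * Real.exp (17 * Real.pi / 32 * (u 0 ^ 2 + u 1 ^ 2)) := by
  set p : Plane := !₂[l 0 + u 0 / 2, l 1 + u 1 / 2] with hp
  have hp0 : p 0 = l 0 + u 0 / 2 := rfl
  have hp1 : p 1 = l 1 + u 1 / 2 := rfl
  have hC : (0 : ℝ) ≤ 2 := by norm_num
  set K : ℝ := 2 * 625 with hK
  set δ : ℝ := 3 / 2 * K * ε with hδ
  have hδ0 : 0 < δ := by positivity
  -- lattice points
  have hlat : ∀ i j : ℤ, ‖dampedFun B p ![((s * i : ℝ) : ℂ), ((s * j : ℝ) : ℂ)]‖ ≤ δ := by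
    intro i j
    by_cases hin : |s * (i : ℝ)| ≤ T + R ∧ |s * (j : ℝ)| ≤ S + R
    · have hmem : (!₂[s * (i : ℝ), s * (j : ℝ)] : Plane) ∈ setOmega T S R s :=
        ⟨hin.1, hin.2, i, j, rfl, rfl⟩
      have h := hsamp _ hmem
      have e : toC2 (!₂[s * (i : ℝ), s * (j : ℝ)] : Plane) =
          ![((s * i : ℝ) : ℂ), ((s * j : ℝ) : ℂ)] := by
        ext k
        fin_cases k <;> simp [toC2]
      rw [e] at h
      rw [dampedFun, norm_mul, norm_damping]
      have h2 : Real.exp (Real.pi / 8 * ((![((s * i : ℝ) : ℂ), ((s * j : ℝ) : ℂ)] 0).im ^ 2 +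
          (![((s * i : ℝ) : ℂ), ((s * j : ℝ) : ℂ)] 1).im ^ 2) -
          Real.pi / 8 * (((![((s * i : ℝ) : ℂ), ((s * j : ℝ) : ℂ)] 0).re - p 0) ^ 2 +
            ((![((s * i : ℝ) : ℂ), ((s * j : ℝ) : ℂ)] 1).re - p 1) ^ 2)) ≤ 1 := by
        rw [Real.exp_le_one_iff]
        simp only [Matrix.cons_val_zero, Matrix.cons_val_one, Complex.ofReal_im, Complex.ofReal_re]
        have : 0 ≤ Real.pi / 8 * ((s * i - p 0) ^ 2 + (s * j - p 1) ^ 2) :=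
          mul_nonneg (div_nonneg Real.pi_pos.le (by norm_num)) (by positivity)
        linarith
      refine (mul_le_of_le_one_right (norm_nonneg _) h2).trans (h.trans ?_)
      rw [hδ, hK]
      linarith
    · refine (norm_dampedFun_le hB hC p _).trans ?_
      simp only [Matrix.cons_val_zero, Matrix.cons_val_one, Complex.ofReal_im, Complex.ofReal_re]
      -- Beyond `Ω` no sample is available, but there the damping alone makes the function small,
      -- because `p` lies in the inner box.
      have hfar : R ^ 2 ≤ (s * i - p 0) ^ 2 + (s * j - p 1) ^ 2 := by
        rw [not_and_or] at hin
        rcases hin with hin | hin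
        · have h1 : R ≤ |s * i - p 0| := by
            have := abs_sub_abs_le_abs_sub (s * (i : ℝ)) (p 0)
            rw [hp0] at this ⊢
            linarith [not_le.mp hin]
          have h2 := pow_le_pow_left₀ hR h1 2
          rw [sq_abs] at h2
          nlinarith [sq_nonneg (s * j - p 1)]
        · have h1 : R ≤ |s * j - p 1| := by
            have := abs_sub_abs_le_abs_sub (s * (j : ℝ)) (p 1)
            rw [hp1] at this ⊢
            linarith [not_le.mp hin]
          have h2 := pow_le_pow_left₀ hR h1 2
          rw [sq_abs] at h2
          nlinarith [sq_nonneg (s * i - p 0)]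
      have hexp : Real.exp (17 * Real.pi / 8 * (0 ^ 2 + 0 ^ 2) -
          Real.pi / 8 * ((s * i - p 0) ^ 2 + (s * j - p 1) ^ 2)) ≤ 3 / 2 * ε := by
        refine le_trans (Real.exp_le_exp.mpr ?_) hRε
        nlinarith [Real.pi_pos]
      calc _ ≤ 2 * 625 * (3 / 2 * ε) := mul_le_mul_of_nonneg_left hexp (by norm_num)
        _ = δ := by rw [hδ, hK]; ring
  -- horizontal lines
  have hline : ∀ (x : ℝ) (j : ℤ), ‖dampedFun B p ![(x : ℂ), ((s * j : ℝ) : ℂ)]‖ ≤ 10 * δ := by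
    intro x j
    have hd := differentiable_dampedFun_line B p 0 ((s * j : ℝ) : ℂ) 1 0
    simp only [zero_add, mul_one, mul_zero, add_zero] at hd
    refine norm_le_of_samples hd (K := K) (by positivity) hε hlog hs hsl (fun x y => ?_)
      (fun k => hlat k j) (by linarith) x
    refine norm_dampedFun_le' hB hC p _ ?_
    simp
  -- the real plane
  have hplane : ∀ x y : ℝ, ‖dampedFun B p ![(x : ℂ), (y : ℂ)]‖ ≤ 100 * δ := by
    intro x y
    have hd := differentiable_dampedFun_line B p (x : ℂ) 0 0 1
    simp only [zero_add, mul_one, mul_zero, add_zero] at hd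
    refine (norm_le_of_samples hd (K := K) (by positivity) hε hlog hs hsl (fun x y => ?_)
      (fun k => hline x k) (by linarith) y).trans (by linarith)
    refine norm_dampedFun_le' hB hC p _ ?_
    simp
  -- the complex direction
  obtain ⟨v₀, hv₀⟩ : ∃ v : ℝ, v = -(u 1) / 2 := ⟨_, rfl⟩
  obtain ⟨v₁, hv₁⟩ : ∃ v : ℝ, v = u 0 / 2 := ⟨_, rfl⟩
  have hd := differentiable_dampedFun_line B p (p 0 : ℂ) (p 1 : ℂ) (v₀ : ℂ) (v₁ : ℂ)
  -- `L(l,u) = p + iv` with `v = (-u₁, u₀)/2`. Interpolating halfway between heights 0 and 2 along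
  -- this line takes the geometric mean of a bound of order `ε` and the a priori bound, hence the
  -- square root.
  have h3 := norm_le_interp_of_gaussian_growth hd (K := K)
    (κ := 17 * Real.pi / 8 * (v₀ ^ 2 + v₁ ^ 2)) (M := 100 * δ) (by positivity) (by positivity)
    (fun x y => by
      rw [mul_assoc (17 * Real.pi / 8)]
      refine norm_dampedFun_le' hB hC p _ ?_
      simp
      ring)
    (fun x => by
      have := hplane (p 0 + x * v₀) (p 1 + x * v₁)
      simpa using this)
    0 2 (θ := 1 / 2) (by norm_num) (by norm_num)
  have hz : ![(p 0 : ℂ) + (((0 : ℝ) : ℂ) + ((1 / 2 * 2 : ℝ) : ℂ) * Complex.I) * v₀,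
      (p 1 : ℂ) + (((0 : ℝ) : ℂ) + ((1 / 2 * 2 : ℝ) : ℂ) * Complex.I) * v₁] = evalL l u := by
    ext i
    fin_cases i
    · simp [evalL, hp0, hv₀]; ring
    · simp [evalL, hp1, hv₁]; ring
  rw [hz, dampedFun, norm_mul, norm_damping] at h3
  have hre : Real.pi / 8 * ((evalL l u 0).im ^ 2 + (evalL l u 1).im ^ 2) -
      Real.pi / 8 * (((evalL l u 0).re - p 0) ^ 2 + ((evalL l u 1).re - p 1) ^ 2) =
      Real.pi / 32 * (u 0 ^ 2 + u 1 ^ 2) := by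
    simp [evalL, hp0, hp1]; ring
  rw [hre] at h3
  -- `100 · (3/2) · 1250² = 234375000 ≤ 15400²`. The exponent `17π/16` drops to `17π/32` once `π/32`
  -- from the damping and `π/2` from `e^Q` are removed.
  have hrhs : (100 * δ) ^ (1 - 1 / 2 : ℝ) *
      (K * Real.exp (17 * Real.pi / 8 * (v₀ ^ 2 + v₁ ^ 2) * 2 ^ 2)) ^ (1 / 2 : ℝ) ≤
      15400 * √ε * Real.exp (17 * Real.pi / 16 * (u 0 ^ 2 + u 1 ^ 2)) := by
    have e1 : (1 - 1 / 2 : ℝ) = 1 / 2 := by norm_num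
    rw [e1, ← Real.sqrt_eq_rpow, ← Real.sqrt_eq_rpow, ← Real.sqrt_mul (by positivity)]
    apply Real.sqrt_le_iff.mpr
    refine ⟨by positivity, ?_⟩
    rw [mul_pow, mul_pow, Real.sq_sqrt hε.le, ← Real.exp_nat_mul]
    have e2 : ((2 : ℕ) : ℝ) * (17 * Real.pi / 16 * (u 0 ^ 2 + u 1 ^ 2)) =
        17 * Real.pi / 8 * (v₀ ^ 2 + v₁ ^ 2) * 2 ^ 2 := by
      rw [hv₀, hv₁]; push_cast; ring
    rw [e2, ← mul_assoc]
    refine mul_le_mul_of_nonneg_right ?_ (Real.exp_pos _).le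
    rw [hδ, hK]
    nlinarith
  rw [evaluation, norm_mul, norm_exp_evalQ]
  have h4 := h3.trans hrhs
  have e3 : Real.exp (17 * Real.pi / 16 * (u 0 ^ 2 + u 1 ^ 2)) =
      Real.exp (17 * Real.pi / 32 * (u 0 ^ 2 + u 1 ^ 2)) *
        Real.exp (Real.pi / 2 * (u 0 ^ 2 + u 1 ^ 2)) * Real.exp (Real.pi / 32 * (u 0 ^ 2 + u 1 ^ 2)) := by
    rw [← Real.exp_add, ← Real.exp_add]; congr 1; ring
  rw [e3, ← mul_assoc, ← mul_assoc] at h4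
  have h5 := le_of_mul_le_mul_right h4 (Real.exp_pos _)
  rw [Real.exp_neg, ← div_eq_mul_inv, div_le_iff₀ (Real.exp_pos _)]
  exact h5

end

noncomputable section

/-! ### Existence of solutions of the first program -/

/-- This is why the objective is the largest diagonal entry: for positive semidefinite matrices it
controls every entry, which gives both compactness of sublevel sets and the growth bound for `F_A`.
-/
theorem norm_apply_le_of_diag_le {V : Type} [Fintype V] {A : Matrix V V ℂ} (hA : A.PosSemidef)
    {c : ℝ} (hc : ∀ l, (A l l).re ≤ c) (l m : V) : ‖A l m‖ ≤ c := by
  obtain ⟨y, hy⟩ := posSemidef_exists_vectors hA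
  have hd : ∀ u, (A u u).re = ∑ j, ‖y j u‖ ^ 2 := by
    intro u
    rw [hy, Complex.re_sum]
    refine Finset.sum_congr rfl fun j _ => ?_
    rw [Complex.star_def, Complex.mul_conj, Complex.ofReal_re, Complex.normSq_eq_norm_sq]
  have h1 : ‖A l m‖ ≤ ∑ j, ‖y j l‖ * ‖y j m‖ := by
    rw [hy]
    refine (norm_sum_le _ _).trans (le_of_eq (Finset.sum_congr rfl fun j _ => ?_))
    rw [norm_mul, norm_star]
  have h2 : ∑ j, ‖y j l‖ * ‖y j m‖ ≤ ∑ j, (1 / 2 * ‖y j l‖ ^ 2 + 1 / 2 * ‖y j m‖ ^ 2) :=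
    Finset.sum_le_sum fun j _ => by nlinarith [sq_nonneg (‖y j l‖ - ‖y j m‖)]
  rw [Finset.sum_add_distrib, ← Finset.mul_sum, ← Finset.mul_sum, ← hd, ← hd] at h2
  linarith [hc l, hc m]

theorem re_diag_le_objective1 {Γ : Set Plane} [Fintype Γ] (A : Matrix Γ Γ ℂ) (l : Γ) :
    (A l l).re ≤ objective1 A :=
  le_ciSup (f := fun l : Γ => (A l l).re) (Set.finite_range _).bddAbove l

theorem continuous_objective1 {Γ : Set Plane} [Fintype Γ] [Nonempty Γ] :
    Continuous (objective1 : Matrix Γ Γ ℂ → ℝ) := by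
  have e : (objective1 : Matrix Γ Γ ℂ → ℝ) =
      fun A => Finset.univ.sup' Finset.univ_nonempty fun l : Γ => (A l l).re := by
    ext A
    exact (Finset.sup'_univ_eq_ciSup fun l : Γ => (A l l).re).symm
  rw [e]
  refine Continuous.finset_sup'_apply _ fun l _ => ?_
  exact Complex.continuous_re.comp (continuous_id.matrix_elem l l)

theorem isClosed_posSemidef {V : Type} [Fintype V] :
    IsClosed {A : Matrix V V ℂ | A.PosSemidef} := by
  simp only [Matrix.posSemidef_iff_dotProduct_mulVec, Set.ofPred_and, Set.ofPred_forall]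
  refine IsClosed.inter ?_ (isClosed_iInter fun x => ?_)
  · exact isClosed_eq continuous_id.matrix_conjTranspose continuous_id
  · have hc : Continuous fun A : Matrix V V ℂ => star x ⬝ᵥ A.mulVec x :=
      continuous_const.dotProduct (continuous_id.matrix_mulVec continuous_const)
    exact isClosed_le continuous_const hc

theorem isClosed_feasible1 (Γ Ω : Set Plane) [Fintype Γ] (σ : Ω → ℝ) (ε : ℝ) :
    IsClosed (feasible1 Γ Ω σ ε) := by
  have e : feasible1 Γ Ω σ ε = {A | A.PosSemidef} ∩
      ⋂ w : Ω, {A | ‖ansatzFun A (toC2 w) - (σ w : ℂ)‖ ≤ ε} := by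
    ext A
    simp [feasible1]
  rw [e]
  refine isClosed_posSemidef.inter (isClosed_iInter fun w => isClosed_le ?_ continuous_const)
  refine (Continuous.sub ?_ continuous_const).norm
  unfold ansatzFun
  exact continuous_finsetSum _ fun l _ => continuous_finsetSum _ fun m _ =>
    (continuous_id.matrix_elem l m).mul continuous_const

theorem exists_isSolution1 {Γ Ω : Set Plane} [Fintype Γ] [Nonempty Γ] {σ : Ω → ℝ} {ε : ℝ}
    (h : (feasible1 Γ Ω σ ε).Nonempty) : ∃ A, IsSolution1 Γ Ω σ ε A := by
  obtain ⟨A₀, hA₀⟩ := h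
  set K : Set (Matrix Γ Γ ℂ) := feasible1 Γ Ω σ ε ∩ {A | objective1 A ≤ objective1 A₀} with hK
  have hball : IsCompact (Set.univ.pi fun _ : Γ => Set.univ.pi fun _ : Γ =>
      Metric.closedBall (0 : ℂ) (objective1 A₀)) :=
    isCompact_univ_pi fun _ => isCompact_univ_pi fun _ => isCompact_closedBall _ _
  have hKc : IsCompact K := by
    refine IsCompact.of_isClosed_subset hball
      ((isClosed_feasible1 Γ Ω σ ε).inter (isClosed_le continuous_objective1 continuous_const)) ?_
    rintro A ⟨hA, hle⟩ l - m -
    rw [mem_closedBall_zero_iff]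
    exact norm_apply_le_of_diag_le hA.1 (fun l => (re_diag_le_objective1 A l).trans hle) l m
  obtain ⟨A, hAK, hmin⟩ := hKc.exists_isMinOn ⟨A₀, hA₀, Set.mem_ofPred_eq ▸ le_refl (objective1 A₀)⟩ continuous_objective1.continuousOn
  refine ⟨A, hAK.1, fun B hB => ?_⟩
  by_cases hBA : objective1 B ≤ objective1 A₀
  · exact hmin ⟨hB, hBA⟩
  · exact hAK.2.trans (not_le.mp hBA).le

/-! ### Rank one coefficient matrices -/

theorem evaluation_ansatzFun_vecMulVec {Γ : Set Plane} [Fintype Γ] (c : Γ → ℂ) (p u : Plane) :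
    evaluation (ansatzFun (Matrix.vecMulVec c (star c))) p u =
      (∑ l : Γ, c l * gaborKernel (p + u) l) * star (∑ l : Γ, c l * gaborKernel p l) := by
  rw [evaluation_ansatzFun, star_sum, Finset.sum_mul_sum]
  refine Finset.sum_congr rfl fun l _ => Finset.sum_congr rfl fun m _ => ?_
  rw [Matrix.vecMulVec_apply, Pi.star_apply, star_mul']
  ring

theorem ansatzFun_sub {Γ : Set Plane} [Fintype Γ] (A B : Matrix Γ Γ ℂ) (z : Fin 2 → ℂ) :
    ansatzFun (A - B) z = ansatzFun A z - ansatzFun B z := by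
  simp [ansatzFun, sub_mul, Finset.sum_sub_distrib]

theorem norm_mul_star_sub_le {a b a' b' : ℂ} {δ : ℝ} (ha : ‖a - a'‖ ≤ δ) (hb : ‖b - b'‖ ≤ δ)
    (ha' : ‖a'‖ ≤ 1) (hb' : ‖b'‖ ≤ 1) : ‖a * star b - a' * star b'‖ ≤ δ * (2 + δ) := by
  have e : a * star b - a' * star b' =
      (a - a') * star (b - b') + (a - a') * star b' + a' * star (b - b') := by
    rw [star_sub]; ring
  have hδ : 0 ≤ δ := (norm_nonneg _).trans ha
  rw [e]
  refine (norm_add₃_le).trans ?_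
  simp only [norm_mul, norm_star]
  nlinarith [mul_le_mul ha hb (norm_nonneg _) hδ, mul_le_mul ha hb' (norm_nonneg _) hδ,
    mul_le_mul ha' hb (norm_nonneg _) zero_le_one]

/-! ### Degrees in the proximity graph -/

theorem norm_latPt_sub_sq (a b : ℤ × ℤ) :
    ‖latPt a - latPt b‖ ^ 2 = 1 / 2 * (((a - b).1 : ℝ) ^ 2 + ((a - b).2 : ℝ) ^ 2) := by
  rw [norm_sub_sq_eq_sqDist, sqDist, latPt_zero_coord, latPt_zero_coord, latPt_one_coord,
    latPt_one_coord, Prod.fst_sub, Prod.snd_sub]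
  push_cast
  rw [← meshA_sq]
  ring

-- In units of `𝔞` the neighbours lie in a square of half-width `k = ⌊√2 r⌋`. Removing the vertex
-- itself leaves `4k² + 4k ≤ 8k²`, so the bound stays quadratic even for small `r`.
open Classical in
theorem card_adj_proximityGraph_le {T S r : ℝ} (hr : 0 < r) (u : gaborRect T S) :
    ((Finset.univ.filter fun v => (proximityGraph (gaborRect T S) r).Adj u v).card : ℝ) ≤
      16 * r ^ 2 := by
  choose b hb using fun v : gaborRect T S => exists_latPt_of_mem_gaborRect v.2
  set k : ℕ := ⌊√2 * r⌋₊ with hk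
  have hk2 : (k : ℝ) ≤ √2 * r := Nat.floor_le (by positivity)
  have hk3 : (k : ℝ) ^ 2 ≤ 2 * r ^ 2 := by
    calc (k : ℝ) ^ 2 ≤ (√2 * r) ^ 2 := pow_le_pow_left₀ k.cast_nonneg hk2 2
      _ = 2 * r ^ 2 := by rw [mul_pow, Real.sq_sqrt (by norm_num)]
  have hcoord : ∀ i : ℤ, (i : ℝ) ^ 2 ≤ 2 * r ^ 2 → i ∈ Finset.Icc (-(k : ℤ)) k := by
    intro i hi
    have h1 : |(i : ℝ)| ≤ √2 * r := by
      refine abs_le_of_sq_le_sq ?_ (by positivity)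
      rwa [mul_pow, Real.sq_sqrt (by norm_num)]
    have h2 : i.natAbs ≤ k := by
      refine Nat.le_floor ?_
      rwa [Nat.cast_natAbs, Int.cast_abs]
    rw [Finset.mem_Icc]
    omega
  have hle : (Finset.univ.filter fun v => (proximityGraph (gaborRect T S) r).Adj u v).card ≤
      ((Finset.Icc (-(k : ℤ)) k ×ˢ Finset.Icc (-(k : ℤ)) k).erase (0, 0)).card := by
    refine Finset.card_le_card_of_injOn (fun v => b u - b v) (fun v hv => ?_) (fun v _ w _ h => ?_)
    · have hadj : (proximityGraph (gaborRect T S) r).Adj u v := by simpa using hv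
      obtain ⟨h0, h1⟩ := hadj
      rw [← hb u, ← hb v] at h0 h1
      have h2 := norm_latPt_sub_sq (b u) (b v)
      have h3 : ‖latPt (b u) - latPt (b v)‖ ^ 2 ≤ r ^ 2 := pow_le_pow_left₀ h0.le h1.le 2
      rw [h2] at h3
      have hne : b u - b v ≠ (0, 0) := by
        intro h
        rw [h] at h2
        have := pow_pos h0 2
        rw [h2] at this
        simp at this
      refine Finset.mem_coe.mpr (Finset.mem_erase.mpr ⟨hne, Finset.mem_product.mpr ⟨?_, ?_⟩⟩)
      · exact hcoord _ (by nlinarith [sq_nonneg ((b u - b v).2 : ℝ)])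
      · exact hcoord _ (by nlinarith [sq_nonneg ((b u - b v).1 : ℝ)])
    · have h' : b v = b w := sub_right_injective h
      exact Subtype.ext (by rw [← hb v, ← hb w, h'])
  have hcard : ((Finset.Icc (-(k : ℤ)) k ×ˢ Finset.Icc (-(k : ℤ)) k).erase (0, 0)).card =
      4 * k ^ 2 + 4 * k := by
    rw [Finset.card_erase_of_mem (by simp), Finset.card_product, Int.card_Icc]
    have : ((k : ℤ) + 1 - -(k : ℤ)).toNat = 2 * k + 1 := by omega
    rw [this]
    refine Nat.sub_eq_of_eq_add ?_
    ring
  have h8 : (4 * k ^ 2 + 4 * k : ℕ) ≤ 8 * k ^ 2 := by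
    have := Nat.le_self_pow two_ne_zero k
    omega
  calc ((Finset.univ.filter fun v => (proximityGraph (gaborRect T S) r).Adj u v).card : ℝ)
      ≤ ((8 * k ^ 2 : ℕ) : ℝ) := Nat.cast_le.mpr ((hle.trans_eq hcard).trans h8)
    _ = 8 * (k : ℝ) ^ 2 := by push_cast; ring
    _ ≤ 16 * r ^ 2 := by linarith

/-! ### Consequences of the calibration -/

open Classical in
theorem secondEigenvalue_nonneg {V : Type} [Fintype V] (G : SimpleGraph V) {α : V → ℝ}
    (hα : ∀ v, 0 ≤ α v) : 0 ≤ secondEigenvalue G α := by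
  unfold secondEigenvalue
  split_ifs with h
  · have hA := weightedLaplacian_isHermitian G α
    have hnn : ∀ i, 0 ≤ hA.eigenvalues i := by
      intro i
      have h1 := re_inner_toEuclideanLin_eq_sum hA (hA.eigenvectorBasis i)
      rw [Finset.sum_eq_single i] at h1
      · rw [(hA.eigenvectorBasis).inner_eq_one, norm_one, one_pow, mul_one] at h1
        rw [← h1, RCLike.re_to_real, inner_weightedLaplacian G α hα]
        refine mul_nonneg (by norm_num) (Finset.sum_nonneg fun u _ => Finset.sum_nonneg fun v _ => ?_)
        split_ifs
        · exact sq_nonneg _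
        · exact le_rfl
      · intro j _ hj
        rw [(hA.eigenvectorBasis).inner_eq_zero hj]
        simp
      · intro hi
        exact absurd (Finset.mem_univ i) hi
    set e : Fin (Fintype.card V) ≃ V := Fintype.equivOfCardEq (Fintype.card_fin _) with he
    have h2 := hnn (e ⟨Fintype.card V - 2, Nat.sub_lt (lt_of_lt_of_le Nat.zero_lt_two h)
      Nat.zero_lt_two⟩)
    rw [Matrix.IsHermitian.eigenvalues, ← he, Equiv.symm_apply_apply] at h2
    exact h2
  · exact le_rfl

end

noncomputable section

/-! ### Smallness of `ε`, `ε'` and of the Gaussian tails. -/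

theorem zero_mem_gaborRect {T S : ℝ} (hT : 0 ≤ T) (hS : 0 ≤ S) : (0 : Plane) ∈ gaborRect T S :=
  ⟨by simpa using hT, by simpa using hS, 0, 0, by simp, by simp⟩

theorem gaborEnergy_le_card {f : ℝ → ℂ} (hG : ∀ p, ‖gabor f p‖ ≤ 1) (Λ : Set Plane) [Fintype Λ] :
    gaborEnergy f Λ ≤ Fintype.card Λ := by
  have h : gaborEnergy f Λ ≤ ∑ _l : Λ, (1 : ℝ) :=
    Finset.sum_le_sum fun l _ => pow_le_one₀ (norm_nonneg _) (hG l)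
  simpa using h

/-- The smallness condition on `ε`, expressed through `ε'`. -/
theorem WellCalibrated.eps'_le {f : ℝ → ℂ} {T S R r s ε ε' : ℝ}
    (h : WellCalibrated f T S R r s ε ε') :
    4.29 * ε' ≤ min (gaborEnergy f (setLambda T S) / (Fintype.card (setLambda T S) : ℝ) ^ 2)
      (spectralGap f (setLambda T S) r / (192 * r ^ 2)) := by
  set M := min (gaborEnergy f (setLambda T S) / (Fintype.card (setLambda T S) : ℝ) ^ 2)
    (spectralGap f (setLambda T S) r / (192 * r ^ 2)) with hM
  have hgap : 0 ≤ spectralGap f (setLambda T S) r :=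
    secondEigenvalue_nonneg _ fun u => sq_nonneg _
  have hE : 0 ≤ gaborEnergy f (setLambda T S) := Finset.sum_nonneg fun _ _ => sq_nonneg _
  have hM0 : 0 ≤ M := le_min (by positivity) (by positivity)
  have h1 := Real.sqrt_le_sqrt h.eps_le
  rw [Real.sqrt_sq (by positivity)] at h1
  set a := Real.exp (17 * Real.pi / 32 * r ^ 2) with ha
  have hinv : Real.exp (-(17 * Real.pi / 32) * r ^ 2) = a⁻¹ := by
    rw [neg_mul, Real.exp_neg]
  have ha0 : 0 < a := Real.exp_pos _
  rw [hinv] at h1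
  have h2 := mul_le_mul_of_nonneg_right h1 ha0.le
  have h3 : a⁻¹ / (1.33 * 10 ^ 5) * M * a = M / (1.33 * 10 ^ 5) := by
    field_simp
  rw [h3, le_div_iff₀ (by norm_num)] at h2
  rw [h.eps'_eq]
  -- The constant is `1.33·10⁵ / 3.1·10⁴`, rounded down to 4.29.
  nlinarith [mul_nonneg (Real.sqrt_nonneg ε) ha0.le]

theorem WellCalibrated.eps_small {f : ℝ → ℂ} (hG : ∀ p, ‖gabor f p‖ ≤ 1) {T S R r s ε ε' : ℝ}
    (h : WellCalibrated f T S R r s ε ε') : ε ≤ 1 / 10 ^ 6 := by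
  have : Nonempty (setLambda T S) := ⟨⟨0, zero_mem_gaborRect h.T_pos.le h.S_pos.le⟩⟩
  have hN : (1 : ℝ) ≤ Fintype.card (setLambda T S) := by exact_mod_cast Fintype.card_pos
  have h1 := h.eps'_le.trans (min_le_left _ _)
  have h2 : gaborEnergy f (setLambda T S) / (Fintype.card (setLambda T S) : ℝ) ^ 2 ≤ 1 := by
    rw [div_le_one (by positivity)]
    nlinarith [gaborEnergy_le_card hG (setLambda T S)]
  have ha : 1 ≤ Real.exp (17 * Real.pi / 32 * r ^ 2) :=
    Real.one_le_exp (mul_nonneg (div_nonneg (mul_nonneg (by norm_num) Real.pi_pos.le) (by norm_num))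
      (sq_nonneg _))
  rw [h.eps'_eq] at h1
  have h3 : √ε ≤ √ε * Real.exp (17 * Real.pi / 32 * r ^ 2) :=
    le_mul_of_one_le_right (Real.sqrt_nonneg _) ha
  have h4 : √ε ≤ 1 / 1000 := by linarith
  have h5 := Real.sq_sqrt h.eps_pos.le
  nlinarith [Real.sqrt_nonneg ε]

theorem WellCalibrated.two_le_log {f : ℝ → ℂ} (hG : ∀ p, ‖gabor f p‖ ≤ 1) {T S R r s ε ε' : ℝ}
    (h : WellCalibrated f T S R r s ε ε') : 2 ≤ Real.log (2 / (3 * ε)) := by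
  have hε := h.eps_pos
  rw [Real.le_log_iff_exp_le (by positivity)]
  have h2 : Real.exp 2 = Real.exp 1 ^ 2 := by rw [← Real.exp_nat_mul]; norm_num
  have h3 : Real.exp 1 ^ 2 ≤ 2.7182818286 ^ 2 :=
    pow_le_pow_left₀ (Real.exp_pos _).le Real.exp_one_lt_d9.le 2
  rw [h2]
  refine h3.trans ?_
  rw [le_div_iff₀ (by positivity)]
  nlinarith [h.eps_small hG]

/-- From `R ≥ 1/(2s)` and the bound on `s`, `R² ≥ ln(2/(3ε))/0.36`, and `π/8 > 0.36`. -/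
theorem WellCalibrated.exp_neg_le {f : ℝ → ℂ} (hG : ∀ p, ‖gabor f p‖ ≤ 1) {T S R r s ε ε' : ℝ}
    (h : WellCalibrated f T S R r s ε ε') : Real.exp (-(Real.pi / 8 * R ^ 2)) ≤ 3 / 2 * ε := by
  have hε := h.eps_pos
  have hlog := h.two_le_log hG
  set L := Real.log (2 / (3 * ε)) with hL
  have hsq : 0 < √L := Real.sqrt_pos.mpr (by linarith)
  have hR1 : (r + s⁻¹) / 2 ≤ R := (le_max_right _ _).trans h.R_ge
  have hs : √L / 0.3 ≤ s⁻¹ := by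
    rw [← inv_div]
    exact inv_anti₀ h.s_pos h.s_le
  have hR2 : √L / 0.6 ≤ R := by
    have e : √L / 0.6 = √L / 0.3 / 2 := by ring
    rw [e]; linarith [h.r_pos]
  have hR3 : (√L / 0.6) ^ 2 ≤ R ^ 2 := pow_le_pow_left₀ (by positivity) hR2 2
  rw [div_pow, Real.sq_sqrt (by linarith)] at hR3
  have hR4 : L ≤ Real.pi / 8 * R ^ 2 := by
    have : L ≤ 3 / 8 * (L / 0.6 ^ 2) := by norm_num; linarith
    nlinarith [Real.pi_gt_three, sq_nonneg R]
  calc Real.exp (-(Real.pi / 8 * R ^ 2)) ≤ Real.exp (-L) := Real.exp_le_exp.mpr (by linarith)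
    _ = 3 / 2 * ε := by
      rw [Real.exp_neg, hL, Real.exp_log (by positivity), inv_div]; ring

/-! ### The first program recovers the sesquilinear samples -/

theorem WellCalibrated.exists_coefficients {f : ℝ → ℂ} (hf : MemLp f 2 volume)
    (hG : ∀ p, ‖gabor f p‖ ≤ 1) {T S R r s ε ε' : ℝ} (h : WellCalibrated f T S R r s ε ε') :
    ∃ c : setGamma T S R → ℂ, (∀ l, ‖c l‖ ≤ 1) ∧ ∀ z : Plane, |z 0| ≤ T + R → |z 1| ≤ S + R →
      ‖∑ l : setGamma T S R, c l * gaborKernel z l - gabor f z‖ ≤ ε / 8 := by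
  have hε := h.eps_pos
  have hεs := h.eps_small hG
  obtain ⟨X, hX, hXG⟩ := exists_bounded_expansion hf hG (δ := ε / 16) (by positivity)
  refine ⟨fun l => X l, fun l => hX l, fun z h0 h1 => ?_⟩
  have ht := norm_synthesis_sub_sum_le hX h.R_pos.le h0 h1
  have eT : T + R + R = T + 2 * R := by ring
  have eS : S + R + R = S + 2 * R := by ring
  rw [eT, eS, norm_sub_rev] at ht
  have h2 := hXG z
  rw [norm_sub_rev] at h2
  have he : Real.exp (-(Real.pi / 4 * R ^ 2)) * 64 ≤ ε / 16 := by
    have e : Real.exp (-(Real.pi / 4 * R ^ 2)) = Real.exp (-(Real.pi / 8 * R ^ 2)) ^ 2 := by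
      rw [← Real.exp_nat_mul]; congr 1; push_cast; ring
    have h3 := pow_le_pow_left₀ (Real.exp_pos _).le (h.exp_neg_le hG) 2
    rw [e]
    nlinarith
  have h4 := norm_sub_le_norm_sub_add_norm_sub
    (∑ l : setGamma T S R, X l * gaborKernel z l) (synthesis X z) (gabor f z)
  linarith

section Recovery

variable {f : ℝ → ℂ} {T S R r s ε ε' : ℝ} {σ : setOmega T S R s → ℝ} {c : setGamma T S R → ℂ}

theorem vecMulVec_mem_feasible1 (hε : 0 < ε) (hε1 : ε ≤ 1) (hG : ∀ p, ‖gabor f p‖ ≤ 1)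
    (hσ : ∀ w : setOmega T S R s, |σ w - spectrogram f w| ≤ ε / 2)
    (hc : ∀ z : Plane, |z 0| ≤ T + R → |z 1| ≤ S + R →
      ‖∑ l : setGamma T S R, c l * gaborKernel z l - gabor f z‖ ≤ ε / 8) :
    Matrix.vecMulVec c (star c) ∈ feasible1 (setGamma T S R) (setOmega T S R s) σ ε := by
  refine ⟨Matrix.posSemidef_vecMulVec_self_star c, fun w => ?_⟩
  have hw := hc w w.2.1 w.2.2.1
  have h1 := norm_mul_star_sub_le hw hw (hG w) (hG w)
  rw [← evaluation_zero (ansatzFun _), evaluation_ansatzFun_vecMulVec, add_zero]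
  have h2 : gabor f w * star (gabor f w) = (spectrogram f w : ℂ) := by
    rw [spectrogram, Complex.star_def, Complex.mul_conj, Complex.normSq_eq_norm_sq]
  rw [h2] at h1
  have h3 : ‖(spectrogram f w : ℂ) - (σ w : ℂ)‖ ≤ ε / 2 := by
    rw [← Complex.ofReal_sub, Complex.norm_real, Real.norm_eq_abs, abs_sub_comm]
    exact hσ w
  refine (norm_sub_le_norm_sub_add_norm_sub _ (spectrogram f w : ℂ) _).trans ?_
  nlinarith

/-- Minimality enters only through the entry bound 1 inherited from the rank-one candidate. The
midpoint of `l` and `l'` stays in the box by convexity, so the localization estimate applies to the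
difference of the two matrices. -/
theorem norm_evaluation_sub_le (hcal : WellCalibrated f T S R r s ε ε')
    (hG : ∀ p, ‖gabor f p‖ ≤ 1)
    (hσ : ∀ w : setOmega T S R s, |σ w - spectrogram f w| ≤ ε / 2) (hc1 : ∀ l, ‖c l‖ ≤ 1)
    (hc : ∀ z : Plane, |z 0| ≤ T + R → |z 1| ≤ S + R →
      ‖∑ l : setGamma T S R, c l * gaborKernel z l - gabor f z‖ ≤ ε / 8)
    {A : Matrix (setGamma T S R) (setGamma T S R) ℂ}
    (hA : IsSolution1 (setGamma T S R) (setOmega T S R s) σ ε A)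
    (l l' : setLambda T S) (hll : ‖(l : Plane) - l'‖ ≤ r) :
    ‖evaluation (ansatzFun A) l ((l' : Plane) - l) - gabor f l' * star (gabor f l)‖ ≤ ε' := by
  have hε := hcal.eps_pos
  have hεs := hcal.eps_small hG
  have hR := hcal.R_pos
  have : Nonempty (setGamma T S R) := ⟨⟨0, zero_mem_gaborRect
    (by linarith [hcal.T_pos]) (by linarith [hcal.S_pos])⟩⟩
  set A₀ := Matrix.vecMulVec c (star c) with hA₀
  have hfeas : A₀ ∈ feasible1 (setGamma T S R) (setOmega T S R s) σ ε :=
    vecMulVec_mem_feasible1 hε (by linarith) hG hσ hc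
  have hA₀1 : ∀ l m, ‖A₀ l m‖ ≤ 1 := by
    intro l m
    rw [hA₀, Matrix.vecMulVec_apply, Pi.star_apply, norm_mul, norm_star]
    exact mul_le_one₀ (hc1 l) (norm_nonneg _) (hc1 m)
  have hobj : objective1 A₀ ≤ 1 := ciSup_le fun l => (Complex.re_le_norm _).trans (hA₀1 l l)
  have hA1 : ∀ l m, ‖A l m‖ ≤ 1 := norm_apply_le_of_diag_le hA.1.1 fun l =>
    (re_diag_le_objective1 A l).trans ((hA.2 hfeas).trans hobj)
  have hB : ∀ l m, ‖(A - A₀) l m‖ ≤ 2 := fun l m =>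
    (norm_sub_le (A l m) (A₀ l m)).trans (by linarith [hA1 l m, hA₀1 l m])
  have hsamp : ∀ w ∈ setOmega T S R s, ‖ansatzFun (A - A₀) (toC2 w)‖ ≤ 2 * ε := by
    intro w hw
    rw [ansatzFun_sub]
    have h1 := hA.1.2 ⟨w, hw⟩
    have h2 := hfeas.2 ⟨w, hw⟩
    rw [norm_sub_rev] at h2
    refine (norm_sub_le_norm_sub_add_norm_sub _ (σ ⟨w, hw⟩ : ℂ) _).trans ?_
    linarith
  have hmid : ∀ {a b B : ℝ}, |a| ≤ B → |b| ≤ B → |a + (b - a) / 2| ≤ B := by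
    intro a b B ha hb
    rw [abs_le] at *
    constructor <;> linarith
  have hloc := norm_evaluation_le_of_samples (T := T) (S := S) (R := R) hcal.s_pos hε hR.le
    (hcal.two_le_log hG)
    hcal.s_le (hcal.exp_neg_le hG) hB hsamp (l := (l : Plane)) (u := (l' : Plane) - l)
    (hmid l.2.1 l'.2.1) (hmid l.2.2.1 l'.2.2.1)
  have hsub : evaluation (ansatzFun (A - A₀)) l ((l' : Plane) - l) =
      evaluation (ansatzFun A) l ((l' : Plane) - l) -
        evaluation (ansatzFun A₀) l ((l' : Plane) - l) := by
    simp only [evaluation, ansatzFun_sub, sub_mul]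
  rw [hsub, ← norm_sq_plane, evaluation_ansatzFun_vecMulVec, add_sub_cancel] at hloc
  have hin : ∀ l : setLambda T S,
      ‖∑ m : setGamma T S R, c m * gaborKernel l m - gabor f l‖ ≤ ε / 8 := fun l =>
    hc l (l.2.1.trans (by linarith)) (l.2.2.1.trans (by linarith))
  have h2 := norm_mul_star_sub_le (hin l') (hin l) (hG l') (hG l)
  have h3 := (norm_sub_le_norm_sub_add_norm_sub _ _ _).trans (add_le_add hloc h2)
  refine h3.trans ?_
  have hexp : Real.exp (17 * Real.pi / 32 * ‖(l' : Plane) - l‖ ^ 2) ≤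
      Real.exp (17 * Real.pi / 32 * r ^ 2) := by
    rw [norm_sub_rev]
    have := Real.pi_pos
    gcongr
  have ha : 1 ≤ Real.exp (17 * Real.pi / 32 * r ^ 2) :=
    Real.one_le_exp (mul_nonneg (div_nonneg (mul_nonneg (by norm_num) Real.pi_pos.le) (by norm_num))
      (sq_nonneg _))
  set a := Real.exp (17 * Real.pi / 32 * r ^ 2) with ha'
  have hs0 := Real.sqrt_nonneg ε
  have h4 : ε ≤ √ε := by
    have := Real.sq_sqrt hε.le
    have : √ε ≤ 1 := Real.sqrt_le_one.mpr (by linarith)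
    nlinarith
  have h5 : √ε ≤ √ε * a := le_mul_of_one_le_right hs0 ha
  have h6 : ε / 8 * (2 + ε / 8) ≤ ε := by nlinarith
  have h7 : 15400 * √ε * Real.exp (17 * Real.pi / 32 * ‖(l' : Plane) - l‖ ^ 2) ≤
      15400 * √ε * a := mul_le_mul_of_nonneg_left hexp (by positivity)
  rw [hcal.eps'_eq]
  nlinarith

end Recovery

/-! ### The final estimate -/

/-- Here `64 = 2·2·16`: the propagation factor, the tolerance `2ε'` and the degree bound `16r²`. The
trace error contributes at most `ε'` and the misalignment at most `6κ = 384ε'r²E/λ₂`, which fits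
under `20² = 400`. -/
theorem error_bound_of_trace {E N t lam r ε' κ : ℝ} (hE : 0 < E) (hN : 1 ≤ N) (hlam : 0 < lam)
    (hr : 0 < r) (hε' : 0 < ε') (h1 : 4.29 * ε' ≤ E / N ^ 2) (h2 : 4.29 * ε' ≤ lam / (192 * r ^ 2))
    (ht : |t - E| ≤ 2 * N * ε') (hκ : κ = 64 * ε' * r ^ 2 * E / lam) :
    2 * κ < t ∧ (√t - √E) ^ 2 + 2 * √t * √E * (κ / (t - κ)) ≤
      ε' * (1 + 20 * r * √(E / lam)) ^ 2 := by
  rw [le_div_iff₀ (by positivity)] at h1 h2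
  have hκ0 : 0 ≤ κ := by rw [hκ]; positivity
  have hκ1 : κ ≤ 0.078 * E := by
    rw [hκ, div_le_iff₀ hlam]
    nlinarith
  have hNε : 2 * N * ε' ≤ 0.467 * E := by nlinarith
  obtain ⟨ht1, ht2⟩ := abs_le.mp ht
  have ht0 : 0 < t := by linarith
  refine ⟨by linarith, ?_⟩
  have hsE : 0 < √E := Real.sqrt_pos.mpr hE
  have hst : 0 < √t := Real.sqrt_pos.mpr ht0
  have hE2 := Real.sq_sqrt hE.le
  have ht3 := Real.sq_sqrt ht0.le
  have hfirst : (√t - √E) ^ 2 ≤ ε' := by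
    have e1 : (√t - √E) ^ 2 * (√t + √E) ^ 2 = (t - E) ^ 2 := by
      rw [← mul_pow, ← ht3, ← hE2, Real.sqrt_sq hst.le, Real.sqrt_sq hsE.le]; ring
    have e2 : (t - E) ^ 2 ≤ (2 * N * ε') ^ 2 := sq_le_sq' ht1 ht2
    have e3 : (2 * N * ε') ^ 2 ≤ ε' * E := by nlinarith
    have e4 : E ≤ (√t + √E) ^ 2 := by nlinarith
    have e5 : (√t - √E) ^ 2 * E ≤ ε' * E :=
      (mul_le_mul_of_nonneg_left e4 (sq_nonneg _)).trans (e1.le.trans (e2.trans e3))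
    exact le_of_mul_le_mul_right e5 hE
  have hsecond : 2 * √t * √E * (κ / (t - κ)) ≤ 6 * κ := by
    have e1 : √t ≤ 1.22 * √E := by
      rw [← Real.sqrt_sq (by positivity : (0 : ℝ) ≤ 1.22 * √E)]
      refine Real.sqrt_le_sqrt ?_
      rw [mul_pow, hE2]
      norm_num
      linarith
    have e2 : √t * √E ≤ 1.22 * E := by nlinarith
    rw [← mul_div_assoc, div_le_iff₀ (by linarith)]
    have e3 : 2 * √t * √E ≤ 6 * (t - κ) := by linarith
    nlinarith
  have hq : 0 ≤ E / lam := by positivity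
  have hq2 := Real.sq_sqrt hq
  have hκ2 : κ = 64 * ε' * r ^ 2 * (E / lam) := by rw [hκ]; ring
  have hfin : ε' * (1 + 20 * r * √(E / lam)) ^ 2 =
      ε' + 400 * (ε' * r ^ 2 * (E / lam)) + 40 * (ε' * r * √(E / lam)) := by
    linear_combination 400 * ε' * r ^ 2 * hq2
  have p1 : 0 ≤ ε' * r ^ 2 * (E / lam) := by positivity
  have p2 : 0 ≤ ε' * r * √(E / lam) := by positivity
  rw [hfin]
  linarith

/-- `177² ≥ 3.1·10⁴` and `2·0.84 ≥ 17π/32`. -/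
theorem sqrt_eps'_le {r ε : ℝ} (hε : 0 < ε) :
    √(3.1 * 10 ^ 4 * √ε * Real.exp (17 * Real.pi / 32 * r ^ 2)) ≤
      177 * Real.exp (0.84 * r ^ 2) * ε ^ (1 / 4 : ℝ) := by
  rw [Real.sqrt_le_iff]
  refine ⟨by positivity, ?_⟩
  have e1 : (ε ^ (1 / 4 : ℝ)) ^ 2 = √ε := by
    rw [← Real.rpow_natCast, ← Real.rpow_mul hε.le, Real.sqrt_eq_rpow]; norm_num
  have e2 : Real.exp (17 * Real.pi / 32 * r ^ 2) ≤ Real.exp (0.84 * r ^ 2) ^ 2 := by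
    rw [← Real.exp_nat_mul, Real.exp_le_exp]
    push_cast
    nlinarith [Real.pi_lt_d2, sq_nonneg r]
  rw [mul_pow, mul_pow, e1]
  have h := mul_le_mul_of_nonneg_left e2 (Real.sqrt_nonneg ε)
  have h0 : 0 ≤ √ε * Real.exp (0.84 * r ^ 2) ^ 2 := by positivity
  linarith

theorem topEigenvector_gaborSamples {f : ℝ → ℂ} {T S R r s ε ε' : ℝ}
    (hcal : WellCalibrated f T S R r s ε ε') {Y : Matrix (setLambda T S) (setLambda T S) ℂ}
    (hY : Y.PosSemidef) (hYx : ∀ l l' : setLambda T S, ‖(l : Plane) - l'‖ ≤ r →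
      ‖Y l' l - gabor f l' * star (gabor f l)‖ ≤ 2 * ε') :
    HasSimpleTopEigenvalue Y ∧
      ∀ v : EuclideanSpace ℂ (setLambda T S), IsTopEigenvector Y v →
        ∃ θ : ℝ,
          ‖((Real.sqrt Y.trace.re : ℝ) : ℂ) • v -
              Complex.exp (Complex.I * (θ : ℂ)) • gaborSamples f (setLambda T S)‖ ≤
            177 * Real.exp (0.84 * r ^ 2) *
              (1 + 20 * r * Real.sqrt
                (gaborEnergy f (setLambda T S) / spectralGap f (setLambda T S) r)) *
              ε ^ (1 / 4 : ℝ) := by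
  have hr := hcal.r_pos
  have hε' := hcal.eps'_pos
  have : Nonempty (setLambda T S) := ⟨⟨0, zero_mem_gaborRect hcal.T_pos.le hcal.S_pos.le⟩⟩
  have hN : (1 : ℝ) ≤ Fintype.card (setLambda T S) := by exact_mod_cast Fintype.card_pos
  have h1 := hcal.eps'_le.trans (min_le_left _ _)
  have h2 := hcal.eps'_le.trans (min_le_right _ _)
  set E := gaborEnergy f (setLambda T S) with hEdef
  set N : ℝ := (Fintype.card (setLambda T S) : ℝ) with hNdef
  set lam := spectralGap f (setLambda T S) r with hlamdef
  -- Positivity of the energy and of the gap is forced by `ε' > 0` through the calibration.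
  have hE : 0 < E := by
    have : 0 < E / N ^ 2 := by linarith
    exact (div_pos_iff_of_pos_right (by positivity)).mp this
  have hlam : 0 < lam := by
    have : 0 < lam / (192 * r ^ 2) := by linarith
    exact (div_pos_iff_of_pos_right (by positivity)).mp this
  set x := gaborSamples f (setLambda T S) with hx
  have hxv : ∀ l, x l = gabor f l := fun _ => rfl
  have hxE : ‖x‖ ^ 2 = E := EuclideanSpace.norm_sq_eq x
  have hx0 : x ≠ 0 := by
    intro h
    rw [h, norm_zero] at hxE
    norm_num at hxE
    linarith
  have hdiag : ∀ u, ‖Y u u - x u * star (x u)‖ ≤ 2 * ε' := fun u =>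
    hYx u u (by rw [sub_self, norm_zero]; exact hr.le)
  have hedge : ∀ u v, (proximityGraph (setLambda T S) r).Adj u v →
      ‖Y u v - x u * star (x v)‖ ≤ 2 * ε' := fun u v huv =>
    hYx v u (by rw [norm_sub_rev]; exact huv.2.le)
  have hconc := secondEigenvalue_mul_trace_sub_le (proximityGraph (setLambda T S) r) x hx0 hlam hY
    hdiag hedge (card_adj_proximityGraph_le hr)
  set κ := 64 * ε' * r ^ 2 * E / lam with hκ
  have hQ : ∀ q : ℝ, lam * q ≤ 2 * (2 * ε') * (16 * r ^ 2) * ‖x‖ ^ 2 → q ≤ κ := by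
    intro q hq
    rw [hxE] at hq
    rw [hκ, le_div_iff₀ hlam]
    linarith
  have htr : |Y.trace.re - E| ≤ 2 * N * ε' := by
    have e : Y.trace - (E : ℂ) = ∑ u, (Y u u - x u * star (x u)) := by
      rw [Finset.sum_sub_distrib, Matrix.trace, hEdef, gaborEnergy, Complex.ofReal_sum]
      congr 1
      refine Finset.sum_congr rfl fun u _ => ?_
      rw [hxv, Complex.star_def, Complex.mul_conj, Complex.normSq_eq_norm_sq]
    have h3 : |(Y.trace - (E : ℂ)).re| ≤ ‖Y.trace - (E : ℂ)‖ := Complex.abs_re_le_norm _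
    rw [Complex.sub_re, Complex.ofReal_re] at h3
    refine h3.trans ?_
    rw [e]
    refine (norm_sum_le_of_le _ fun u _ => hdiag u).trans (le_of_eq ?_)
    rw [Finset.sum_const, nsmul_eq_mul, Finset.card_univ]
    ring
  obtain ⟨hκt, hbound⟩ := error_bound_of_trace hE hN hlam hr hε' h1 h2 htr hκ
  obtain ⟨hsimple, hclose⟩ := topEigenvector_close hY x hx0 hκt (hQ _ hconc)
  refine ⟨hsimple, fun v hv => ?_⟩
  obtain ⟨θ, hθ⟩ := hclose v hv
  refine ⟨θ, ?_⟩
  have hxn : ‖x‖ = √E := by rw [← hxE, Real.sqrt_sq (norm_nonneg _)]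
  rw [hxn] at hθ
  have hsq := hθ.trans hbound
  have hq : 0 ≤ 1 + 20 * r * √(E / lam) := by positivity
  have h4 : ε' * (1 + 20 * r * √(E / lam)) ^ 2 = (√ε' * (1 + 20 * r * √(E / lam))) ^ 2 := by
    rw [mul_pow, Real.sq_sqrt hε'.le]
  rw [h4] at hsq
  have h5 := (pow_le_pow_iff_left₀ (norm_nonneg _) (by positivity) two_ne_zero).mp hsq
  refine h5.trans ?_
  have h6 : √ε' ≤ 177 * Real.exp (0.84 * r ^ 2) * ε ^ (1 / 4 : ℝ) := by
    rw [hcal.eps'_eq]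
    exact sqrt_eps'_le hcal.eps_pos
  calc √ε' * (1 + 20 * r * √(E / lam))
      ≤ 177 * Real.exp (0.84 * r ^ 2) * ε ^ (1 / 4 : ℝ) * (1 + 20 * r * √(E / lam)) :=
        mul_le_mul_of_nonneg_right h6 hq
    _ = _ := by ring

end

theorem theorem1 (f : ℝ → ℂ) (hf : MemLp f 2 volume)
    (hSf : eLpNorm (spectrogram f) ⊤ volume ≤ 1)
    (T S R r s ε ε' : ℝ) (hcal : WellCalibrated f T S R r s ε ε')
    (σ : setOmega T S R s → ℝ)
    (hσ : ∀ w : setOmega T S R s, |σ w - spectrogram f w| ≤ ε / 2) :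
    -- the first convex program is feasible, and has a solution
    (feasible1 (setGamma T S R) (setOmega T S R s) σ ε).Nonempty ∧
    (∃ A, IsSolution1 (setGamma T S R) (setOmega T S R s) σ ε A) ∧
    ∀ A, IsSolution1 (setGamma T S R) (setOmega T S R s) σ ε A →
      -- the second convex program is feasible
      (feasible2 (setLambda T S) A r ε').Nonempty ∧
      ∀ Y ∈ feasible2 (setLambda T S) A r ε',
        HasSimpleTopEigenvalue Y ∧
        ∀ v : EuclideanSpace ℂ (setLambda T S), IsTopEigenvector Y v →
          ∃ θ : ℝ,
            ‖((Real.sqrt Y.trace.re : ℝ) : ℂ) • v -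
                Complex.exp (Complex.I * (θ : ℂ)) • gaborSamples f (setLambda T S)‖ ≤
              177 * Real.exp (0.84 * r ^ 2) *
                (1 + 20 * r * Real.sqrt
                  (gaborEnergy f (setLambda T S) / spectralGap f (setLambda T S) r)) *
                ε ^ (1 / 4 : ℝ) := by
  have hG := norm_gabor_le_one hf hSf
  obtain ⟨c, hc1, hc⟩ := hcal.exists_coefficients hf hG
  have hfeas := vecMulVec_mem_feasible1 hcal.eps_pos (by linarith [hcal.eps_small hG]) hG hσ hc
  have : Nonempty (setGamma T S R) := ⟨⟨0, zero_mem_gaborRect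
    (by linarith [hcal.T_pos, hcal.R_pos]) (by linarith [hcal.S_pos, hcal.R_pos])⟩⟩
  refine ⟨⟨_, hfeas⟩, exists_isSolution1 ⟨_, hfeas⟩, fun A hA => ?_⟩
  have hrec := norm_evaluation_sub_le hcal hG hσ hc1 hc hA
  refine ⟨?_, fun Y hY => topEigenvector_gaborSamples hcal hY.1 fun l l' hll => ?_⟩
  -- The exact rank-one matrix `x x*` is feasible for program 2; the triangle inequality then puts
  -- every feasible `Y` within `2ε'` of it on the constrained entries.
  · refine ⟨Matrix.vecMulVec (fun l : setLambda T S => gabor f l) (star fun l => gabor f l),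
      Matrix.posSemidef_vecMulVec_self_star _, fun l l' hll => ?_⟩
    rw [norm_sub_rev, Matrix.vecMulVec_apply]
    exact hrec l l' hll
  · have h := (norm_sub_le_norm_sub_add_norm_sub _ _ _).trans
      (add_le_add (hY.2 l l' hll) (hrec l l' hll))
    exact h.trans (by linarith)
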